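/- A \emph{SAS$^+$ instance} $\langle V,D,A,I,G\rangle$ consists of a finite set $V$ of variables, a finite domain $D$, a finite set $A$ of actions, an initial state $I\in D^V$ and a goal $G\in (D\cup\{\mathbf u\})^V$, where $\mathbf u\notin D$ means ``undefined''. Every action $a$ has a precondition $\mathrm{pre}(a)$ and an effect $\mathrm{eff}(a)$, both in $(D\cup\{\mathbf u\})^V$. It is valid in a state $s\in D^V$ if $\mathrm{pre}(a)[v]\in\{s[v],\mathbf u\}$ for all $v\in V$; its result in $s$ is the state $t$ with $t[v]=\mathrm{eff}(a)[v]$ if $\mathrm{eff}(a)[v]\neq\mathbf u$ and $t[v]=s[v]$ otherwise. A \emph{plan} is a finite sequence of actions of $A$ that can be applied one after the other from $I$, each in a state in which it is valid, and that ends in a state $s$ with $G[v]\in\{s[v],\mathbf u\}$ for all $v\in V$. $(0,2)$-\textsc{Bounded SAS$^+$ Planning} is the following parameterized problem: given a SAS$^+$ instance in which every action has no preconditions ($\mathrm{pre}(a)[v]=\mathbf u$ for all $v$) and at most two effects ($\mathrm{eff}(a)[v]\ne\mathbf u$ for at most two $v$), and an integer $k\ge 1$, which is the parameter, decide whether the instance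 has a plan of length at most $k$. \textbf{Theorem.} $(0,2)$-\textsc{Bounded SAS$^+$ Planning} is fixed-parameter tractable: there are an algorithm (a deterministic Turing machine), a computable function $f:\mathbb N\to\mathbb N$ and a constant $c$ such that the algorithm decides every input $\langle w,k\rangle$ (a string $w$, which may encode an instance, and a number $k$) in at most $f(k)\cdot n^{c}$ steps, where $n=|\langle w,k\rangle|$ is the input size. -/

import Mathlib

/-! ## Parameterized problems and fixed-parameter tractability -/

/-- A parameterized problem over the alphabet `Γ`: a set of pairs of a string and a parameter. -/
abbrev ParameterizedProblem (Γ : Type) : Type := Set (List Γ × ℕ)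

/-- The string `⟨w, k⟩` that an algorithm reads: the main part `w`, a separator (`none`), and
the parameter `k` in binary. Its length is the input size `|⟨w, k⟩|`. -/
def pairInput {Γ : Type} (w : List Γ) (k : ℕ) : List (Option (Γ ⊕ Bool)) :=
  w.map (fun x => some (Sum.inl x)) ++
    none :: (Computability.encodeNat k).map (fun b => some (Sum.inr b))

/-- `L` is fixed-parameter tractable: one deterministic Turing machine (with finitely many
stacks, Mathlib's `Turing.FinTM2`), a computable function `f` and a constant `c` exist such that
on every input `⟨w, k⟩` the machine halts after at most `f k * |⟨w, k⟩| ^ c` steps, and its output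
is the bit that says whether `(w, k)` belongs to `L`. -/
def FixedParameterTractable {Γ : Type} (L : ParameterizedProblem Γ) : Prop :=
  ∃ (M : Turing.TM2ComputableAux (Option (Γ ⊕ Bool)) Bool) (f : ℕ → ℕ) (c : ℕ),
    Computable f ∧
    ∀ (w : List Γ) (k : ℕ), ∃ b : Bool, (b = true ↔ (w, k) ∈ L) ∧
      Nonempty (Turing.TM2OutputsInTime M.tm
        ((pairInput w k).map M.inputAlphabet.symm)
        (some ((Computability.encodeBool b).map M.outputAlphabet.symm))
        (f k * (pairInput w k).length ^ c))

namespace SASPlus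

/-! ## The planning framework -/

/-- A total state over the variables `V` and the domain `D`. -/
abbrev State (V D : Type) : Type := V → D

/-- A partial state; `none` is the undefined value. -/
abbrev PartialState (V D : Type) : Type := V → Option D

/-- An action: a precondition and an effect, both partial states. -/
structure Action (V D : Type) where
  pre : PartialState V D
  eff : PartialState V D

namespace Action

variable {V D : Type}

/-- `a` is valid in the state `s`. -/
def Valid (a : Action V D) (s : State V D) : Prop :=
  ∀ v, a.pre v = some (s v) ∨ a.pre v = none

/-- The result of `a` in the state `s`. -/
def result (a : Action V D) (s : State V D) : State V D :=
  fun v => (a.eff v).getD (s v)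

/-- The number of preconditions of `a`. -/
def numPre [Fintype V] (a : Action V D) : ℕ :=
  (Finset.univ.filter fun v => (a.pre v).isSome = true).card

/-- The number of effects of `a`. -/
def numEff [Fintype V] (a : Action V D) : ℕ :=
  (Finset.univ.filter fun v => (a.eff v).isSome = true).card

end Action

/-- `IsPlanFrom s ω t`: the actions of `ω` can be applied one after the other starting in `s`,
each of them in a state in which it is valid, and lead to the state `t`. -/
def IsPlanFrom {V D : Type} (s : State V D) : List (Action V D) → State V D → Prop
  | [], t => s = t
  | a :: ω, t => a.Valid s ∧ IsPlanFrom (a.result s) ω t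

/-- An SAS⁺ instance with variables `V` and domain `D`. The finite set of actions is given by
listing its elements. -/
structure Instance (V D : Type) where
  actions : List (Action V D)
  init : State V D
  goal : PartialState V D

namespace Instance

variable {V D : Type}

/-- `s` is a goal state. -/
def IsGoalState (P : Instance V D) (s : State V D) : Prop :=
  ∀ v, P.goal v = some (s v) ∨ P.goal v = none

/-- `ω` is a plan for `P`: a sequence of actions of `P` leading from the initial state to some
goal state. -/
def IsPlan (P : Instance V D) (ω : List (Action V D)) : Prop :=
  (∀ a ∈ ω, a ∈ P.actions) ∧ ∃ t, IsPlanFrom P.init ω t ∧ P.IsGoalState t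

/-- Every action has at most `p` preconditions and at most `e` effects. -/
def Bounded [Fintype V] (P : Instance V D) (p e : ℕ) : Prop :=
  ∀ a ∈ P.actions, a.numPre ≤ p ∧ a.numEff ≤ e

end Instance

/-! ## Instances as strings

An instance with `n` variables and `d` domain values is written over the variables `Fin n` and the
domain `Fin d`. States are written as the tuples of their `n` values. The value with index `x` is
written with `x` strokes; since the domain itself is part of the instance and is
written with `d` strokes, this changes the size only polynomially compared with any other
numbering of an explicitly listed domain. -/

/-- The alphabet for SAS⁺ instances. -/
inductive Symbol
  /-- a stroke, for counting -/
  | one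
  /-- the undefined value -/
  | undef
  /-- end of an entry of a tuple -/
  | endEntry
  /-- end of a number or of a tuple -/
  | endRow
  deriving DecidableEq

instance : Fintype Symbol where
  elems := {Symbol.one, Symbol.undef, Symbol.endEntry, Symbol.endRow}
  complete x := by cases x <;> decide

/-- A value of the extended domain. -/
def encodeValue {d : ℕ} : Option (Fin d) → List Symbol
  | none => [Symbol.undef, Symbol.endEntry]
  | some x => List.replicate x Symbol.one ++ [Symbol.endEntry]

/-- A partial state, as the tuple of its values. -/
def encodePartialState {n d : ℕ} (s : PartialState (Fin n) (Fin d)) : List Symbol :=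
  (List.ofFn fun v => encodeValue (s v)).flatten ++ [Symbol.endRow]

/-- An action: its precondition, then its effect. -/
def encodeAction {n d : ℕ} (a : Action (Fin n) (Fin d)) : List Symbol :=
  encodePartialState a.pre ++ encodePartialState a.eff

/-- An instance: number of variables, size of the domain, initial state, goal, actions. -/
def encodeInstance {n d : ℕ} (P : Instance (Fin n) (Fin d)) : List Symbol :=
  List.replicate n Symbol.one ++ [Symbol.endRow] ++
  List.replicate d Symbol.one ++ [Symbol.endRow] ++
  encodePartialState (fun v => some (P.init v)) ++
  encodePartialState P.goal ++
  (P.actions.map encodeAction).flatten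

/-- `(p, e)`-Bounded SAS⁺ Planning, with the plan length bound `k` as the parameter: `(w, k)`
belongs to it if `w` encodes an SAS⁺ instance all of whose actions have at most `p` preconditions
and at most `e` effects, `k` is positive, and the instance has a plan of length at most `k`. -/
def boundedPlanning (p e : ℕ) : ParameterizedProblem Symbol :=
  {x | 0 < x.2 ∧ ∃ (n d : ℕ) (P : Instance (Fin n) (Fin d)),
    encodeInstance P = x.1 ∧ P.Bounded p e ∧
    ∃ ω : List (Action (Fin n) (Fin d)), P.IsPlan ω ∧ ω.length ≤ x.2}

end SASPlus

/-! Without preconditions every sequence of actions is applicable, and the final value of a variable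
comes from its last writer, or from the initial state if there is none. So a sequence is a plan iff
every effect that contradicts the goal (a bad effect) is overwritten later and every initially wrong
variable is written (`isPlanFrom_goal_iff`).

Actions all of whose variables are written again later can be deleted. Each remaining action writes
some variable for the last time; as it has at most two effects, at most one of them is bad, and a
single later action repairs it. Taking this action as parent, and a virtual root for actions without
bad effects, turns the plan into a tree. Conversely, listing a tree with children before parents
gives a sequence with all bad effects repaired. Hence plans of length at most `k` correspond to
trees with at most `k` actions that write all wrong variables (`covers_none_iff`,
`Instance.exists_plan_iff`).

A plan of length `k` writes at most `2k` variables, so more wrong variables mean that there is none.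
Otherwise the sets of wrong variables are numbers below `4 ^ k`, and dynamic programming decides,
for each budget `c ≤ k`, root `x` and set `S`, whether a tree at `x` with at most `c` further
actions writes `S`: either `x` alone does, or a child is attached and `S` and the budget are split
(`Encodes.newEntry_iff`, `answer_iff`). The table and the work per entry are polynomial in the input
length plus `4 ^ k`.

The machine is obtained from structured programs with unary counters, which compile step by step to
`Turing.TM2` (`Exec.steps`, `exists_machine`). Polynomial-time functions on counters are closed
under bounded loops, sums and quantifiers (`CompIn.loop`, `PolyComp.sum`, `PolyDec.all`), so every
predicate of the algorithm is decided in polynomial time by following its definition. -/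

/-! ## Structured programs on stacks -/

namespace StackProg

/-- Structured programs over the stacks `K` with internal state `σ`. -/
inductive Prog (K : Type) (Γ : K → Type) (σ : Type) : Type
  | push (k : K) (f : σ → Γ k) : Prog K Γ σ
  | pop (k : K) (f : σ → Option (Γ k) → σ) : Prog K Γ σ
  | load (f : σ → σ) : Prog K Γ σ
  | seq (p q : Prog K Γ σ) : Prog K Γ σ
  | ite (c : σ → Bool) (p q : Prog K Γ σ) : Prog K Γ σ
  | whileDo (c : σ → Bool) (p : Prog K Γ σ) : Prog K Γ σ

namespace Prog

variable {K : Type} {Γ : K → Type} {σ : Type}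

/-- `p.Exec s t n`: started in `s`, the program `p` terminates in `t` after `n` steps. -/
inductive Exec [DecidableEq K] : Prog K Γ σ → σ × (∀ k, List (Γ k)) → σ × (∀ k, List (Γ k)) →
    ℕ → Prop
  | push (k : K) (f : σ → Γ k) (v S) :
      Exec (push k f) (v, S) (v, Function.update S k (f v :: S k)) 1
  | pop (k : K) (f : σ → Option (Γ k) → σ) (v S) :
      Exec (pop k f) (v, S) (f v (S k).head?, Function.update S k (S k).tail) 1
  | load (f : σ → σ) (v S) : Exec (load f) (v, S) (f v, S) 1
  | seq {p q s t u m n} : Exec p s t m → Exec q t u n → Exec (seq p q) s u (m + n)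
  | ite_true {c p q s t n} : c s.1 = true → Exec p s t n → Exec (ite c p q) s t (n + 1)
  | ite_false {c p q s t n} : c s.1 = false → Exec q s t n → Exec (ite c p q) s t (n + 1)
  | while_false {c p s} : c s.1 = false → Exec (whileDo c p) s s 1
  | while_true {c p s t u m n} : c s.1 = true → Exec p s t m → Exec (whileDo c p) t u n →
      Exec (whileDo c p) s u (m + n + 1)

/-- A step pushes at most one symbol. With unary counters this makes a time bound a bound on
computed values. -/
theorem Exec.length_le [DecidableEq K] {p : Prog K Γ σ} {s t : σ × (∀ k, List (Γ k))} {n : ℕ}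
    (h : Exec p s t n) (k : K) : (t.2 k).length ≤ (s.2 k).length + n := by
  induction h with
  | push j f v S =>
    by_cases hk : k = j
    · subst hk; simp
    · simp [hk]
  | pop j f v S =>
    by_cases hk : k = j
    · subst hk; simp; omega
    · simp [hk]
  | load f v S => simp
  | seq _ _ h1 h2 => omega
  | ite_true _ _ h => omega
  | ite_false _ _ h => omega
  | while_false _ => omega
  | while_true _ _ _ h1 h2 => omega

/-- The control points of a program. -/
def Lab : Prog K Γ σ → Type
  | push _ _ => Unit
  | pop _ _ => Unit
  | load _ => Unit
  | seq p q => Lab p ⊕ Lab q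
  | ite _ p q => Option (Lab p ⊕ Lab q)
  | whileDo _ p => Option (Lab p)

instance lab_finite : (p : Prog K Γ σ) → Finite (Lab p)
  | push _ _ => inferInstanceAs (Finite Unit)
  | pop _ _ => inferInstanceAs (Finite Unit)
  | load _ => inferInstanceAs (Finite Unit)
  | seq p q =>
    have := lab_finite p
    have := lab_finite q
    inferInstanceAs (Finite (Lab p ⊕ Lab q))
  | ite _ p q =>
    have := lab_finite p
    have := lab_finite q
    inferInstanceAs (Finite (Option (Lab p ⊕ Lab q)))
  | whileDo _ p =>
    have := lab_finite p
    inferInstanceAs (Finite (Option (Lab p)))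

/-- The first control point. -/
def entry : (p : Prog K Γ σ) → Lab p
  | push _ _ => ()
  | pop _ _ => ()
  | load _ => ()
  | seq p _ => Sum.inl (entry p)
  | ite _ _ _ => none
  | whileDo _ _ => none

open Turing.TM2 in
/-- The machine code of a program whose control points are embedded in `Λ` and which continues
at `exit`. -/
def code {Λ : Type} : (p : Prog K Γ σ) → (Lab p → Λ) → Λ → Lab p → Stmt Γ Λ σ
  | push k f, _, exit => fun _ => Stmt.push k f (Stmt.goto fun _ => exit)
  | pop k f, _, exit => fun _ => Stmt.pop k f (Stmt.goto fun _ => exit)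
  | load f, _, exit => fun _ => Stmt.load f (Stmt.goto fun _ => exit)
  | seq p q, emb, exit => fun l => Sum.rec
      (fun l => code p (fun l => emb (Sum.inl l)) (emb (Sum.inr (entry q))) l)
      (fun l => code q (fun l => emb (Sum.inr l)) exit l) l
  | ite c p q, emb, exit => fun l => Option.rec
      (Stmt.branch c (Stmt.goto fun _ => emb (some (Sum.inl (entry p))))
        (Stmt.goto fun _ => emb (some (Sum.inr (entry q)))))
      (fun l => Sum.rec
        (fun l => code p (fun l => emb (some (Sum.inl l))) exit l)
        (fun l => code q (fun l => emb (some (Sum.inr l))) exit l) l) l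
  | whileDo c p, emb, exit => fun l => Option.rec
      (Stmt.branch c (Stmt.goto fun _ => emb (some (entry p))) (Stmt.goto fun _ => exit))
      (fun l => code p (fun l => emb (some l)) (emb none) l) l

/-- Each control point holds one instruction followed by a jump, so step counts agree exactly.
Arbitrary `emb` and `exit` let the induction treat a subprogram at its place inside the whole
machine. -/
theorem Exec.steps [DecidableEq K] {p : Prog K Γ σ} {s t : σ × (∀ k, List (Γ k))} {n : ℕ}
    (h : Exec p s t n) {Λ : Type} (M : Λ → Turing.TM2.Stmt Γ Λ σ) (emb : Lab p → Λ) (exit : Λ)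
    (hM : ∀ l, M (emb l) = code p emb exit l) :
    (flip bind (Turing.TM2.step M))^[n] (some ⟨some (emb (entry p)), s.1, s.2⟩) =
      some ⟨some exit, t.1, t.2⟩ := by
  induction h generalizing exit with
  | push k f v S =>
    have := hM (entry _)
    simp [flip, Turing.TM2.step, this, code]
  | pop k f v S =>
    have := hM (entry _)
    simp [flip, Turing.TM2.step, this, code]
  | load f v S =>
    have := hM (entry _)
    simp [flip, Turing.TM2.step, this, code]
  | @seq p q s t u m n _ _ h1 h2 =>
    rw [Nat.add_comm, Function.iterate_add_apply]
    have e1 := h1 (fun l => emb (Sum.inl l)) (emb (Sum.inr (entry q))) fun l => hM (Sum.inl l)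
    have e2 := h2 (fun l => emb (Sum.inr l)) exit fun l => hM (Sum.inr l)
    exact (congrArg _ e1).trans e2
  | @ite_true c p q s t n hc _ h1 =>
    rw [Function.iterate_succ_apply]
    have e1 := h1 (fun l => emb (some (Sum.inl l))) exit fun l => hM (some (Sum.inl l))
    have := hM none
    refine Eq.trans (congrArg _ ?_) e1
    simp [flip, Turing.TM2.step, entry, this, code, hc]
  | @ite_false c p q s t n hc _ h1 =>
    rw [Function.iterate_succ_apply]
    have e1 := h1 (fun l => emb (some (Sum.inr l))) exit fun l => hM (some (Sum.inr l))
    have := hM none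
    refine Eq.trans (congrArg _ ?_) e1
    simp [flip, Turing.TM2.step, entry, this, code, hc]
  | @while_false c p s hc =>
    have := hM none
    simp [flip, Turing.TM2.step, entry, this, code, hc]
  | @while_true c p s t u m n hc _ _ h1 h2 =>
    have e1 := h1 (fun l => emb (some l)) (emb none) fun l => hM (some l)
    have e2 := h2 emb exit hM
    have := hM none
    rw [Function.iterate_succ_apply, Nat.add_comm m n, Function.iterate_add_apply]
    refine Eq.trans (congrArg _ (Eq.trans (congrArg _ ?_) e1)) e2
    simp [flip, Turing.TM2.step, entry, this, code, hc]

/-- The stacks that a program uses. -/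
def usedStacks [DecidableEq K] : Prog K Γ σ → Finset K
  | push k _ => {k}
  | pop k _ => {k}
  | load _ => ∅
  | seq p q => usedStacks p ∪ usedStacks q
  | ite _ p q => usedStacks p ∪ usedStacks q
  | whileDo _ p => usedStacks p

/-- The same program on a finite set of stacks containing all those which it uses. -/
def restrict [DecidableEq K] (A : Finset K) :
    (p : Prog K Γ σ) → p.usedStacks ⊆ A → Prog {k // k ∈ A} (fun k => Γ k.1) σ
  | push k f, h => push ⟨k, h (by simp [usedStacks])⟩ f
  | pop k f, h => pop ⟨k, h (by simp [usedStacks])⟩ f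
  | load f, _ => load f
  | seq p q, h => seq (restrict A p (Finset.union_subset_left h))
      (restrict A q (Finset.union_subset_right h))
  | ite c p q, h => ite c (restrict A p (Finset.union_subset_left h))
      (restrict A q (Finset.union_subset_right h))
  | whileDo c p, h => whileDo c (restrict A p h)

theorem update_restrict [DecidableEq K] {A : Finset K} {k : K} (hk : k ∈ A)
    (S : ∀ k, List (Γ k)) (x : List (Γ k)) :
    (fun j : {k // k ∈ A} => Function.update S k x j.1) =
      Function.update (β := fun j : {k // k ∈ A} => List (Γ j.1)) (fun j => S j.1) ⟨k, hk⟩ x := by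
  funext j
  obtain ⟨j, hj⟩ := j
  by_cases h : j = k
  · subst h; simp
  · rw [Function.update_of_ne h, Function.update_of_ne (by simpa using h)]

/-- Counters are indexed by all of `ℕ`, but a `Turing.FinTM2` has finitely many stacks. A run never
looks at stacks that its program does not mention. -/
theorem Exec.restrict [DecidableEq K] {p : Prog K Γ σ} {s t : σ × (∀ k, List (Γ k))} {n : ℕ}
    (h : Exec p s t n) (A : Finset K) (hA : p.usedStacks ⊆ A) :
    Exec (p.restrict A hA) (s.1, fun k => s.2 k.1) (t.1, fun k => t.2 k.1) n := by
  induction h with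
  | push k f v S =>
    have := Exec.push (⟨k, hA (by simp [usedStacks])⟩ : {k // k ∈ A}) (Γ := fun k => Γ k.1) f v
      (fun j => S j.1)
    rwa [← update_restrict] at this
  | pop k f v S =>
    have := Exec.pop (⟨k, hA (by simp [usedStacks])⟩ : {k // k ∈ A}) (Γ := fun k => Γ k.1) f v
      (fun j => S j.1)
    rwa [← update_restrict] at this
  | load f v S => exact Exec.load f v _
  | seq _ _ h1 h2 => exact Exec.seq (h1 _) (h2 _)
  | ite_true hc _ h1 => exact Exec.ite_true hc (h1 _)
  | ite_false hc _ h1 => exact Exec.ite_false hc (h1 _)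
  | while_false hc => exact Exec.while_false hc
  | while_true hc _ _ h1 h2 => exact Exec.while_true hc (h1 hA) (h2 hA)

end Prog

end StackProg

/-! ## Register programs -/

namespace StackProg

/-- The stacks of a register machine: an output stack, three data stacks and counters. -/
inductive Stk
  | out
  | data (i : Fin 3)
  | reg (i : ℕ)
  deriving DecidableEq

/-- The stack alphabets of a register machine. -/
def Alph (A : Type) : Stk → Type
  | .out => Bool
  | .data _ => A
  | .reg _ => A

/-- The programs of a register machine. -/
abbrev RProg (A : Type) : Type := Prog Stk (Alph A) (Option A)

section Runs

variable {A : Type} [Inhabited A]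

/-- The stack contents for an output, data and counter values. -/
def stk (o : List Bool) (d : Fin 3 → List A) (ρ : ℕ → ℕ) : ∀ k, List (Alph A k)
  | .out => o
  | .data i => d i
  | .reg i => List.replicate (ρ i) (default : A)

theorem update_stk_reg (o : List Bool) (d : Fin 3 → List A) (ρ : ℕ → ℕ) (i n : ℕ)
    (l : List A) (hl : l = List.replicate n default) :
    Function.update (β := fun k => List (Alph A k)) (stk o d ρ) (Stk.reg i) l =
      stk o d (Function.update ρ i n) := by
  subst hl
  funext k
  cases k with
  | out => rfl
  | data j => rfl
  | reg j =>
    by_cases h : j = i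
    · subst h
      refine (Function.update_self _ _ _).trans ?_
      simp only [stk, Function.update_self]
      rfl
    · refine (Function.update_of_ne (by simpa using h) _ _).trans ?_
      simp only [stk, Function.update_of_ne h]

theorem update_stk_data (o : List Bool) (d : Fin 3 → List A) (ρ : ℕ → ℕ) (i : Fin 3)
    (l : List A) :
    Function.update (β := fun k => List (Alph A k)) (stk o d ρ) (Stk.data i) l =
      stk o (Function.update d i l) ρ := by
  funext k
  cases k with
  | out => rfl
  | reg j => rfl
  | data j =>
    by_cases h : j = i
    · subst h
      exact (Function.update_self _ _ _).trans
        (Function.update_self (β := fun _ => List A) j l d).symm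
    · exact (Function.update_of_ne (by simpa using h) _ _).trans
        (Function.update_of_ne (β := fun _ => List A) h l d).symm

theorem update_stk_out (o o' : List Bool) (d : Fin 3 → List A) (ρ : ℕ → ℕ) :
    Function.update (β := fun k => List (Alph A k)) (stk o d ρ) Stk.out o' = stk o' d ρ := by
  funext k
  cases k with
  | out => exact Function.update_self _ _ _
  | reg j => rfl
  | data j => rfl

/-- Do nothing. -/
def skip : RProg A := Prog.load id

/-- Increment a counter. -/
def incr (i : ℕ) : RProg A := Prog.push (Stk.reg i) fun _ => (default : A)

/-- Decrement a counter. -/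
def decr (i : ℕ) : RProg A := Prog.pop (Stk.reg i) fun v _ => v

/-- Pop a symbol from a counter into the internal state. -/
def probe (i : ℕ) : RProg A := Prog.pop (Stk.reg i) fun _ (o : Option A) => o

/-- Pop a symbol from a data stack into the internal state. -/
def popData (i : Fin 3) : RProg A := Prog.pop (Stk.data i) fun _ (o : Option A) => o

/-- Push the symbol in the internal state to a data stack. -/
def pushData (i : Fin 3) : RProg A := Prog.push (Stk.data i) fun v => (v.getD default : A)

section Exec

variable (o : List Bool) (d : Fin 3 → List A) (ρ : ℕ → ℕ) (v : Option A)

theorem exec_skip : skip.Exec (v, stk o d ρ) (v, stk o d ρ) 1 := Prog.Exec.load id _ _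

theorem exec_incr (i : ℕ) :
    (incr i).Exec (v, stk o d ρ) (v, stk o d (Function.update ρ i (ρ i + 1))) 1 := by
  rw [← update_stk_reg o d ρ i _ _ rfl, List.replicate_succ]
  exact Prog.Exec.push (Γ := Alph A) (Stk.reg i) (fun _ => (default : A)) v _

theorem exec_decr (i : ℕ) :
    (decr i).Exec (v, stk o d ρ) (v, stk o d (Function.update ρ i (ρ i - 1))) 1 := by
  rw [← update_stk_reg o d ρ i _ _ rfl, ← List.tail_replicate]
  exact Prog.Exec.pop (Γ := Alph A) (Stk.reg i) (fun v _ => v) v _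

theorem exec_probe_zero (i : ℕ) (h : ρ i = 0) :
    (probe i).Exec (v, stk o d ρ) (none, stk o d ρ) 1 := by
  have := Prog.Exec.pop (Γ := Alph A) (Stk.reg i) (fun _ (o : Option A) => o) v (stk o d ρ)
  have e : stk o d ρ (Stk.reg i) = ([] : List A) := congrArg (fun n => List.replicate n (default : A)) h
  rw [e] at this
  have e2 := update_stk_reg o d ρ i 0 [] rfl
  rw [Function.update_eq_self_iff.2 h.symm] at e2
  exact (congrArg (fun S => (probe i).Exec (v, stk o d ρ) (none, S) 1) e2).mp this

theorem exec_probe_succ (i n : ℕ) (h : ρ i = n + 1) :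
    (probe i).Exec (v, stk o d ρ) (some default, stk o d (Function.update ρ i n)) 1 := by
  have := Prog.Exec.pop (Γ := Alph A) (Stk.reg i) (fun _ (o : Option A) => o) v (stk o d ρ)
  have e : stk o d ρ (Stk.reg i) = (default :: List.replicate n default : List A) :=
    congrArg (fun n => List.replicate n (default : A)) h
  rw [e] at this
  have e2 := update_stk_reg o d ρ i n _ rfl
  exact (congrArg (fun S => (probe i).Exec (v, stk o d ρ) (some default, S) 1) e2).mp this

theorem exec_popData (i : Fin 3) :
    (popData i).Exec (v, stk o d ρ)
      ((d i).head?, stk o (Function.update d i (d i).tail) ρ) 1 := by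
  rw [← update_stk_data]
  exact Prog.Exec.pop (Γ := Alph A) (Stk.data i) (fun _ (o : Option A) => o) v _

theorem exec_pushData (i : Fin 3) :
    (pushData i).Exec (v, stk o d ρ)
      (v, stk o (Function.update d i (v.getD default :: d i)) ρ) 1 := by
  rw [← update_stk_data]
  exact Prog.Exec.push (Γ := Alph A) (Stk.data i) (fun v => (v.getD default : A)) v _

end Exec

/-- Data and counter values. -/
abbrev Mem (A : Type) : Type := (Fin 3 → List A) × (ℕ → ℕ)

/-- `Runs p s t T`: the program `p` leads from the memory `s` to the memory `t` in at most `T`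
steps. -/
def Runs (p : RProg A) (s t : Mem A) (T : ℕ) : Prop :=
  ∀ v, ∃ v' n, n ≤ T ∧ p.Exec (v, stk [] s.1 s.2) (v', stk [] t.1 t.2) n

namespace Runs

theorem seq {p q : RProg A} {s t u : Mem A} {T T' : ℕ} (h : Runs p s t T) (h' : Runs q t u T') :
    Runs (p.seq q) s u (T + T') := fun v =>
  let ⟨v', n, hn, he⟩ := h v
  let ⟨v'', n', hn', he'⟩ := h' v'
  ⟨v'', n + n', Nat.add_le_add hn hn', he.seq he'⟩

theorem congr {p : RProg A} {d d' : Fin 3 → List A} {ρ ρ' τ τ' : ℕ → ℕ} {T T' : ℕ}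
    (h : Runs p (d, ρ) (d', ρ') T) (hs : ∀ r, τ r = ρ r) (ht : ∀ r, τ' r = ρ' r)
    (hT : T ≤ T') : Runs p (d, τ) (d', τ') T' := fun v => by
  obtain ⟨v', n, hn, he⟩ := h v
  rw [funext hs, funext ht]
  exact ⟨v', n, hn.trans hT, he⟩

theorem le_add {p : RProg A} {s t : Mem A} {T : ℕ} (h : Runs p s t T) (i : ℕ) :
    t.2 i ≤ s.2 i + T := by
  obtain ⟨v', n, hn, he⟩ := h none
  have h1 := he.length_le (Stk.reg i)
  have h2 : ∀ (d : Fin 3 → List A) ρ, (stk [] d ρ (Stk.reg i)).length = ρ i :=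
    fun d ρ => List.length_replicate
  simp only [h2] at h1
  omega

end Runs

theorem runs_skip (s : Mem A) : Runs skip s s 1 := fun v => ⟨v, 1, le_rfl, exec_skip _ _ _ _⟩

theorem runs_incr (i : ℕ) (d : Fin 3 → List A) (ρ : ℕ → ℕ) :
    Runs (incr i) (d, ρ) (d, Function.update ρ i (ρ i + 1)) 1 :=
  fun v => ⟨v, 1, le_rfl, exec_incr _ _ _ _ _⟩

theorem runs_decr (i : ℕ) (d : Fin 3 → List A) (ρ : ℕ → ℕ) :
    Runs (decr i) (d, ρ) (d, Function.update ρ i (ρ i - 1)) 1 :=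
  fun v => ⟨v, 1, le_rfl, exec_decr _ _ _ _ _⟩

/-- Repeat a program as often as a counter says, counting down to zero. -/
def times (i : ℕ) (p : RProg A) : RProg A :=
  (probe i).seq (Prog.whileDo Option.isSome (p.seq (probe i)))

/-- `d j` and `ρ j` are the loop invariant after `j` rounds, except at the counter `i`, which is
decremented before the body starts and must be preserved by it. A round costs the body, a loop test
and a probe; the first probe and the last test give the final `2`. -/
theorem runs_times {i n T : ℕ} {p : RProg A} (d : ℕ → Fin 3 → List A) (ρ : ℕ → ℕ → ℕ)
    (h : ∀ j < n, Runs p (d j, Function.update (ρ j) i (n - 1 - j))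
      (d (j + 1), Function.update (ρ (j + 1)) i (n - 1 - j)) T) :
    Runs (times i p) (d 0, Function.update (ρ 0) i n)
      (d n, Function.update (ρ n) i 0) (n * (T + 2) + 2) := by
  -- Here `m` is the number of rounds still to be done.
  have key : ∀ m ≤ n, ∀ v, ∃ v' t, t ≤ m * (T + 2) + 1 + 1 ∧
      (times i p).Exec (v, stk [] (d (n - m)) (Function.update (ρ (n - m)) i m))
        (v', stk [] (d n) (Function.update (ρ n) i 0)) t := by
    intro m
    induction m with
    | zero =>
      intro _ v
      exact ⟨none, 2, by omega,
        (exec_probe_zero _ _ _ v i (by simp)).seq (Prog.Exec.while_false rfl)⟩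
    | succ m ih =>
      intro hm v
      have e1 := exec_probe_succ [] (d (n - (m + 1)))
        (Function.update (ρ (n - (m + 1))) i (m + 1)) v i m (by simp)
      rw [Function.update_idem] at e1
      obtain ⟨v1, t1, ht1, he1⟩ := h (n - (m + 1)) (by omega) (some default)
      rw [show n - 1 - (n - (m + 1)) = m by omega, show n - (m + 1) + 1 = n - m by omega] at he1
      obtain ⟨v2, t2, ht2, he2⟩ := ih (by omega) v1
      -- The run for the remaining rounds begins with a probe, which serves here as the end of the
      -- current loop body.
      cases he2 with
      | @seq _ _ _ w _ a b hp hw =>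
        have := Prog.Exec.while_true (c := Option.isSome) (s := (some default, _)) rfl
          (he1.seq hp) hw
        have ha : a = 1 := by cases hp; rfl
        refine ⟨v2, _, ?_, e1.seq this⟩
        rw [Nat.add_mul]
        omega
  intro v
  have := key n le_rfl v
  rwa [Nat.sub_self] at this

/-- Run `p` if a counter is zero and `q` otherwise. -/
def ifZero (i : ℕ) (p q : RProg A) : RProg A :=
  (probe i).seq (Prog.ite Option.isSome ((incr i).seq q) p)

/-- The extra steps are the probe, the branch and, for a nonzero counter, the increment that puts
the probed symbol back. -/
theorem runs_ifZero {i T : ℕ} {p q : RProg A} {d : Fin 3 → List A} {ρ : ℕ → ℕ} {t : Mem A}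
    (hp : ρ i = 0 → Runs p (d, ρ) t T) (hq : ρ i ≠ 0 → Runs q (d, ρ) t T) :
    Runs (ifZero i p q) (d, ρ) t (T + 3) := by
  intro v
  rcases Nat.eq_zero_or_pos (ρ i) with h | h
  · obtain ⟨v', n, hn, he⟩ := hp h none
    exact ⟨v', _, by omega, (exec_probe_zero _ _ _ v i h).seq (Prog.Exec.ite_false rfl he)⟩
  · obtain ⟨n, hn⟩ := Nat.exists_eq_succ_of_ne_zero h.ne'
    have e1 := exec_probe_succ [] d ρ v i n hn
    have e2 := exec_incr [] d (Function.update ρ i n) (some default) i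
    have e3 : Function.update (Function.update ρ i n) i (Function.update ρ i n i + 1) = ρ := by
      simp [← Nat.succ_eq_add_one, ← hn]
    rw [e3] at e2
    obtain ⟨v', t', ht', he⟩ := hq h.ne' (some default)
    exact ⟨v', _, by omega, e1.seq (Prog.Exec.ite_true rfl (e2.seq he))⟩

/-- Set a counter to zero. -/
def clear (i : ℕ) : RProg A := times i skip

theorem runs_clear (i : ℕ) (d : Fin 3 → List A) (ρ : ℕ → ℕ) :
    Runs (clear i) (d, ρ) (d, Function.update ρ i 0) (ρ i * 3 + 2) :=
  (runs_times (i := i) (n := ρ i) (T := 1) (fun _ => d) (fun _ => ρ) fun j _ =>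
    runs_skip _).congr (by simp) (by simp) le_rfl

/-- Add a counter to another one, setting it to zero. -/
def move (i j : ℕ) : RProg A := times i (incr j)

theorem runs_move {i j : ℕ} (hij : i ≠ j) (d : Fin 3 → List A) (ρ : ℕ → ℕ) :
    Runs (move i j) (d, ρ) (d, Function.update (Function.update ρ j (ρ j + ρ i)) i 0)
      (ρ i * 3 + 2) := by
  have := runs_times (i := i) (n := ρ i) (T := 1) (p := incr j) (fun _ => d)
    (fun l => Function.update ρ j (ρ j + l)) fun l _ =>
      (runs_incr j d (Function.update (Function.update ρ j (ρ j + l)) i (ρ i - 1 - l))).congr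
        (fun _ => rfl) (fun r => by grind [Function.update_apply]) le_rfl
  exact this.congr (fun r => by grind [Function.update_apply])
    (fun r => by grind [Function.update_apply]) le_rfl

/-- Add a counter to another one, using a scratch counter. -/
def copy (i j t : ℕ) : RProg A := (times i ((incr j).seq (incr t))).seq (move t i)

/-- The counter `i` is used up while `j` and `t` grow, then refilled from `t`; the two loops cost
`4` and `3` steps per unit. -/
theorem runs_copy {i j t : ℕ} (hij : i ≠ j) (hit : i ≠ t) (hjt : j ≠ t) (d : Fin 3 → List A)
    (ρ : ℕ → ℕ) (hs : ρ t = 0) :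
    Runs (copy i j t) (d, ρ) (d, Function.update ρ j (ρ j + ρ i)) (ρ i * 7 + 4) := by
  have h1 := runs_times (i := i) (n := ρ i) (T := 2) (p := (incr j).seq (incr t)) (fun _ => d)
    (fun l => Function.update (Function.update ρ j (ρ j + l)) t l) fun l _ =>
      ((runs_incr j d (Function.update (Function.update (Function.update ρ j
        (ρ j + l)) t l) i (ρ i - 1 - l))).seq (runs_incr t _ _)).congr
        (fun _ => rfl) (fun r => by grind [Function.update_apply]) le_rfl
  refine (h1.seq (runs_move hit.symm _ _)).congr (fun r => by grind [Function.update_apply])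
    (fun r => by grind [Function.update_apply]) ?_
  have : Function.update (Function.update (Function.update ρ j (ρ j + ρ i)) t (ρ i)) i 0 t
      = ρ i := by grind [Function.update_apply]
  rw [this]
  omega

/-- Move the top symbol of a data stack to the scratch data stack. -/
def shift (b : Fin 3) : RProg A := (popData b).seq (Prog.ite Option.isSome (pushData 2) skip)

/-- The invariant is stated for all `j`, also beyond the end of `l`, where nothing moves any more.
-/
theorem runs_shift {b : Fin 3} (hb : b ≠ 2) (d : Fin 3 → List A) (ρ : ℕ → ℕ) (l : List A)
    (j : ℕ) :
    Runs (shift b)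
      (Function.update (Function.update d b (l.drop j)) 2 (l.take j).reverse, ρ)
      (Function.update (Function.update d b (l.drop (j + 1))) 2 (l.take (j + 1)).reverse, ρ)
      3 := by
  intro v
  have e1 := exec_popData []
    (Function.update (Function.update d b (l.drop j)) 2 (l.take j).reverse) ρ v b
  have hS : Function.update (Function.update d b (l.drop j)) 2 (l.take j).reverse b =
      l.drop j := by simp [hb]
  rw [hS] at e1
  rcases lt_or_ge j l.length with hj | hj
  · rw [List.drop_eq_getElem_cons hj] at e1 ⊢
    simp only [List.head?_cons, List.tail_cons] at e1
    have e2 := exec_pushData [] (Function.update (Function.update (Function.update d b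
        (l[j] :: l.drop (j + 1))) 2 (l.take j).reverse) b (l.drop (j + 1))) ρ (some l[j]) 2
    refine ⟨some l[j], 3, le_rfl, ?_⟩
    have e3 : Function.update (Function.update (Function.update (Function.update d b
        (l[j] :: l.drop (j + 1))) 2 (l.take j).reverse) b (l.drop (j + 1))) 2
        ((some l[j]).getD default :: (Function.update (Function.update (Function.update d b
        (l[j] :: l.drop (j + 1))) 2 (l.take j).reverse) b (l.drop (j + 1))) 2) =
        Function.update (Function.update d b (l.drop (j + 1))) 2 (l.take (j + 1)).reverse := by
      have e4 : (l.take (j + 1)).reverse = l[j] :: (l.take j).reverse := by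
        rw [List.take_add_one, List.getElem?_eq_getElem hj]; simp
      rw [e4]
      funext i
      by_cases h2 : i = 2
      · subst h2; simp [Ne.symm hb]
      · by_cases h1 : i = b
        · subst h1; simp [h2]
        · simp [h1, h2]
    rw [e3] at e2
    exact e1.seq (Prog.Exec.ite_true (c := Option.isSome) rfl e2)
  · have e3 : l.drop j = [] := List.drop_eq_nil_of_le hj
    have e4 : l.drop (j + 1) = [] := List.drop_eq_nil_of_le (by omega)
    have e5 : l.take (j + 1) = l.take j := by
      rw [List.take_of_length_le hj, List.take_of_length_le (by omega)]
    rw [e3] at e1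
    rw [e3, e4, e5]
    refine ⟨none, 3, le_rfl, ?_⟩
    have e6 : Function.update (Function.update (Function.update d b []) 2 (l.take j).reverse) b
        (List.tail []) = Function.update (Function.update d b []) 2 (l.take j).reverse := by
      simp [hb]
    rw [e6] at e1
    exact e1.seq (Prog.Exec.ite_false (c := Option.isSome) rfl (exec_skip _ _ _ _))

/-- Move all symbols from the scratch data stack to another one. -/
def restore (b : Fin 3) : RProg A :=
  (popData 2).seq (Prog.whileDo Option.isSome ((pushData b).seq (popData 2)))

theorem runs_restore {b : Fin 3} (hb : b ≠ 2) (ρ : ℕ → ℕ) (l : List A) (d : Fin 3 → List A) :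
    Runs (restore b) (Function.update d 2 l, ρ)
      (Function.update (Function.update d b (l.reverse ++ d b)) 2 [], ρ) (l.length * 3 + 2) := by
  intro v
  induction l generalizing v d with
  | nil =>
    have e1 := exec_popData [] (Function.update d 2 []) ρ v 2
    refine ⟨none, 2, by simp, ?_⟩
    simp only [Function.update_self, List.head?_nil, List.tail_nil, Function.update_idem] at e1
    have e2 : Function.update (Function.update d b (([] : List A).reverse ++ d b)) 2 [] =
        Function.update d 2 [] := by simp
    rw [e2]
    exact e1.seq (Prog.Exec.while_false (c := Option.isSome) rfl)
  | cons x l ih =>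
    have e1 := exec_popData [] (Function.update d 2 (x :: l)) ρ v 2
    simp only [Function.update_self, List.head?_cons, List.tail_cons, Function.update_idem] at e1
    have e2 := exec_pushData [] (Function.update d 2 l) ρ (some x) b
    rw [Function.update_comm hb.symm] at e2
    simp only [Function.update_of_ne hb, Option.getD_some] at e2
    obtain ⟨v', n, hn, he⟩ := ih (Function.update d b (x :: d b)) (some x)
    cases he with
    | @seq _ _ _ w _ a c hp hw =>
      have ha : a = 1 := by cases hp; rfl
      refine ⟨v', _, ?_, e1.seq (Prog.Exec.while_true (c := Option.isSome) (m := 1 + 1) (n := c)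
        rfl (e2.seq (ha ▸ hp)) ?_)⟩
      · rw [List.length_cons]; omega
      · simpa using hw

/-- Count the symbols of a data stack, moving them to the scratch data stack. -/
def pour (b : Fin 3) (m : ℕ) : RProg A :=
  (popData b).seq (Prog.whileDo Option.isSome ((pushData 2).seq ((incr m).seq (popData b))))

theorem runs_pour {b : Fin 3} (hb : b ≠ 2) (m : ℕ) (ρ : ℕ → ℕ) (l l' : List A)
    (d : Fin 3 → List A) :
    Runs (pour b m) (Function.update (Function.update d b l) 2 l', ρ)
      (Function.update (Function.update d b []) 2 (l.reverse ++ l'),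
        Function.update ρ m (ρ m + l.length)) (l.length * 4 + 2) := by
  intro v
  induction l generalizing v l' ρ with
  | nil =>
    have e1 := exec_popData [] (Function.update (Function.update d b []) 2 l') ρ v b
    have e2 : Function.update (Function.update d b []) 2 l' b = [] := by simp [hb]
    have e3 : Function.update (Function.update (Function.update d b []) 2 l') b [] =
        Function.update (Function.update d b []) 2 l' := by
      rw [Function.update_eq_self_iff, e2]
    rw [e2, List.head?_nil, List.tail_nil, e3] at e1
    refine ⟨none, 2, by simp, ?_⟩
    rw [List.length_nil, Nat.add_zero, Function.update_eq_self]
    exact e1.seq (Prog.Exec.while_false (c := Option.isSome) rfl)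
  | cons x l ih =>
    have e1 := exec_popData [] (Function.update (Function.update d b (x :: l)) 2 l') ρ v b
    have e2 : Function.update (Function.update d b (x :: l)) 2 l' b = x :: l := by simp [hb]
    have e3 : Function.update (Function.update (Function.update d b (x :: l)) 2 l') b l =
        Function.update (Function.update d b l) 2 l' := by
      rw [Function.update_comm hb.symm, Function.update_idem]
    rw [e2, List.head?_cons, List.tail_cons, e3] at e1
    have e4 := exec_pushData [] (Function.update (Function.update d b l) 2 l') ρ (some x) 2
    simp only [Function.update_self, Function.update_idem, Option.getD_some] at e4
    have e5 := exec_incr [] (Function.update (Function.update d b l) 2 (x :: l')) ρ (some x) m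
    obtain ⟨v', n, hn, he⟩ := ih (Function.update ρ m (ρ m + 1)) (x :: l') (some x)
    cases he with
    | @seq _ _ _ w _ a c hp hw =>
      have ha : a = 1 := by cases hp; rfl
      refine ⟨v', _, ?_, e1.seq (Prog.Exec.while_true (c := Option.isSome) (m := 1 + (1 + 1))
        (n := c) rfl (e4.seq (e5.seq (ha ▸ hp))) ?_)⟩
      · rw [List.length_cons]; omega
      · simpa [Nat.add_assoc, Nat.add_comm 1] using hw

/-- Increment a counter if the top symbol of a data stack passes a test. -/
def test (b : Fin 3) (t : Option A → Bool) (m : ℕ) : RProg A :=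
  (popData b).seq ((Prog.ite t (incr m) skip).seq (Prog.ite Option.isSome (pushData b) skip))

theorem runs_test (b : Fin 3) (t : Option A → Bool) (m : ℕ) (d : Fin 3 → List A) (ρ : ℕ → ℕ) :
    Runs (test b t m) (d, ρ)
      (d, Function.update ρ m (ρ m + if t (d b).head? then 1 else 0)) 5 := by
  intro v
  have e1 := exec_popData [] d ρ v b
  have e2 : (Prog.ite t (incr m) skip).Exec
      ((d b).head?, stk [] (Function.update d b (d b).tail) ρ)
      ((d b).head?, stk [] (Function.update d b (d b).tail)
        (Function.update ρ m (ρ m + if t (d b).head? then 1 else 0))) 2 := by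
    by_cases h : t (d b).head?
    · rw [if_pos h]
      exact Prog.Exec.ite_true h (exec_incr _ _ _ _ _)
    · rw [if_neg h, Nat.add_zero, Function.update_eq_self]
      exact Prog.Exec.ite_false (by simpa using h) (exec_skip _ _ _ _)
  refine ⟨(d b).head?, 1 + (2 + 2), le_rfl, e1.seq (e2.seq (t := ((d b).head?, _)) ?_)⟩
  cases h : d b with
  | nil =>
    refine Prog.Exec.ite_false (c := Option.isSome) rfl ?_
    convert exec_skip _ _ _ _ using 3
    simp [h]
  | cons x l =>
    refine Prog.Exec.ite_true (c := Option.isSome) rfl ?_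
    convert exec_pushData _ _ _ _ b using 3
    simp [h]

end Runs

end StackProg

/-! ## Functions computed by register programs -/

namespace StackProg

/-- `T` is polynomially bounded in `X`. -/
def PolyBdd {ι : Type} (X T : ι → ℕ) : Prop := ∃ c, ∀ a, T a ≤ (X a + 2) ^ c

namespace PolyBdd

variable {ι κ : Type} {X Y T U : ι → ℕ}

theorem mono (h : PolyBdd X T) (hU : ∀ a, U a ≤ T a) : PolyBdd X U :=
  let ⟨c, hc⟩ := h
  ⟨c, fun a => (hU a).trans (hc a)⟩

theorem const (X : ι → ℕ) (n : ℕ) : PolyBdd X fun _ => n :=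
  ⟨n, fun a => (Nat.lt_two_pow_self).le.trans (Nat.pow_le_pow_left (by omega) n)⟩

theorem of_le (h : ∀ a, T a ≤ X a) : PolyBdd X T := ⟨1, fun a => by have := h a; rw [pow_one]; omega⟩

theorem mul (hT : PolyBdd X T) (hU : PolyBdd X U) : PolyBdd X fun a => T a * U a :=
  let ⟨c, hc⟩ := hT
  let ⟨e, he⟩ := hU
  ⟨c + e, fun a => by rw [pow_add]; exact Nat.mul_le_mul (hc a) (he a)⟩

/-- Both summands are at most `(X a + 2) ^ (c + e)`; since the base is at least `2`, one more factor
absorbs the doubling. -/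
theorem add (hT : PolyBdd X T) (hU : PolyBdd X U) : PolyBdd X fun a => T a + U a := by
  obtain ⟨c, hc⟩ := hT
  obtain ⟨e, he⟩ := hU
  refine ⟨c + e + 1, fun a => ?_⟩
  have h1 : (X a + 2) ^ c ≤ (X a + 2) ^ (c + e) := Nat.pow_le_pow_right (by omega) (by omega)
  have h2 : (X a + 2) ^ e ≤ (X a + 2) ^ (c + e) := Nat.pow_le_pow_right (by omega) (by omega)
  have h3 := hc a
  have h4 := he a
  have h5 : (X a + 2) ^ (c + e) * 2 ≤ (X a + 2) ^ (c + e) * (X a + 2) :=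
    Nat.mul_le_mul_left _ (by omega)
  rw [pow_succ]
  show T a + U a ≤ _
  omega

theorem pow (hT : PolyBdd X T) (e : ℕ) : PolyBdd X fun a => T a ^ e :=
  let ⟨c, hc⟩ := hT
  ⟨c * e, fun a => by rw [pow_mul]; exact Nat.pow_le_pow_left (hc a) e⟩

theorem trans (hY : PolyBdd X Y) (hT : PolyBdd Y T) : PolyBdd X T :=
  let ⟨e, he⟩ := hT
  ((hY.add (const X 2)).pow e).mono he

theorem comp (hT : PolyBdd X T) (f : κ → ι) : PolyBdd (fun a => X (f a)) fun a => T (f a) :=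
  let ⟨c, hc⟩ := hT
  ⟨c, fun a => hc (f a)⟩

theorem of_comp (f : κ → ι) {Z : κ → ℕ} (hT : PolyBdd X T) (hX : PolyBdd Z fun a => X (f a)) :
    PolyBdd Z fun a => T (f a) := hX.trans (hT.comp f)

end PolyBdd

/-- The contexts in which functions are computed: two data stacks and finitely many counters. -/
class Ctx (α : Type) (A : outParam Type) where
  arity : ℕ
  val : α → ℕ → ℕ
  data : α → Fin 3 → List A
  size : α → ℕ
  data_two : ∀ a, data a 2 = []
  val_le : ∀ a l, l < arity → val a l ≤ size a
  length_le : ∀ a i, (data a i).length ≤ size a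

/-- The contents of the two data stacks. -/
structure Tapes (A : Type) where
  input : List A
  table : List A

/-- The data stacks for given contents. -/
def Tapes.data {A : Type} (a : Tapes A) : Fin 3 → List A := ![a.input, a.table, []]

instance (A : Type) : Ctx (Tapes A) A where
  arity := 0
  val _ _ := 0
  data a := a.data
  size a := a.input.length + a.table.length
  data_two _ := rfl
  val_le _ _ h := absurd h (Nat.not_lt_zero _)
  length_le a i := by
    match i with
    | 0 => simp [Tapes.data]
    | 1 => simp [Tapes.data]
    | 2 => simp [Tapes.data]

/-- Put a new value in front of a sequence. -/
def consSeq (x : ℕ) (f : ℕ → ℕ) : ℕ → ℕ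
  | 0 => x
  | l + 1 => f l

/-- As with de Bruijn indices, the newest variable has index `0`. Numbers enter the size by their
value, since counters are unary. -/
instance (α A : Type) [Ctx α A] : Ctx (α × ℕ) A where
  arity := Ctx.arity α + 1
  val a := consSeq a.2 (Ctx.val a.1)
  data a := Ctx.data a.1
  size a := Ctx.size a.1 + a.2
  data_two a := Ctx.data_two a.1
  val_le a l h := by
    cases l with
    | zero => exact Nat.le_add_left _ _
    | succ l => exact (Ctx.val_le a.1 l (by omega)).trans (Nat.le_add_right _ _)
  length_le a i := (Ctx.length_le a.1 i).trans (Nat.le_add_right _ _)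

section

variable {α A : Type} [Ctx α A]

/-- The values of `a : α` are held by the counters given by `args`, and all counters from `m` on
are free. -/
def Holds (a : α) (args : ℕ → ℕ) (m : ℕ) (ρ : ℕ → ℕ) : Prop :=
  (∀ l < Ctx.arity α, args l < m ∧ ρ (args l) = Ctx.val a l) ∧ ∀ r, m ≤ r → ρ r = 0

theorem exists_holds (a : α) : ∃ args m ρ, Holds a args m ρ :=
  ⟨id, Ctx.arity α, fun l => if l < Ctx.arity α then Ctx.val a l else 0,
    fun l hl => ⟨hl, if_pos hl⟩, fun _ hr => if_neg (by omega)⟩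

theorem Holds.push {a : α} {args : ℕ → ℕ} {m : ℕ} {ρ : ℕ → ℕ} (h : Holds a args m ρ) (x : ℕ) :
    Holds (a, x) (consSeq m args) (m + 1) (Function.update ρ m x) := by
  refine ⟨fun l hl => ?_, fun r hr => ?_⟩
  · cases l with
    | zero => exact ⟨Nat.lt_succ_self m, Function.update_self _ _ _⟩
    | succ l =>
      have := h.1 l (Nat.lt_of_succ_lt_succ hl)
      refine ⟨this.1.trans (Nat.lt_succ_self m), ?_⟩
      refine (Function.update_of_ne this.1.ne _ _).trans this.2
  · rw [Function.update_of_ne (by omega)]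
    exact h.2 r (by omega)

/-- Reserves the counter `m` for an intermediate result that is not visible as a variable. -/
theorem Holds.skip {a : α} {args : ℕ → ℕ} {m : ℕ} {ρ : ℕ → ℕ} (h : Holds a args m ρ) (x : ℕ) :
    Holds a args (m + 1) (Function.update ρ m x) :=
  ⟨fun l hl => by
    have := h.1 l hl
    exact ⟨this.1.trans (Nat.lt_succ_self m), (Function.update_of_ne this.1.ne _ _).trans this.2⟩,
    (h.push x).2⟩

end

section

variable {α β A : Type} [Ctx α A] [Ctx β A] [Inhabited A]

/-- `P` computes `f` in time `T`. -/
def Computes (P : (ℕ → ℕ) → ℕ → RProg A) (f : α → ℕ) (T : α → ℕ) : Prop :=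
  ∀ a args m ρ, Holds a args m ρ →
    Runs (P args m) (Ctx.data a, ρ) (Ctx.data a, Function.update ρ m (f a)) (T a)

/-- `f` is computed in time polynomial in the size of the context and in `B`. -/
def CompIn (f B : α → ℕ) : Prop :=
  ∃ P T, PolyBdd (fun a => Ctx.size a + B a) T ∧ Computes P f T

/-- `f` is computed in time polynomial in the size of the context. -/
def PolyComp (f : α → ℕ) : Prop := ∃ P T, PolyBdd Ctx.size T ∧ Computes P f T

theorem CompIn.polyComp {f B : α → ℕ} (h : CompIn f B) (hB : PolyBdd Ctx.size B) :
    PolyComp f :=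
  let ⟨P, T, hT, hP⟩ := h
  ⟨P, T, ((PolyBdd.of_le fun _ => le_rfl).add hB).trans hT, hP⟩

/-- The result is built in unary in a counter that starts at zero. So polynomial time forces
polynomial values, which is what permits using them as loop bounds. -/
theorem Computes.le {P : (ℕ → ℕ) → ℕ → RProg A} {f T : α → ℕ} (h : Computes P f T) (a : α) :
    f a ≤ T a := by
  obtain ⟨args, m, ρ, hρ⟩ := exists_holds a
  have := (h a args m ρ hρ).le_add m
  simpa [hρ.2 m le_rfl] using this

theorem PolyComp.polyBdd {f : α → ℕ} (h : PolyComp f) : PolyBdd Ctx.size f :=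
  let ⟨_, _, hT, hP⟩ := h
  hT.mono hP.le

/-- Functions that only use some of the variables of the context. -/
theorem PolyComp.rename {f : β → ℕ} (hf : PolyComp f) (τ : ℕ → ℕ) (h : α → β)
    (hdata : ∀ a, Ctx.data (h a) = Ctx.data a)
    (hval : ∀ l < Ctx.arity β, τ l < Ctx.arity α ∧ ∀ a, Ctx.val (h a) l = Ctx.val a (τ l))
    (hsize : ∀ a, Ctx.size (h a) ≤ Ctx.size a) : PolyComp fun a => f (h a) := by
  obtain ⟨P, T, hT, hP⟩ := hf
  refine ⟨fun args m => P (fun l => args (τ l)) m, fun a => T (h a),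
    PolyBdd.of_comp h hT (PolyBdd.of_le hsize), fun a args m ρ hρ => ?_⟩
  rw [← hdata]
  refine hP (h a) _ m ρ ⟨fun l hl => ?_, hρ.2⟩
  have h1 := hval l hl
  have h2 := hρ.1 _ h1.1
  exact ⟨h2.1, h2.2.trans (h1.2 a).symm⟩

theorem PolyComp.weaken {f : α → ℕ} (hf : PolyComp f) : PolyComp fun a : α × ℕ => f a.1 :=
  hf.rename (fun l => l + 1) Prod.fst (fun _ => rfl)
    (fun _ hl => ⟨Nat.succ_lt_succ hl, fun _ => rfl⟩) fun _ => Nat.le_add_right _ _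

/-- Hides the loop index from a body that depends only on the context and the accumulator. -/
theorem PolyComp.weaken_second {f : α × ℕ → ℕ} (hf : PolyComp f) :
    PolyComp fun a : (α × ℕ) × ℕ => f (a.1.1, a.2) :=
  hf.rename (fun l => l.rec 0 fun l _ => l + 2) (fun a : (α × ℕ) × ℕ => (a.1.1, a.2))
    (fun _ => rfl)
    (fun l hl => by
      cases l with
      | zero => exact ⟨Nat.succ_pos _, fun _ => rfl⟩
      | succ l => exact ⟨Nat.succ_lt_succ hl, fun _ => rfl⟩)
    fun a => Nat.add_le_add_right (Nat.le_add_right _ _) _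

theorem PolyComp.const (n : ℕ) : PolyComp fun _ : α => n := by
  induction n with
  | zero =>
    refine ⟨fun _ _ => StackProg.skip, fun _ => 1, PolyBdd.const _ _, fun a args m ρ hρ => ?_⟩
    refine (runs_skip _).congr (fun _ => rfl) (fun r => ?_) le_rfl
    rw [← hρ.2 m le_rfl, Function.update_eq_self]
  | succ n ih =>
    obtain ⟨P, T, hT, hP⟩ := ih
    refine ⟨fun args m => (P args m).seq (incr m), fun a => T a + 1,
      hT.add (PolyBdd.const _ _), fun a args m ρ hρ => ?_⟩
    exact ((hP a args m ρ hρ).seq (runs_incr m _ _)).congr (fun _ => rfl)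
      (fun r => by grind [Function.update_apply]) le_rfl

theorem PolyComp.val (l : ℕ) (hl : l < Ctx.arity α) : PolyComp fun a : α => Ctx.val a l := by
  refine ⟨fun args m => copy (args l) m (m + 1), fun a => Ctx.val a l * 7 + 4,
    (((PolyBdd.of_le fun a => Ctx.val_le a l hl).mul (PolyBdd.const _ _)).add
      (PolyBdd.const _ _)), fun a args m ρ hρ => ?_⟩
  obtain ⟨h1, h2⟩ := hρ.1 l hl
  have h3 := hρ.2 m le_rfl
  refine (runs_copy (by omega) (by omega) (by omega) _ ρ (hρ.2 (m + 1) (by omega))).congr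
    (fun _ => rfl) (fun r => ?_) (by rw [h2])
  rw [h2, h3, Nat.zero_add]

theorem PolyComp.var : PolyComp fun a : α × ℕ => a.2 :=
  PolyComp.val (α := α × ℕ) 0 (Nat.succ_pos _)

theorem PolyComp.succ {f : α → ℕ} (hf : PolyComp f) : PolyComp fun a => f a + 1 := by
  obtain ⟨P, T, hT, hP⟩ := hf
  refine ⟨fun args m => (P args m).seq (incr m), fun a => T a + 1,
    hT.add (PolyBdd.const _ _), fun a args m ρ hρ => ?_⟩
  exact ((hP a args m ρ hρ).seq (runs_incr m _ _)).congr (fun _ => rfl)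
    (fun r => by grind [Function.update_apply]) le_rfl

theorem PolyComp.pred {f : α → ℕ} (hf : PolyComp f) : PolyComp fun a => f a - 1 := by
  obtain ⟨P, T, hT, hP⟩ := hf
  refine ⟨fun args m => (P args m).seq (decr m), fun a => T a + 1,
    hT.add (PolyBdd.const _ _), fun a args m ρ hρ => ?_⟩
  exact ((hP a args m ρ hρ).seq (runs_decr m _ _)).congr (fun _ => rfl)
    (fun r => by grind [Function.update_apply]) le_rfl

theorem PolyComp.ifZero {f g h : α → ℕ} (hf : PolyComp f) (hg : PolyComp g) (hh : PolyComp h) :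
    PolyComp fun a => if f a = 0 then g a else h a := by
  have hfb := hf.polyBdd
  obtain ⟨P, T, hT, hP⟩ := hf
  obtain ⟨Q, U, hU, hQ⟩ := hg
  obtain ⟨R, V, hV, hR⟩ := hh
  refine ⟨fun args m => (P args m).seq (StackProg.ifZero m (Q args m)
    ((clear m).seq (R args m))),
    fun a => T a + ((U a + ((f a * 3 + 2) + V a)) + 3),
    hT.add ((hU.add (((hfb.mul (PolyBdd.const _ _)).add (PolyBdd.const _ _)).add hV)).add
      (PolyBdd.const _ _)), fun a args m ρ hρ => ?_⟩
  refine (hP a args m ρ hρ).seq (runs_ifZero (fun h0 => ?_) (fun h0 => ?_))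
  · rw [Function.update_self] at h0
    refine (hQ a args m ρ hρ).congr (fun r => ?_) (fun r => ?_) (by omega)
    · have := hρ.2 m le_rfl
      grind [Function.update_apply]
    · show Function.update ρ m (if f a = 0 then g a else h a) r = _
      rw [if_pos h0]
  · rw [Function.update_self] at h0
    have e := (runs_clear m (Ctx.data a) (Function.update ρ m (f a))).congr (fun _ => rfl)
      (τ' := ρ) (fun r => by have := hρ.2 m le_rfl; grind [Function.update_apply]) le_rfl
    refine (e.seq (hR a args m ρ hρ)).congr (fun _ => rfl) (fun r => ?_) ?_
    · show Function.update ρ m (if f a = 0 then g a else h a) r = _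
      rw [if_neg h0]
    · rw [Function.update_self]; omega

/-- Repeating a polynomial body can leave polynomial time because the accumulator grows. With `B`
bounding all intermediate values, every round costs at most the same polynomial in the size, `n` and
`B`. -/
theorem CompIn.loop {n init : α → ℕ} {body : (α × ℕ) × ℕ → ℕ} {B : α → ℕ} (hn : PolyComp n)
    (hi : PolyComp init) (hb : PolyComp body)
    (hB : ∀ a, ∀ i ≤ n a, (Nat.rec (init a) (fun i r => body ((a, i), r)) i : ℕ) ≤ B a) :
    CompIn (fun a => (Nat.rec (init a) (fun i r => body ((a, i), r)) (n a) : ℕ)) B := by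
  set acc : α → ℕ → ℕ := fun a i => (Nat.rec (init a) (fun i r => body ((a, i), r)) i : ℕ)
    with hacc
  have hnb := hn.polyBdd
  obtain ⟨P, T, hT, hP⟩ := hn
  obtain ⟨Q, U, hU, hQ⟩ := hi
  obtain ⟨R, V, ⟨c, hV⟩, hR⟩ := hb
  -- One bound for the body in all rounds, since the index is at most `n a` and the accumulator at
  -- most `B a`.
  set W : α → ℕ := fun a => (Ctx.size a + n a + B a + 2) ^ c with hW
  have hV' : ∀ a i, i ≤ n a → V ((a, i), acc a i) ≤ W a := fun a i hi =>
    (hV _).trans (Nat.pow_le_pow_left (by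
      have := hB a i hi
      show Ctx.size a + i + acc a i + 2 ≤ _
      simp only [hacc]
      omega) c)
  have hX : PolyBdd (fun a => Ctx.size a + B a) (Ctx.size (α := α)) :=
    PolyBdd.of_le fun _ => Nat.le_add_right _ _
  have hBB : PolyBdd (fun a : α => Ctx.size a + B a) B :=
    PolyBdd.of_le fun _ => Nat.le_add_left _ _
  have hc := PolyBdd.const (fun a : α => Ctx.size a + B a)
  have hn' := hX.trans hnb
  refine ⟨fun args m => (P args m).seq ((Q args (m + 1)).seq ((times m
    ((R (consSeq (m + 1) (consSeq (m + 2) args)) (m + 3)).seq ((clear (m + 1)).seq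
      ((move (m + 3) (m + 1)).seq (incr (m + 2)))))).seq ((clear (m + 2)).seq
        (move (m + 1) m)))),
    fun a => T a + (U a + ((n a * ((W a + ((B a * 3 + 2) + ((B a * 3 + 2) + 1))) + 2) + 2) +
      ((n a * 3 + 2) + (B a * 3 + 2)))), ?_, fun a args m ρ hρ => ?_⟩
  · exact (hX.trans hT).add ((hX.trans hU).add (((hn'.mul (((((hX.add hn').add hBB).add
      (hc 2)).pow c).add (((hBB.mul (hc 3)).add (hc 2)).add (((hBB.mul (hc 3)).add (hc 2)).add
        (hc 1))) |>.add (hc 2))).add (hc 2)).add (((hn'.mul (hc 3)).add (hc 2)).add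
          ((hBB.mul (hc 3)).add (hc 2)))))
  · have z1 := hρ.2 (m + 1) (by omega)
    have z2 := hρ.2 (m + 2) (by omega)
    have z3 := hρ.2 (m + 3) (by omega)
    have h1 := hP a args m ρ hρ
    have h2 := hQ a args (m + 1) _ (hρ.skip (n a))
    -- Counter `m` counts the rounds down, `m + 1` is the accumulator, `m + 2` the index, and `m +
    -- 3` receives the new accumulator.
    set ρs : ℕ → ℕ → ℕ := fun j =>
      Function.update (Function.update ρ (m + 1) (acc a j)) (m + 2) j with hρs
    have hstep : ∀ j < n a, Runs ((R (consSeq (m + 1) (consSeq (m + 2) args)) (m + 3)).seq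
        ((clear (m + 1)).seq ((move (m + 3) (m + 1)).seq (incr (m + 2)))))
        (Ctx.data a, Function.update (ρs j) m (n a - 1 - j))
        (Ctx.data a, Function.update (ρs (j + 1)) m (n a - 1 - j))
        (W a + ((B a * 3 + 2) + ((B a * 3 + 2) + 1))) := by
      intro j hj
      have hh : Holds ((a, j), acc a j) (consSeq (m + 1) (consSeq (m + 2) args)) (m + 3)
          (Function.update (ρs j) m (n a - 1 - j)) := by
        refine ⟨fun l hl => ?_, fun r hr => ?_⟩
        · match l with
          | 0 => exact ⟨by simp [consSeq], by simp [consSeq, hρs]; rfl⟩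
          | 1 => exact ⟨by simp [consSeq], by simp [consSeq, hρs]; rfl⟩
          | l + 2 =>
            have := hρ.1 l (by simpa [Ctx.arity] using hl)
            refine ⟨by simp only [consSeq]; omega, ?_⟩
            show Function.update (ρs j) m (n a - 1 - j) (args l) = Ctx.val a l
            rw [← this.2]
            grind [Function.update_apply]
        · have := hρ.2 r (by omega)
          grind [Function.update_apply]
      have hs : body ((a, j), acc a j) = acc a (j + 1) := rfl
      have e := hR _ _ _ _ hh
      rw [hs] at e
      have hBj : acc a j ≤ B a := hB a j (by omega)
      have hBj1 : acc a (j + 1) ≤ B a := hB a (j + 1) (by omega)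
      refine (e.seq ((runs_clear (m + 1) _ _).seq ((runs_move (i := m + 3) (j := m + 1)
        (by omega) _ _).seq (runs_incr (m + 2) _ _)))).congr (fun _ => rfl) (fun r => ?_) ?_
      · grind [Function.update_apply]
      · refine Nat.add_le_add (hV' a j hj.le) (Nat.add_le_add ?_ (Nat.add_le_add ?_ le_rfl))
        · have : Function.update (Function.update (ρs j) m (n a - 1 - j)) (m + 3)
            (acc a (j + 1)) (m + 1) = acc a j := by grind [Function.update_apply]
          rw [this]; omega
        · have : Function.update (Function.update (Function.update (ρs j) m (n a - 1 - j)) (m + 3)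
            (acc a (j + 1))) (m + 1) 0 (m + 3) = acc a (j + 1) := by grind [Function.update_apply]
          rw [this]; omega
    have h3 := (runs_times (fun _ => Ctx.data a) ρs hstep).congr
      (τ := Function.update (Function.update ρ m (n a)) (m + 1) (init a))
      (fun r => by
        have : acc a 0 = init a := rfl
        grind [Function.update_apply]) (fun _ => rfl) le_rfl
    refine (h1.seq (h2.seq (h3.seq ((runs_clear (m + 2) _ _).seq (runs_move (i := m + 1) (j := m)
      (by omega) _ _))))).congr (fun _ => rfl) (fun r => ?_) ?_
    · have : (Nat.rec (init a) (fun i r => body ((a, i), r)) (n a) : ℕ) = acc a (n a) := rfl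
      grind [Function.update_apply]
    · have hBn : acc a (n a) ≤ B a := hB a (n a) le_rfl
      have e1 : Function.update (ρs (n a)) m 0 (m + 2) = n a := by
        grind [Function.update_apply]
      have e2 : Function.update (Function.update (ρs (n a)) m 0) (m + 2) 0 (m + 1) =
          acc a (n a) := by grind [Function.update_apply]
      rw [e1, e2]
      beta_reduce
      omega

/-- The counter with the position reaches zero while symbols are shifted away, and so can take the
answer. A position beyond the end leaves an empty stack, in accordance with `none`. -/
theorem PolyComp.testAt {f : α → ℕ} (hf : PolyComp f) (b : Fin 3) (hb : b ≠ 2)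
    (t : Option A → Bool) :
    PolyComp fun a : α => if t (Ctx.data a b)[f a]? then 1 else 0 := by
  have hfb := hf.polyBdd
  obtain ⟨P, T, hT, hP⟩ := hf
  have hc := PolyBdd.const (Ctx.size (α := α))
  have hs : PolyBdd (Ctx.size (α := α)) Ctx.size := PolyBdd.of_le fun _ => le_rfl
  refine ⟨fun args m => (P args m).seq ((times m (shift b)).seq ((test b t m).seq (restore b))),
    fun a => T a + ((f a * (3 + 2) + 2) + (5 + (Ctx.size a * 3 + 2))),
    hT.add (((hfb.mul (hc _)).add (hc _)).add ((hc _).add ((hs.mul (hc _)).add (hc _)))),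
    fun a args m ρ hρ => ?_⟩
  have z := hρ.2 m le_rfl
  set l := Ctx.data a b with hl
  have h1 := hP a args m ρ hρ
  have h2 := runs_times (i := m) (n := f a) (p := shift b)
    (fun j => Function.update (Function.update (Ctx.data a) b (l.drop j)) 2 (l.take j).reverse)
    (fun _ => ρ) (fun j _ => runs_shift hb (Ctx.data a) _ l j)
  simp only [List.drop_zero, List.take_zero, List.reverse_nil] at h2
  have e1 : Function.update (Function.update (Ctx.data a) b l) 2 [] = Ctx.data a := by
    rw [hl, Function.update_eq_self, ← Ctx.data_two a, Function.update_eq_self]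
  rw [e1] at h2
  have h3 := runs_test b t m (Function.update (Function.update (Ctx.data a) b (l.drop (f a))) 2
    (l.take (f a)).reverse) (Function.update ρ m 0)
  have h4 := runs_restore hb (Function.update (Function.update ρ m 0) m
    (Function.update ρ m 0 m + if t (Function.update (Function.update (Ctx.data a) b
      (l.drop (f a))) 2 (l.take (f a)).reverse b).head? then 1 else 0)) (l.take (f a)).reverse
    (Function.update (Ctx.data a) b (l.drop (f a)))
  have h5 := h2.seq (h3.seq h4)
  have e2 : Function.update (Function.update (Function.update (Ctx.data a) b (l.drop (f a))) b
      ((l.take (f a)).reverse.reverse ++ Function.update (Ctx.data a) b (l.drop (f a)) b)) 2 [] =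
      Ctx.data a := by
    rw [List.reverse_reverse, Function.update_self, List.take_append_drop, Function.update_idem]
    exact e1
  have e3 : (Function.update (Function.update (Ctx.data a) b (l.drop (f a))) 2
      (l.take (f a)).reverse b).head? = l[f a]? := by
    rw [Function.update_of_ne hb, Function.update_self, List.head?_drop]
  rw [e2, e3] at h5
  refine (h1.seq h5).congr (fun _ => rfl) (fun r => ?_) ?_
  · grind [Function.update_apply]
  · have h6 : (l.take (f a)).reverse.length ≤ Ctx.size a := by
      rw [List.length_reverse, List.length_take]
      exact (min_le_right _ _).trans (Ctx.length_le a b)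
    beta_reduce
    omega

theorem PolyComp.length (b : Fin 3) (hb : b ≠ 2) :
    PolyComp fun a : α => (Ctx.data a b).length := by
  have hc := PolyBdd.const (Ctx.size (α := α))
  have hs : PolyBdd (Ctx.size (α := α)) Ctx.size := PolyBdd.of_le fun _ => le_rfl
  refine ⟨fun args m => (pour b m).seq (restore b),
    fun a => (Ctx.size a * 4 + 2) + (Ctx.size a * 3 + 2),
    ((hs.mul (hc _)).add (hc _)).add ((hs.mul (hc _)).add (hc _)), fun a args m ρ hρ => ?_⟩
  have e : Function.update (Function.update (Ctx.data a) b (Ctx.data a b)) 2 [] =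
      Ctx.data a := by
    rw [Function.update_eq_self, ← Ctx.data_two a, Function.update_eq_self]
  have h1 := runs_pour hb m ρ (Ctx.data a b) [] (Ctx.data a)
  have h2 := runs_restore hb (Function.update ρ m (ρ m + (Ctx.data a b).length))
    ((Ctx.data a b).reverse ++ []) (Function.update (Ctx.data a) b [])
  have h3 := h1.seq h2
  simp only [List.append_nil, List.reverse_reverse, Function.update_self, Function.update_idem,
    e, hρ.2 m le_rfl, Nat.zero_add] at h3
  have h4 := Ctx.length_le a b
  refine h3.congr (fun _ => rfl) (fun _ => rfl) ?_
  rw [List.length_reverse]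
  beta_reduce
  omega

end

end StackProg

/-! ## Closure properties of polynomial-time register functions -/

namespace StackProg

section

variable {α A : Type} [Ctx α A] [Inhabited A]

theorem PolyComp.congr {f g : α → ℕ} (hf : PolyComp f) (h : ∀ a, g a = f a) : PolyComp g := by
  rwa [funext h]

theorem PolyComp.iterate {n init B : α → ℕ} {h : α → ℕ → ℕ} (hn : PolyComp n)
    (hi : PolyComp init) (hh : PolyComp fun x : α × ℕ => h x.1 x.2) (hB : PolyBdd Ctx.size B)
    (hle : ∀ a, ∀ i ≤ n a, (h a)^[i] (init a) ≤ B a) :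
    PolyComp fun a => (h a)^[n a] (init a) := by
  have key : ∀ a i, (Nat.rec (init a) (fun _ r => h a r) i : ℕ) = (h a)^[i] (init a) := by
    intro a i
    induction i with
    | zero => rfl
    | succ i ih => rw [Function.iterate_succ_apply', ← ih]
  refine ((CompIn.loop hn hi hh.weaken_second (B := B) fun a i hi => ?_).polyComp hB).congr
    fun a => (key a _).symm
  exact (key a i).trans_le (hle a i hi)

theorem iterate_le_add {h : ℕ → ℕ} {G : ℕ} (hG : ∀ q, h q ≤ q + G) (i q : ℕ) :
    h^[i] q ≤ q + i * G := by
  induction i with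
  | zero => simp
  | succ i ih =>
    rw [Function.iterate_succ_apply', Nat.add_mul]
    have := hG (h^[i] q)
    omega

/-- Growth by at most `G a` per round keeps all iterates below `init a + n a * G a`. All loops that
move through the input are of this kind. -/
theorem PolyComp.iterate_of_le_add {n init G : α → ℕ} {h : α → ℕ → ℕ} (hn : PolyComp n)
    (hi : PolyComp init) (hh : PolyComp fun x : α × ℕ => h x.1 x.2) (hG : PolyBdd Ctx.size G)
    (hle : ∀ a q, h a q ≤ q + G a) : PolyComp fun a => (h a)^[n a] (init a) :=
  hn.iterate hi hh (hi.polyBdd.add (hn.polyBdd.mul hG)) fun a i hi =>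
    (StackProg.iterate_le_add (hle a) i _).trans
      (Nat.add_le_add_left (Nat.mul_le_mul_right _ hi) _)

theorem PolyComp.add {f g : α → ℕ} (hf : PolyComp f) (hg : PolyComp g) :
    PolyComp fun a => f a + g a :=
  (hg.iterate_of_le_add hf (h := fun _ r => r + 1) PolyComp.var.succ (PolyBdd.const _ 1)
    fun _ _ => le_rfl).congr fun a => (Nat.succ_iterate (f a) (g a)).symm

theorem PolyComp.sub {f g : α → ℕ} (hf : PolyComp f) (hg : PolyComp g) :
    PolyComp fun a => f a - g a :=
  (hg.iterate_of_le_add hf (h := fun _ r => r - 1) PolyComp.var.pred (PolyBdd.const _ 0)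
    fun _ _ => Nat.sub_le _ _).congr fun a => (Nat.pred_iterate (f a) (g a)).symm

theorem PolyComp.mul {f g : α → ℕ} (hf : PolyComp f) (hg : PolyComp g) :
    PolyComp fun a => f a * g a :=
  (hg.iterate_of_le_add (PolyComp.const 0) (h := fun a r => r + f a)
    (PolyComp.var.add hf.weaken) hf.polyBdd fun _ _ => le_rfl).congr fun a => by
      have : ∀ n m, (fun r => r + f a)^[n] m = m + f a * n := by
        intro n m
        induction n with
        | zero => rfl
        | succ n ih => rw [Function.iterate_succ_apply', ih, Nat.mul_succ, Nat.add_assoc]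
      simp [this]

/-- Partial sums are at most the whole sum, which is polynomial because both the number of terms and
the terms are. -/
theorem PolyComp.sum {n : α → ℕ} {g : α → ℕ → ℕ} (hn : PolyComp n)
    (hg : PolyComp fun x : α × ℕ => g x.1 x.2) :
    PolyComp fun a => ∑ i ∈ Finset.range (n a), g a i := by
  have key : ∀ a i, (Nat.rec 0 (fun i r => r + g a i) i : ℕ) = ∑ j ∈ Finset.range i, g a j := by
    intro a i
    induction i with
    | zero => rfl
    | succ i ih => rw [Finset.sum_range_succ, ← ih]
  refine ((CompIn.loop hn (PolyComp.const 0) (PolyComp.var.add hg.weaken)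
    (B := fun a => ∑ i ∈ Finset.range (n a), g a i) fun a i hi => ?_).polyComp ?_).congr
    fun a => (key a _).symm
  · refine (key a i).trans_le (Finset.sum_le_sum_of_subset ?_)
    exact Finset.range_subset_range.2 hi
  · obtain ⟨c, hc⟩ := hg.polyBdd
    refine (hn.polyBdd.mul ((((PolyBdd.of_le fun _ => le_rfl).add hn.polyBdd).add
      (PolyBdd.const _ 2)).pow c)).mono fun a => ?_
    refine (Finset.sum_le_card_nsmul _ _ ((Ctx.size a + n a + 2) ^ c) fun i hi => ?_).trans ?_
    · refine (hc (a, i)).trans (Nat.pow_le_pow_left ?_ c)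
      show Ctx.size a + i + 2 ≤ _
      have := Finset.mem_range.1 hi
      omega
    · simp

open Classical in
/-- `p` is decided in time polynomial in the size of the context. -/
def PolyDec (p : α → Prop) : Prop := PolyComp fun a => if p a then 1 else 0

namespace PolyDec

variable {p q : α → Prop} {f g : α → ℕ}

theorem congr (hp : PolyDec p) (h : ∀ a, q a ↔ p a) : PolyDec q := by
  rwa [funext fun a => propext (h a)]

theorem ite [DecidablePred p] (hp : PolyDec p) (hf : PolyComp f) (hg : PolyComp g) :
    PolyComp fun a => if p a then f a else g a :=
  (PolyComp.ifZero hp hg hf).congr fun a => by by_cases h : p a <;> simp [h]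

theorem eq_zero (hf : PolyComp f) : PolyDec fun a => f a = 0 :=
  (hf.ifZero (PolyComp.const 1) (PolyComp.const 0)).congr fun a => by
    by_cases h : f a = 0 <;> simp [h]

theorem not (hp : PolyDec p) : PolyDec fun a => ¬p a :=
  (eq_zero hp).congr fun a => by by_cases h : p a <;> simp [h]

theorem and (hp : PolyDec p) (hq : PolyDec q) : PolyDec fun a => p a ∧ q a :=
  (eq_zero (hp.not.add hq.not)).congr fun a => by
    by_cases h : p a <;> by_cases h' : q a <;> simp [h, h']

theorem or (hp : PolyDec p) (hq : PolyDec q) : PolyDec fun a => p a ∨ q a :=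
  (hp.not.and hq.not).not.congr fun a => by tauto

theorem imp (hp : PolyDec p) (hq : PolyDec q) : PolyDec fun a => p a → q a :=
  (hp.not.or hq).congr fun a => by tauto

theorem le (hf : PolyComp f) (hg : PolyComp g) : PolyDec fun a => f a ≤ g a :=
  (eq_zero (hf.sub hg)).congr fun a => by omega

theorem lt (hf : PolyComp f) (hg : PolyComp g) : PolyDec fun a => f a < g a :=
  le hf.succ hg

theorem eq (hf : PolyComp f) (hg : PolyComp g) : PolyDec fun a => f a = g a :=
  ((le hf hg).and (le hg hf)).congr fun _ => le_antisymm_iff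

theorem count {n : α → ℕ} {p : α → ℕ → Prop} [∀ a i, Decidable (p a i)] (hn : PolyComp n)
    (hp : PolyDec fun x : α × ℕ => p x.1 x.2) :
    PolyComp fun a => ∑ i ∈ Finset.range (n a), if p a i then 1 else 0 :=
  PolyComp.sum (g := fun a i => if p a i then 1 else 0) hn
    (PolyComp.congr hp fun x => by congr)

/-- A bounded quantifier holds iff the number of counterexamples, a sum, is zero. -/
theorem all {n : α → ℕ} {p : α → ℕ → Prop} (hn : PolyComp n)
    (hp : PolyDec fun x : α × ℕ => p x.1 x.2) : PolyDec fun a => ∀ i < n a, p a i := by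
  classical
  exact (eq_zero (count (p := fun a i => ¬p a i) hn hp.not)).congr fun a => by simp

theorem ex {n : α → ℕ} {p : α → ℕ → Prop} (hn : PolyComp n)
    (hp : PolyDec fun x : α × ℕ => p x.1 x.2) : PolyDec fun a => ∃ i < n a, p a i :=
  (all (p := fun a i => ¬p a i) hn hp.not).not.congr fun a => by push Not; rfl

theorem testAt (hf : PolyComp f) (b : Fin 3) (hb : b ≠ 2) (t : Option A → Prop) :
    PolyDec fun a : α => t (Ctx.data a b)[f a]? := by
  classical
  exact (hf.testAt b hb fun o => decide (t o)).congr fun a => by simp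

end PolyDec

theorem PolyComp.half {f : α → ℕ} (hf : PolyComp f) : PolyComp fun a => f a / 2 :=
  (PolyDec.count (p := fun a i => 2 * (i + 1) ≤ f a) hf
    (PolyDec.le ((PolyComp.const 2).mul PolyComp.var.succ) hf.weaken)).congr fun a => by
    have : (Finset.range (f a)).filter (fun i => 2 * (i + 1) ≤ f a) = Finset.range (f a / 2) := by
      ext; simp; omega
    rw [Finset.sum_boole, this, Finset.card_range, Nat.cast_id]

/-- The bit is the parity of `q = f a / 2 ^ g a`, obtained by repeated halving and computed as `q -
2 * (q / 2)`. -/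
theorem PolyDec.testBit {f g : α → ℕ} (hf : PolyComp f) (hg : PolyComp g) :
    PolyDec fun a => (f a).testBit (g a) = true := by
  have h1 : PolyComp fun a => (fun r => r / 2)^[g a] (f a) :=
    hg.iterate_of_le_add hf (h := fun _ r => r / 2) PolyComp.var.half (PolyBdd.const _ 0)
      fun _ q => Nat.div_le_self q 2
  refine (PolyDec.eq (h1.sub ((PolyComp.const 2).mul h1.half)) (PolyComp.const 1)).congr
    fun a => ?_
  have : ∀ j s, (fun r => r / 2)^[j] s = s / 2 ^ j := by
    intro j s
    induction j with
    | zero => simp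
    | succ j ih => rw [Function.iterate_succ_apply', ih, Nat.div_div_eq_div_mul, pow_succ]
  rw [this, Nat.testBit_eq_decide_div_mod_eq, decide_eq_true_iff]
  omega

end

end StackProg

/-! ## Plans without preconditions -/

namespace SASPlus

/-! ### Trees of actions and repaired sequences. -/

section Covers

variable {V ι : Type}

/-- The variables written by an action, or by no action. -/
def writes (wr : ι → Set V) : Option ι → Set V
  | none => ∅
  | some a => wr a

/-- The variables written by a sequence of actions. -/
def written (wr : ι → Set V) (ω : List ι) : Set V := {v | ∃ a ∈ ω, v ∈ wr a}

/-- `Covers wr bad c x S`: before the variables written by `x`, all variables of `S` can be written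
by at most `c` further actions (arranged in a tree with root `x`) in such a way that every bad
effect is overwritten. -/
inductive Covers (wr bad : ι → Set V) : ℕ → Option ι → Set V → Prop
  | base {c x S} : S ⊆ writes wr x → Covers wr bad c x S
  -- A child `b` repaired by `x` is attached. Its subtree has `c₁` actions below `b`, the rest of
  -- the tree has `c₂`; the strict inequality pays for `b` itself.
  | step {c x S b c₁ c₂ S₁ S₂} : bad b ⊆ writes wr x → c₁ + c₂ < c →
      S ⊆ writes wr x ∪ S₁ ∪ S₂ → Covers wr bad c₁ (some b) S₁ → Covers wr bad c₂ x S₂ →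
      Covers wr bad c x S

/-- Every bad effect of an action of the sequence lies in `F` or is overwritten later. -/
def Repaired (wr bad : ι → Set V) (F : Set V) : List ι → Prop
  | [] => True
  | a :: ω => bad a ⊆ F ∪ written wr ω ∧ Repaired wr bad F ω

variable {wr bad : ι → Set V}

theorem written_nil : written wr [] = ∅ := by simp [written]

theorem written_cons (a : ι) (ω : List ι) : written wr (a :: ω) = wr a ∪ written wr ω := by
  ext v; simp [written]

theorem written_append (ω ω' : List ι) :
    written wr (ω ++ ω') = written wr ω ∪ written wr ω' := by
  ext v; simp [written, or_and_right, exists_or]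

theorem repaired_append (F : Set V) (ω ω' : List ι) :
    Repaired wr bad F (ω ++ ω') ↔
      Repaired wr bad (F ∪ written wr ω') ω ∧ Repaired wr bad F ω' := by
  induction ω with
  | nil => simp [Repaired]
  | cons a ω ih =>
    simp only [List.cons_append, Repaired, ih, written_append, and_assoc]
    rw [show F ∪ (written wr ω ∪ written wr ω') = F ∪ written wr ω' ∪ written wr ω by
      ext; simp only [Set.mem_union]; tauto]

namespace Covers

theorem mono {c c' : ℕ} {x : Option ι} {S S' : Set V} (h : Covers wr bad c x S) (hc : c ≤ c')
    (hS : S' ⊆ S) : Covers wr bad c' x S' := by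
  cases h with
  | base h => exact base (hS.trans h)
  | step h1 h2 h3 h4 h5 => exact step h1 (h2.trans_le hc) (hS.trans h3) h4 h5

/-- The tree is listed with every child before its parent. `F` stands for everything written after
the list, the root's variables included. -/
theorem exists_repaired {c : ℕ} {x : Option ι} {S : Set V} (h : Covers wr bad c x S) (F : Set V)
    (hF : writes wr x ⊆ F) :
    ∃ ω : List ι, ω.length ≤ c ∧ Repaired wr bad F ω ∧ S ⊆ F ∪ written wr ω := by
  induction h generalizing F with
  | base h => exact ⟨[], Nat.zero_le _, trivial, (h.trans hF).trans Set.subset_union_left⟩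
  | @step c x S b c₁ c₂ S₁ S₂ hb hc hS _ _ ih1 ih2 =>
    obtain ⟨ω₁, l1, r1, s1⟩ := ih1 (F ∪ wr b) Set.subset_union_right
    obtain ⟨ω₂, l2, r2, s2⟩ := ih2 (F ∪ written wr (ω₁ ++ [b]))
      (hF.trans Set.subset_union_left)
    -- The subtree of `b` is listed as a block ending with `b`. The rest may precede it, since
    -- additional later writes only help to repair.
    refine ⟨ω₂ ++ (ω₁ ++ [b]), by simp; omega, ?_, ?_⟩
    · rw [repaired_append, repaired_append]
      refine ⟨r2, ?_, (hb.trans hF).trans Set.subset_union_left, trivial⟩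
      rwa [written_cons, written_nil, Set.union_empty]
    · intro v hv
      have h1 := @s1 v
      have h2 := @s2 v
      have h3 := @hF v
      have h4 := hS hv
      simp only [written_append, written_cons, written_nil, Set.mem_union,
        Set.union_empty] at h1 h2 h4 ⊢
      tauto

end Covers

/-- A sequence in which bad effects are overwritten later and in which every action writes a
variable that is not written later. -/
def Clean (wr bad : ι → Set V) : List ι → Prop
  | [] => True
  | a :: ω => bad a ⊆ written wr ω ∧ ¬wr a ⊆ written wr ω ∧ Clean wr bad ω

/-- Deleting an action whose variables are all written later does not change the set of written
variables, so it spoils no repair of an earlier action. -/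
theorem Repaired.exists_clean {ω : List ι} (h : Repaired wr bad ∅ ω) :
    ∃ ω', ω'.length ≤ ω.length ∧ written wr ω' = written wr ω ∧ Clean wr bad ω' := by
  induction ω with
  | nil => exact ⟨[], le_rfl, rfl, trivial⟩
  | cons a ω ih =>
    obtain ⟨ω', h1, h2, h3⟩ := ih h.2
    by_cases ha : wr a ⊆ written wr ω
    · refine ⟨ω', h1.trans (Nat.le_succ _), ?_, h3⟩
      rw [h2, written_cons, Set.union_eq_self_of_subset_left ha]
    · refine ⟨a :: ω', Nat.succ_le_succ h1, by rw [written_cons, written_cons, h2], ?_, ?_, h3⟩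
      · simpa [h2] using h.1
      · rwa [h2]

theorem Clean.nodup {ω : List ι} (h : Clean wr bad ω) : ω.Nodup := by
  induction ω with
  | nil => exact List.nodup_nil
  | cons a ω ih => exact List.nodup_cons.2 ⟨fun ha => h.2.1 fun v hv => ⟨a, ha, hv⟩, ih h.2.2⟩

theorem sum_map_update [DecidableEq ι] {ω : List ι} (hω : ω.Nodup) {p : ι} (hp : p ∈ ω)
    (f : ι → ℕ) (x : ℕ) :
    (ω.map (Function.update f p (f p + x))).sum = (ω.map f).sum + x := by
  induction ω with
  | nil => simp at hp
  | cons a ω ih =>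
    obtain ⟨h1, h2⟩ := List.nodup_cons.1 hω
    rcases List.mem_cons.1 hp with rfl | hp
    · rw [List.map_cons, List.map_cons, List.sum_cons, List.sum_cons, Function.update_self,
        List.map_congr_left (g := f) fun b hb => Function.update_of_ne
          (by rintro rfl; exact h1 hb) _ _]
      omega
    · rw [List.map_cons, List.map_cons, List.sum_cons, List.sum_cons, ih h2 hp,
        Function.update_of_ne (by rintro rfl; exact h1 hp)]
      omega

/-- The sequence is consumed from the front. Each remaining action `a` carries the tree already
collected below it, with budget `c a` and set `S a`; the virtual root carries `c₀` and `S₀`. The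
first action has its tree complete, because children come before parents, and is attached to its
parent. The total budget is invariant. -/
theorem Clean.covers (hbad : ∀ a, bad a ⊆ wr a)
    (h2 : ∀ a, ∀ u ∈ wr a, ∀ v ∈ wr a, ∀ w ∈ wr a, u = v ∨ u = w ∨ v = w) {ω : List ι}
    (h : Clean wr bad ω) (S₀ : Set V) (c₀ : ℕ) (S : ι → Set V) (c : ι → ℕ)
    (hS₀ : Covers wr bad c₀ none S₀) (hS : ∀ a ∈ ω, Covers wr bad (c a) (some a) (S a)) :
    Covers wr bad (c₀ + (ω.map fun a => c a + 1).sum) none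
      (S₀ ∪ {v | ∃ a ∈ ω, v ∈ S a}) := by
  classical
  induction ω generalizing S₀ c₀ S c with
  | nil => simpa using hS₀
  | cons a ω ih =>
    obtain ⟨h3, h4, h5⟩ := h
    have ha : a ∉ ω := fun ha => h4 fun v hv => ⟨a, ha, hv⟩
    obtain ⟨u, hu, hu'⟩ := Set.not_subset.1 h4
    have hSa := hS a List.mem_cons_self
    rcases Set.eq_empty_or_nonempty (bad a) with hb | ⟨x, hx⟩
    -- Nothing has to be repaired, so `a` becomes a child of the virtual root.
    · refine (ih h5 (S₀ ∪ S a) (c₀ + (c a + 1)) S c (.step (b := a) (by simp [hb])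
        (by omega) ?_ hSa hS₀) fun b hb => hS b (List.mem_cons_of_mem a hb)).mono ?_ ?_
      · intro v hv
        simp only [Set.mem_union] at hv ⊢
        tauto
      · rw [List.map_cons, List.sum_cons]; omega
      · intro v hv
        simp only [Set.mem_union, Set.mem_ofPred_eq, List.exists_mem_cons_iff] at hv ⊢
        tauto
    · obtain ⟨p, hp, hxp⟩ := h3 hx
      -- As `a` writes at most two variables and `u` is not written later, `x` is the only bad one;
      -- so `p`, which writes `x`, repairs all of `a`.
      have hbp : bad a ⊆ wr p := by
        intro y hy
        rcases h2 a u hu x (hbad a hx) y (hbad a hy) with e | e | e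
        · exact absurd (e ▸ h3 hx) hu'
        · exact absurd (e ▸ h3 hy) hu'
        · exact e ▸ hxp
      -- The tree of `a` is attached to `p`, whose budget grows by `c a` and by one for `a`.
      have key := ih h5 S₀ c₀ (Function.update S p (S p ∪ S a))
        (Function.update c p (c p + (c a + 1))) hS₀ fun b hb => ?_
      · refine key.mono ?_ ?_
        · have e : (fun b => Function.update c p (c p + (c a + 1)) b + 1) =
              Function.update (fun b => c b + 1) p (c p + 1 + (c a + 1)) := by
            funext b
            by_cases hbp : b = p
            · subst hbp; simp; omega
            · simp [hbp]
          rw [e, sum_map_update h5.nodup hp (fun b => c b + 1), List.map_cons, List.sum_cons]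
          omega
        · intro v hv
          simp only [Set.mem_union, Set.mem_ofPred_eq, List.exists_mem_cons_iff] at hv ⊢
          rcases hv with hv | hv | ⟨b, hb, hv⟩
          · exact Or.inl hv
          · exact Or.inr ⟨p, hp, by simp [hv]⟩
          · refine Or.inr ⟨b, hb, ?_⟩
            by_cases hbp : b = p
            · subst hbp; simp [hv]
            · simpa [hbp] using hv
      · by_cases hbp' : b = p
        · subst hbp'
          rw [Function.update_self, Function.update_self]
          refine .step hbp (by omega) ?_ hSa (hS b (List.mem_cons_of_mem a hb))
          intro v hv
          simp only [Set.mem_union] at hv ⊢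
          tauto
        · rw [Function.update_of_ne hbp', Function.update_of_ne hbp']
          exact hS b (List.mem_cons_of_mem a hb)

theorem covers_none_iff (hbad : ∀ a, bad a ⊆ wr a)
    (h2 : ∀ a, ∀ u ∈ wr a, ∀ v ∈ wr a, ∀ w ∈ wr a, u = v ∨ u = w ∨ v = w) (k : ℕ) (T : Set V) :
    Covers wr bad k none T ↔
      ∃ ω : List ι, ω.length ≤ k ∧ Repaired wr bad ∅ ω ∧ T ⊆ written wr ω := by
  constructor
  · intro h
    obtain ⟨ω, h1, h2, h3⟩ := h.exists_repaired ∅ (by simp [writes])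
    exact ⟨ω, h1, h2, by simpa using h3⟩
  · rintro ⟨ω, hk, hr, hT⟩
    obtain ⟨ω', h1, h3, h4⟩ := hr.exists_clean
    -- Initially every action is a tree of its own, covering what it writes with no further action.
    refine (h4.covers hbad h2 ∅ 0 wr (fun _ => 0) (.base (Set.empty_subset _))
      fun a _ => .base subset_rfl).mono ?_ ?_
    · simp; omega
    · rw [← h3] at hT
      exact hT.trans Set.subset_union_right

end Covers

/-! ### Plans without preconditions as repaired sequences. -/

section Plans

variable {V D : Type}

/-- The effect of `a` on `v` contradicts the goal. -/
def Action.Bad (a : Action V D) (goal : PartialState V D) (v : V) : Prop :=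
  ∃ x y, a.eff v = some x ∧ goal v = some y ∧ x ≠ y

/-- Validity is automatic, so only the last writer of each variable matters, or the value in `s` if
there is no writer. -/
theorem isPlanFrom_goal_iff {goal : PartialState V D} {ω : List (Action V D)}
    (hω : ∀ a ∈ ω, ∀ v, a.pre v = none) (s : State V D) :
    (∃ t, IsPlanFrom s ω t ∧ ∀ v, goal v = some (t v) ∨ goal v = none) ↔
      Repaired (fun a : Action V D => {v | (a.eff v).isSome})
        (fun a => {v | a.Bad goal v}) ∅ ω ∧
      {v | ∃ y, goal v = some y ∧ y ≠ s v} ⊆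
        written (fun a : Action V D => {v | (a.eff v).isSome}) ω := by
  induction ω generalizing s with
  | nil =>
    simp only [IsPlanFrom, Repaired, written_nil, true_and, exists_eq_left', Set.subset_empty_iff,
      Set.eq_empty_iff_forall_notMem, Set.mem_ofPred_eq, not_exists, not_and]
    refine forall_congr' fun v => ?_
    cases goal v <;> simp
  | cons a ω ih =>
    have hv : a.Valid s := fun v => Or.inr (hω a List.mem_cons_self v)
    simp only [IsPlanFrom, hv, true_and, ih fun b hb => hω b (List.mem_cons_of_mem a hb),
      Repaired, written_cons, Set.empty_union, and_assoc]
    rw [and_left_comm]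
    refine and_congr_right fun _ => ?_
    -- A variable is wrong after `a` iff `a` has a bad effect on it, or it was wrong before and `a`
    -- does not write it.
    simp only [Set.subset_def, Set.mem_ofPred_eq, Set.mem_union, Action.Bad, ← forall_and]
    refine forall_congr' fun v => ?_
    cases hg : goal v with
    | none => simp
    | some y => cases he : a.eff v <;> simp [Action.result, he, eq_comm (a := y)]

theorem Repaired.map_iff {V ι κ : Type} {wr bad : ι → Set V} (f : κ → ι) (F : Set V)
    (ω : List κ) :
    Repaired wr bad F (ω.map f) ↔ Repaired (fun a => wr (f a)) (fun a => bad (f a)) F ω := by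
  induction ω with
  | nil => rfl
  | cons a ω ih =>
    simp only [List.map_cons, Repaired, ih]
    simp [written]

variable [Fintype V]

theorem Action.eq_or_of_numEff_le {a : Action V D} (h : a.numEff ≤ 2) {u v w : V}
    (hu : (a.eff u).isSome) (hv : (a.eff v).isSome) (hw : (a.eff w).isSome) :
    u = v ∨ u = w ∨ v = w := by
  classical
  by_contra! hne
  have : ({u, v, w} : Finset V) ⊆ Finset.univ.filter fun v => (a.eff v).isSome = true := by
    intro x hx
    simp only [Finset.mem_insert, Finset.mem_singleton] at hx
    rcases hx with rfl | rfl | rfl <;> simp [*]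
  have h3 := Finset.card_le_card this
  rw [Finset.card_eq_three.2 ⟨u, v, w, hne.1, hne.2.1, hne.2.2, rfl⟩] at h3
  unfold Action.numEff at h
  omega

theorem Action.pre_eq_none {a : Action V D} (h : a.numPre ≤ 0) (v : V) : a.pre v = none := by
  have h1 := Finset.card_eq_zero.1 (Nat.le_zero.1 h)
  have h2 := Finset.eq_empty_iff_forall_notMem.1 h1 v
  simpa using h2

namespace Instance

/-- The variables whose initial value contradicts the goal. -/
def Wrong (P : Instance V D) (v : V) : Prop := ∃ y, P.goal v = some y ∧ y ≠ P.init v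

theorem exists_plan_iff {P : Instance V D} (hP : P.Bounded 0 2) (k : ℕ) :
    (∃ ω, P.IsPlan ω ∧ ω.length ≤ k) ↔
      Covers (fun i : Fin P.actions.length => {v | ((P.actions.get i).eff v).isSome})
        (fun i => {v | (P.actions.get i).Bad P.goal v}) k none {v | P.Wrong v} := by
  rw [covers_none_iff]
  · constructor
    · rintro ⟨ω, ⟨hω, hplan⟩, hk⟩
      have hpre : ∀ a ∈ ω, ∀ v, a.pre v = none :=
        fun a ha => Action.pre_eq_none (hP a (hω a ha)).1
      obtain ⟨h1, h2⟩ := (isPlanFrom_goal_iff hpre P.init).1 hplan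
      have : ∃ ω' : List (Fin P.actions.length), ω'.map P.actions.get = ω := by
        clear hplan hk hpre h1 h2
        induction ω with
        | nil => exact ⟨[], rfl⟩
        | cons a ω ih =>
          obtain ⟨ω', h⟩ := ih fun b hb => hω b (List.mem_cons_of_mem a hb)
          obtain ⟨i, hi, rfl⟩ := List.getElem_of_mem (hω a List.mem_cons_self)
          exact ⟨⟨i, hi⟩ :: ω', by simp [h]⟩
      obtain ⟨ω', rfl⟩ := this
      refine ⟨ω', by simpa using hk, (Repaired.map_iff _ _ _).1 h1, ?_⟩
      refine h2.trans ?_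
      rintro v ⟨a, ha, hv⟩
      obtain ⟨i, hi, rfl⟩ := List.mem_map.1 ha
      exact ⟨i, hi, hv⟩
    · rintro ⟨ω, hk, h1, h2⟩
      have hmem : ∀ a ∈ ω.map P.actions.get, a ∈ P.actions := by
        intro a ha
        obtain ⟨i, _, rfl⟩ := List.mem_map.1 ha
        exact List.getElem_mem _
      refine ⟨ω.map P.actions.get, ⟨hmem, ?_⟩, by simpa using hk⟩
      refine (isPlanFrom_goal_iff (fun a ha => Action.pre_eq_none (hP a (hmem a ha)).1) _).2
        ⟨(Repaired.map_iff _ _ _).2 h1, h2.trans ?_⟩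
      rintro v ⟨i, hi, hv⟩
      exact ⟨_, List.mem_map_of_mem hi, hv⟩
  · rintro i v ⟨x, y, hx, _⟩
    exact Option.isSome_iff_exists.2 ⟨x, hx⟩
  · intro i u hu v hv w hw
    exact Action.eq_or_of_numEff_le (hP _ (List.getElem_mem _)).2 hu hv hw

-- Every wrong variable must be written, and an action writes at most two variables. This keeps the
-- number of sets in the table at `4 ^ k`.
open Classical in
theorem card_wrong_le {P : Instance V D} (hP : P.Bounded 0 2) {k : ℕ}
    (h : ∃ ω, P.IsPlan ω ∧ ω.length ≤ k) :
    (Finset.univ.filter fun v => P.Wrong v).card ≤ 2 * k := by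
  obtain ⟨ω, ⟨hω, hplan⟩, hk⟩ := h
  have hpre : ∀ a ∈ ω, ∀ v, a.pre v = none :=
    fun a ha => Action.pre_eq_none (hP a (hω a ha)).1
  obtain ⟨-, h2⟩ := (isPlanFrom_goal_iff hpre P.init).1 hplan
  have h3 : (Finset.univ.filter fun v => P.Wrong v) ⊆
      ω.toFinset.biUnion fun a => Finset.univ.filter fun v => (a.eff v).isSome = true := by
    intro v hv
    obtain ⟨a, ha, hav⟩ := h2 (Finset.mem_filter.1 hv).2
    exact Finset.mem_biUnion.2 ⟨a, List.mem_toFinset.2 ha, by simpa using hav⟩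
  refine (Finset.card_le_card h3).trans ((Finset.card_biUnion_le_card_mul _ _ 2 fun a ha =>
    (hP a (hω a (List.mem_toFinset.1 ha))).2).trans ?_)
  have := List.toFinset_card_le ω
  omega

end Instance

end Plans

end SASPlus

/-! ## Reading an instance from its encoding -/

namespace SASPlus

/-- The symbols of the input of an algorithm. -/
abbrev Cell : Type := Option (Symbol ⊕ Bool)

/-- A string of symbols as part of the input of an algorithm. -/
def lift (w : List Symbol) : List Cell := w.map fun x => some (Sum.inl x)

theorem lift_append (w w' : List Symbol) : lift (w ++ w') = lift w ++ lift w' := List.map_append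

theorem length_lift (w : List Symbol) : (lift w).length = w.length := List.length_map _

/-- The symbol `s` is found at position `q`. -/
def At (l : List Cell) (q : ℕ) (s : Symbol) : Prop := l[q]? = some (some (Sum.inl s))

instance (l : List Cell) (q : ℕ) (s : Symbol) : Decidable (At l q s) :=
  inferInstanceAs (Decidable (_ = _))

theorem at_iff_drop {l : List Cell} {q : ℕ} {s : Symbol} :
    At l q s ↔ l.drop q = lift [s] ++ l.drop (q + 1) := by
  unfold At
  constructor
  · intro h
    obtain ⟨hq, h⟩ := List.getElem?_eq_some_iff.1 h
    rw [List.drop_eq_getElem_cons hq, h]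
    rfl
  · intro h
    rw [← List.head?_drop, h]
    rfl

theorem at_of_drop {l : List Cell} {q : ℕ} {s : Symbol} {w : List Symbol} {t : List Cell}
    (h : l.drop q = lift (s :: w) ++ t) : At l q s := by
  unfold At
  rw [← List.head?_drop, h]
  rfl

theorem drop_add {l a t : List Cell} {q : ℕ} (h : l.drop q = a ++ t) :
    l.drop (q + a.length) = t := by
  rw [← List.drop_drop, h, List.drop_left]

/-- The end of the strokes that start at position `q`. -/
def strokesEnd (l : List Cell) (q : ℕ) : ℕ :=
  (fun r => if At l r Symbol.one then r + 1 else r)^[l.length] q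

theorem drop_strokesEnd (l : List Cell) (q : ℕ) :
    q ≤ strokesEnd l q ∧
      l.drop q = lift (List.replicate (strokesEnd l q - q) Symbol.one) ++ l.drop (strokesEnd l q) := by
  unfold strokesEnd
  generalize l.length = m
  induction m with
  | zero => exact ⟨le_rfl, by simp [lift]⟩
  | succ m ih =>
    rw [Function.iterate_succ_apply']
    split_ifs with h
    · refine ⟨ih.1.trans (Nat.le_succ _), ?_⟩
      rw [Nat.sub_add_comm ih.1, List.replicate_succ', lift_append, List.append_assoc,
        ← at_iff_drop.1 h]
      exact ih.2
    · exact ih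

/-- The scan stands still once it meets a symbol other than a stroke, so `l.length` iterations
suffice. -/
theorem strokesEnd_eq {l : List Cell} {q x : ℕ} {s : Symbol} (hs : s ≠ Symbol.one) {w : List Symbol}
    {t : List Cell} (h : l.drop q = lift (List.replicate x Symbol.one ++ s :: w) ++ t) :
    strokesEnd l q = q + x := by
  have hx : x ≤ l.length := by
    have := congrArg List.length h
    simp only [List.length_drop, List.length_append, length_lift, List.length_replicate] at this
    omega
  have key : ∀ y m, y ≤ m → ∀ q, l.drop q = lift (List.replicate y Symbol.one ++ s :: w) ++ t →
      (fun r => if At l r Symbol.one then r + 1 else r)^[m] q = q + y := by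
    intro y
    induction y with
    | zero =>
      intro m _ q h
      have h1 : ¬At l q Symbol.one := by
        have : At l q s := at_of_drop h
        unfold At at this ⊢
        rw [this]
        simpa using hs
      exact Function.iterate_fixed (f := fun r => if At l r Symbol.one then r + 1 else r)
        (if_neg h1) m
    | succ y ih =>
      intro m hm q h
      obtain ⟨m, rfl⟩ := Nat.exists_eq_add_of_lt hm
      have h1 : At l q Symbol.one := at_of_drop h
      rw [Function.iterate_succ_apply, if_pos h1, ih _ (by omega)]
      · omega
      · exact drop_add (a := lift [Symbol.one]) h
  exact key x _ hx q h

/-- The position after the entry that starts at position `q`. -/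
def next (l : List Cell) (q : ℕ) : ℕ := if At l q Symbol.undef then q + 2 else strokesEnd l q + 1

/-- A value below `d` or the undefined value is written at position `q`. -/
def EntryOk (l : List Cell) (d q : ℕ) : Prop :=
  (At l q Symbol.undef ∧ At l (q + 1) Symbol.endEntry) ∨
    (¬At l q Symbol.undef ∧ At l (strokesEnd l q) Symbol.endEntry ∧ strokesEnd l q - q < d)

theorem EntryOk.exists_value {l : List Cell} {d q : ℕ} (h : EntryOk l d q) :
    ∃ o : Option (Fin d), l.drop q = lift (encodeValue o) ++ l.drop (next l q) := by
  rcases h with ⟨h1, h2⟩ | ⟨h1, h2, h3⟩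
  · refine ⟨none, ?_⟩
    rw [next, if_pos h1, at_iff_drop.1 h1, at_iff_drop.1 h2]
    rfl
  · refine ⟨some ⟨strokesEnd l q - q, h3⟩, ?_⟩
    rw [next, if_neg h1, (drop_strokesEnd l q).2, at_iff_drop.1 h2]
    simp [encodeValue, lift]

/-- The entry at position `q` is `o`. -/
structure ReadsEntry (l : List Cell) (q : ℕ) {d : ℕ} (o : Option (Fin d)) : Prop where
  undef_iff : At l q Symbol.undef ↔ o = none
  value_eq : ∀ x, o = some x → strokesEnd l q - q = x

/-- Converse of `EntryOk.exists_value`: a written entry passes the check, is read back correctly,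
and `next` jumps just behind it. -/
theorem readsEntry {l t : List Cell} {d q : ℕ} {o : Option (Fin d)}
    (h : l.drop q = lift (encodeValue o) ++ t) :
    EntryOk l d q ∧ ReadsEntry l q o ∧ next l q = q + (lift (encodeValue o)).length := by
  cases o with
  | none =>
    have h1 : At l q Symbol.undef := at_of_drop h
    have h2 : At l (q + 1) Symbol.endEntry :=
      at_of_drop (drop_add (a := lift [Symbol.undef]) (t := lift [Symbol.endEntry] ++ t) h)
    exact ⟨Or.inl ⟨h1, h2⟩, ⟨by simp [h1], by simp⟩, by rw [next, if_pos h1]; rfl⟩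
  | some x =>
    have h1 : strokesEnd l q = q + x := strokesEnd_eq (s := Symbol.endEntry) (w := []) (by decide) h
    have h2 : ¬At l q Symbol.undef := by
      unfold At
      rw [← List.head?_drop, h]
      obtain ⟨x, hx⟩ := x
      cases x <;> simp [encodeValue, lift, List.replicate_succ]
    have h3 : At l (strokesEnd l q) Symbol.endEntry := by
      have h4 := drop_add (a := lift (List.replicate x Symbol.one))
        (t := lift [Symbol.endEntry] ++ t) (by simpa [encodeValue, lift] using h)
      rw [length_lift, List.length_replicate] at h4
      rw [h1]
      exact at_of_drop h4
    refine ⟨Or.inr ⟨h2, h3, ?_⟩, ⟨by simp [h2], ?_⟩, ?_⟩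
    · rw [h1, Nat.add_sub_cancel_left]; exact x.2
    · rintro y hy
      rw [h1, Nat.add_sub_cancel_left, Option.some.inj hy]
    · rw [next, if_neg h2, h1, length_lift]
      simp [encodeValue, Nat.add_assoc]

theorem drop_flatten {l : List Cell} {E : List (List Symbol)} {q : ℕ → ℕ}
    (h : ∀ v, (hv : v < E.length) → l.drop (q v) = lift E[v] ++ l.drop (q (v + 1))) :
    l.drop (q 0) = lift E.flatten ++ l.drop (q E.length) := by
  induction E generalizing q with
  | nil => simp [lift]
  | cons e E ih =>
    have h0 := h 0 (Nat.succ_pos _)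
    have h1 := ih (q := fun v => q (v + 1)) fun v hv => h (v + 1) (Nat.succ_lt_succ hv)
    rw [h0, List.flatten_cons, lift_append, List.append_assoc]
    exact congrArg _ h1

/-- Where an entry starts is known only after its predecessor has been recognised; hence `h` assumes
the entry at `q v`, with an arbitrary rest, and yields `q (v + 1)`. -/
theorem drop_of_flatten {l t : List Cell} {E : List (List Symbol)} {q : ℕ → ℕ}
    (h0 : l.drop (q 0) = lift E.flatten ++ t)
    (h : ∀ v, (hv : v < E.length) → ∀ t', l.drop (q v) = lift E[v] ++ t' →
      q (v + 1) = q v + (lift E[v]).length) :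
    (∀ v, (hv : v < E.length) → ∃ t', l.drop (q v) = lift E[v] ++ t') ∧
      q E.length = q 0 + (lift E.flatten).length := by
  induction E generalizing q with
  | nil => exact ⟨fun v hv => absurd hv (Nat.not_lt_zero v), by simp [lift]⟩
  | cons e E ih =>
    rw [List.flatten_cons, lift_append, List.append_assoc] at h0
    have h1 := h 0 (Nat.succ_pos _) _ h0
    have h2 := drop_add h0
    rw [List.getElem_cons_zero] at h1
    rw [← h1] at h2
    obtain ⟨h3, h4⟩ := ih (q := fun v => q (v + 1)) h2 fun v hv => h (v + 1) (Nat.succ_lt_succ hv)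
    refine ⟨fun v hv => ?_, ?_⟩
    · cases v with
      | zero => exact ⟨_, h0⟩
      | succ v => exact h3 v (Nat.lt_of_succ_lt_succ hv)
    · rw [List.length_cons, h4, h1, List.flatten_cons, lift_append, List.length_append]
      omega

/-- The position after the row of `n` entries that starts at position `q`. -/
def nextRow (l : List Cell) (n q : ℕ) : ℕ := (next l)^[n] q + 1

/-- A row of `n` values below `d` or undefined values is written at position `q`. -/
def RowOk (l : List Cell) (n d q : ℕ) : Prop :=
  (∀ v < n, EntryOk l d ((next l)^[v] q)) ∧ At l ((next l)^[n] q) Symbol.endRow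

theorem RowOk.exists_partialState {l : List Cell} {n d q : ℕ} (h : RowOk l n d q) :
    ∃ s : PartialState (Fin n) (Fin d),
      l.drop q = lift (encodePartialState s) ++ l.drop (nextRow l n q) := by
  choose s hs using fun v : Fin n => (h.1 v v.2).exists_value
  refine ⟨s, ?_⟩
  have := drop_flatten (l := l) (E := List.ofFn fun v => encodeValue (s v))
    (q := fun v => (next l)^[v] q) fun v hv => by
      rw [List.getElem_ofFn, Function.iterate_succ_apply']
      exact hs ⟨v, by simpa using hv⟩
  rw [List.length_ofFn, at_iff_drop.1 h.2] at this
  rw [encodePartialState, lift_append, List.append_assoc]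
  exact this

/-- The row at position `q` is `s`. -/
def ReadsRow (l : List Cell) (q : ℕ) {n d : ℕ} (s : PartialState (Fin n) (Fin d)) : Prop :=
  ∀ v : Fin n, ReadsEntry l ((next l)^[v] q) (s v)

theorem readsRow {l t : List Cell} {n d q : ℕ} {s : PartialState (Fin n) (Fin d)}
    (h : l.drop q = lift (encodePartialState s) ++ t) :
    RowOk l n d q ∧ ReadsRow l q s ∧
      nextRow l n q = q + (lift (encodePartialState s)).length := by
  rw [encodePartialState, lift_append, List.append_assoc] at h
  have key := drop_of_flatten (E := List.ofFn fun v => encodeValue (s v))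
    (q := fun v => (next l)^[v] q) h fun v hv t' ht' => by
      rw [List.getElem_ofFn] at ht' ⊢
      rw [Function.iterate_succ_apply']
      exact (readsEntry ht').2.2
  obtain ⟨h1, h2⟩ := key
  rw [List.length_ofFn] at h2
  have h3 : ∀ v : Fin n, EntryOk l d ((next l)^[v] q) ∧ ReadsEntry l ((next l)^[v] q) (s v) := by
    intro v
    obtain ⟨t', ht'⟩ := h1 v (by simp)
    rw [List.getElem_ofFn] at ht'
    exact ⟨(readsEntry ht').1, (readsEntry ht').2.1⟩
  have h4 := drop_add h
  refine ⟨⟨fun v hv => (h3 ⟨v, hv⟩).1, ?_⟩, fun v => (h3 v).2, ?_⟩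
  · rw [h2]
    exact at_of_drop h4
  · rw [nextRow, h2, encodePartialState, lift_append, List.length_append]
    rfl

/-- The number of variables of the encoded instance. -/
def numVar (l : List Cell) : ℕ := strokesEnd l 0

/-- The size of the domain of the encoded instance. -/
def domSize (l : List Cell) : ℕ := strokesEnd l (numVar l + 1) - (numVar l + 1)

/-- The position of a row of the encoded instance. -/
def rowStart (l : List Cell) (r : ℕ) : ℕ :=
  (nextRow l (numVar l))^[r] (strokesEnd l (numVar l + 1) + 1)

/-- The position of an entry of the encoded instance. -/
def entryPos (l : List Cell) (r v : ℕ) : ℕ := (next l)^[v] (rowStart l r)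

/-- An entry of the encoded instance is undefined. -/
def Undef (l : List Cell) (r v : ℕ) : Prop := At l (entryPos l r v) Symbol.undef

/-- The value of an entry of the encoded instance. -/
def value (l : List Cell) (r v : ℕ) : ℕ := strokesEnd l (entryPos l r v) - entryPos l r v

/-- The encoded instance has an action with index `b`. -/
def IsAction (l : List Cell) (b : ℕ) : Prop :=
  ∃ s : Symbol, l[rowStart l (2 + 2 * b)]? = some (some (Sum.inl s))

instance (l : List Cell) (r v : ℕ) : Decidable (Undef l r v) :=
  inferInstanceAs (Decidable (At _ _ _))

/-- The input starts with an instance with `m` actions. -/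
structure WellFormed (l : List Cell) (m : ℕ) : Prop where
  numVar_end : At l (numVar l) Symbol.endRow
  domSize_end : At l (strokesEnd l (numVar l + 1)) Symbol.endRow
  rows : ∀ r < 2 + 2 * m, RowOk l (numVar l) (domSize l) (rowStart l r)
  init : ∀ v < numVar l, ¬Undef l 0 v
  sep : l[rowStart l (2 + 2 * m)]? = some none

/-- The input starts with the instance `P`. -/
structure Encodes (l : List Cell) {n d : ℕ} (P : Instance (Fin n) (Fin d)) : Prop where
  numVar_eq : numVar l = n
  init : ∀ v : Fin n, ¬Undef l 0 v ∧ value l 0 v = P.init v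
  goal : ∀ v : Fin n, (Undef l 1 v ↔ P.goal v = none) ∧ ∀ x, P.goal v = some x → value l 1 v = x
  isAction_iff : ∀ b, IsAction l b ↔ b < P.actions.length
  pre : ∀ (b : Fin P.actions.length) (v : Fin n),
    (Undef l (2 + 2 * b) v ↔ (P.actions.get b).pre v = none)
  eff : ∀ (b : Fin P.actions.length) (v : Fin n),
    (Undef l (3 + 2 * b) v ↔ (P.actions.get b).eff v = none) ∧
      ∀ x, (P.actions.get b).eff v = some x → value l (3 + 2 * b) v = x

theorem lift_none_inj {w w' : List Symbol} {t t' : List Cell}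
    (h : lift w ++ none :: t = lift w' ++ none :: t') : w = w' := by
  induction w generalizing w' with
  | nil =>
    cases w' with
    | nil => rfl
    | cons a w' => simp [lift] at h
  | cons a w ih =>
    cases w' with
    | nil => simp [lift] at h
    | cons b w' =>
      simp only [lift, List.map_cons, List.cons_append, List.cons.injEq, Option.some.injEq,
        Sum.inl.injEq] at h
      rw [h.1, ih h.2]

theorem rowStart_succ (l : List Cell) (r : ℕ) :
    rowStart l (r + 1) = nextRow l (numVar l) (rowStart l r) :=
  Function.iterate_succ_apply' _ _ _

theorem le_next (l : List Cell) (q : ℕ) : q ≤ next l q := by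
  unfold next
  have := (drop_strokesEnd l q).1
  split_ifs <;> omega

theorem le_nextRow (l : List Cell) (n q : ℕ) : q ≤ nextRow l n q := by
  have : ∀ n, q ≤ (next l)^[n] q := by
    intro n
    induction n with
    | zero => exact le_rfl
    | succ n ih => rw [Function.iterate_succ_apply']; exact ih.trans (le_next l _)
  exact (this n).trans (Nat.le_succ _)

theorem monotone_rowStart (l : List Cell) : Monotone (rowStart l) :=
  monotone_nat_of_le_succ fun r => by rw [rowStart_succ]; exact le_nextRow l _ _

/-- Soundness of the syntax check: the rows found one after the other are assembled into an
instance, and the pieces of `l` into its encoding. -/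
theorem WellFormed.exists_instance {l : List Cell} {m : ℕ} (h : WellFormed l m) :
    ∃ (n d : ℕ) (P : Instance (Fin n) (Fin d)) (t : List Cell),
      l = lift (encodeInstance P) ++ none :: t := by
  choose s hs using fun r : Fin (2 + 2 * m) => (h.rows r r.2).exists_partialState
  simp only [← rowStart_succ] at hs
  have hi : ∀ v, ∃ x, s ⟨0, by omega⟩ v = some x := by
    intro v
    have h1 := (readsRow (hs ⟨0, by omega⟩)).2.1 v
    exact Option.ne_none_iff_exists'.1 fun h2 => h.init v v.2 (h1.undef_iff.2 h2)
  choose x hx using hi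
  refine ⟨numVar l, domSize l, ⟨List.ofFn fun b : Fin m =>
    ⟨s ⟨2 + 2 * b, by omega⟩, s ⟨3 + 2 * b, by omega⟩⟩, x, s ⟨1, by omega⟩⟩,
    l.drop (rowStart l (2 + 2 * m) + 1), ?_⟩
  have e0 := (drop_strokesEnd l 0).2
  have e1 := at_iff_drop.1 h.numVar_end
  have e2 := (drop_strokesEnd l (numVar l + 1)).2
  have e3 := at_iff_drop.1 h.domSize_end
  have e4 := hs ⟨0, by omega⟩
  have e5 := hs ⟨1, by omega⟩
  have e6 := drop_flatten (l := l) (E := List.ofFn fun b : Fin m => encodeAction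
    (⟨s ⟨2 + 2 * b, by omega⟩, s ⟨3 + 2 * b, by omega⟩⟩ : Action (Fin (numVar l)) _))
    (q := fun b => rowStart l (2 + 2 * b)) fun b hb => by
      have hb' : b < m := by simpa using hb
      rw [List.getElem_ofFn, encodeAction, lift_append, List.append_assoc]
      have e7 := hs ⟨2 + 2 * b, by omega⟩
      have e8 := hs ⟨3 + 2 * b, by omega⟩
      simp only [show 2 + 2 * b + 1 = 3 + 2 * b by omega] at e7
      simp only [show 3 + 2 * b + 1 = 2 + 2 * (b + 1) by omega] at e8
      rw [e7, e8]
  have e9 : l.drop (rowStart l (2 + 2 * m)) = none :: l.drop (rowStart l (2 + 2 * m) + 1) := by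
    obtain ⟨hq, h'⟩ := List.getElem?_eq_some_iff.1 h.sep
    rw [List.drop_eq_getElem_cons hq, h']
  rw [List.length_ofFn, e9] at e6
  have e10 : s ⟨0, by omega⟩ = fun v => some (x v) := funext hx
  rw [e10] at e4
  simp only [encodeInstance, lift_append, List.append_assoc, List.map_ofFn, Function.comp_def]
  rw [List.drop_zero] at e0
  calc l = _ := e0
    _ = _ := congrArg _ (e1.trans (congrArg _ (e2.trans (congrArg _ (e3.trans
      (congrArg _ (e4.trans (congrArg _ (e5.trans (congrArg _ e6))))))))))

/-- Completeness of the syntax check and correctness of reading. Row `0` is the initial state, row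
`1` the goal, rows `2 + 2 * b` and `3 + 2 * b` belong to action `b`. By `ht` nothing behind the
separator looks like an action. -/
theorem encodes {l t : List Cell} {n d : ℕ} {P : Instance (Fin n) (Fin d)}
    (h : l = lift (encodeInstance P) ++ none :: t)
    (ht : ∀ s : Symbol, some (Sum.inl s) ∉ t) :
    Encodes l P ∧ WellFormed l P.actions.length := by
  have hl := h
  simp only [encodeInstance, lift_append, List.append_assoc] at h
  have e0 : l.drop 0 = _ := h
  have hn : numVar l = n := by
    have := strokesEnd_eq (s := Symbol.endRow) (w := []) (by decide) (x := n)
      (by rw [lift_append, List.append_assoc]; exact e0)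
    rw [Nat.zero_add] at this
    exact this
  have e1 := drop_add e0
  rw [length_lift, List.length_replicate, Nat.zero_add] at e1
  replace e1 := (congrArg (fun q => l.drop q) hn).trans e1
  have hrow : ∀ r, nextRow l n (rowStart l r) = rowStart l (r + 1) := fun r => by
    rw [rowStart_succ, hn]
  have a1 : At l (numVar l) Symbol.endRow := at_of_drop e1
  have e2 : l.drop (numVar l + 1) = _ := drop_add (a := lift [Symbol.endRow]) e1
  have hd : strokesEnd l (numVar l + 1) = numVar l + 1 + d :=
    strokesEnd_eq (s := Symbol.endRow) (w := []) (by decide) (x := d)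
      (by rw [lift_append, List.append_assoc]; exact e2)
  have hd' : domSize l = d := by rw [domSize, hd]; omega
  have e3 := drop_add e2
  rw [length_lift, List.length_replicate] at e3
  replace e3 := (congrArg (fun q => l.drop q) hd).trans e3
  have a2 : At l (strokesEnd l (numVar l + 1)) Symbol.endRow := at_of_drop e3
  have e4 : l.drop (rowStart l 0) = _ := drop_add (a := lift [Symbol.endRow]) e3
  obtain ⟨k0, r0, p0⟩ := readsRow e4
  rw [hrow] at p0
  have e5 := drop_add e4
  rw [← p0] at e5
  obtain ⟨k1, r1, p1⟩ := readsRow e5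
  rw [hrow] at p1
  have e6 := drop_add e5
  rw [← p1] at e6
  have key := drop_of_flatten (q := fun b => rowStart l (2 + 2 * b)) e6 fun b hb t' ht' => by
    rw [List.getElem_map, encodeAction, lift_append, List.append_assoc] at ht'
    have p2 := (readsRow ht').2.2
    rw [hrow] at p2
    have e7 := drop_add ht'
    rw [← p2] at e7
    have p3 := (readsRow e7).2.2
    rw [hrow] at p3
    rw [List.getElem_map, encodeAction, lift_append, List.length_append]
    show rowStart l (2 + 2 * b + 1 + 1) = _
    rw [p3, p2, Nat.add_assoc]
  obtain ⟨hact, hend⟩ := key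
  rw [List.length_map] at hend
  have e8 := drop_add e6
  rw [← hend] at e8
  have hrows : ∀ b : Fin P.actions.length,
      (RowOk l n d (rowStart l (2 + 2 * b)) ∧
        ReadsRow l (rowStart l (2 + 2 * b)) (P.actions.get b).pre) ∧
      (RowOk l n d (rowStart l (3 + 2 * b)) ∧
        ReadsRow l (rowStart l (3 + 2 * b)) (P.actions.get b).eff) := by
    intro b
    obtain ⟨t', ht'⟩ := hact b (by simp)
    rw [List.getElem_map, encodeAction, lift_append, List.append_assoc] at ht'
    obtain ⟨k2, r2, p2⟩ := readsRow ht'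
    rw [hrow, show 2 + 2 * b.1 + 1 = 3 + 2 * b.1 by omega] at p2
    have e7 := drop_add ht'
    rw [← p2] at e7
    obtain ⟨k3, r3, p3⟩ := readsRow e7
    exact ⟨⟨k2, r2⟩, k3, r3⟩
  have hi : ∀ v : Fin n, ¬Undef l 0 v ∧ value l 0 v = P.init v := by
    intro v
    have := r0 v
    exact ⟨fun hu => by simpa using this.undef_iff.1 hu, this.value_eq _ rfl⟩
  have hsep : l[rowStart l (2 + 2 * P.actions.length)]? = some none := by
    rw [← List.head?_drop, e8]
    rfl
  refine ⟨⟨hn, hi, fun v => ⟨(r1 v).undef_iff, (r1 v).value_eq⟩, fun b => ⟨?_, fun hb => ?_⟩,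
    fun b v => ((hrows b).1.2 v).undef_iff,
    fun b v => ⟨((hrows b).2.2 v).undef_iff, ((hrows b).2.2 v).value_eq⟩⟩,
    ⟨a1, a2, fun r hr => ?_, fun v hv => (hi ⟨v, hn ▸ hv⟩).1, hsep⟩⟩
  -- For `b` beyond the last action the row would start at the separator or behind it, where no
  -- instance symbol occurs.
  · rintro ⟨s, hs⟩
    by_contra hb
    have hle : rowStart l (2 + 2 * P.actions.length) ≤ rowStart l (2 + 2 * b) :=
      monotone_rowStart l (by omega)
    have hw : rowStart l (2 + 2 * P.actions.length) = (encodeInstance P).length := by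
      have h1 := congrArg List.length e8
      have h2 := congrArg List.length hl
      have h3 := (List.getElem?_eq_some_iff.1 hsep).1
      simp only [List.length_drop, List.length_append, length_lift, List.length_cons] at h1 h2
      omega
    rw [hw] at hle
    have hs' : (lift (encodeInstance P) ++ none :: t)[rowStart l (2 + 2 * b)]? =
        some (some (Sum.inl s)) := hl ▸ hs
    rw [List.getElem?_append_right (by rw [length_lift]; exact hle)] at hs'
    have := List.mem_of_getElem? hs'
    simp [ht s] at this
  · obtain ⟨t', ht'⟩ := hact b (by simpa using hb)
    rw [List.getElem_map] at ht'
    obtain ⟨x, xs, hx⟩ := List.exists_cons_of_ne_nil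
      (show encodeAction P.actions[b] ≠ [] by simp [encodeAction, encodePartialState])
    rw [hx] at ht'
    exact ⟨x, at_of_drop ht'⟩
  · rw [hn, hd']
    match r, hr with
    | 0, _ => exact k0
    | 1, _ => exact k1
    | r + 2, hr =>
      rcases Nat.even_or_odd' r with ⟨b, rfl | rfl⟩
      · rw [Nat.add_comm]
        exact (hrows ⟨b, by omega⟩).1.1
      · rw [show 2 * b + 1 + 2 = 3 + 2 * b by omega]
        exact (hrows ⟨b, by omega⟩).2.1

end SASPlus

/-! ## Deciding the entries of the table of covers -/

namespace SASPlus

open StackProg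

/-! ### Reading the input in polynomial time. -/

section Reading

variable {α : Type} [Ctx α Cell]

/-- The input of the algorithm. -/
abbrev inp (a : α) : List Cell := Ctx.data a 0

theorem polyDec_at {f : α → ℕ} (hf : PolyComp f) (s : Symbol) :
    PolyDec fun a => At (inp a) (f a) s :=
  PolyDec.testAt hf 0 (by decide) fun o => o = some (some (Sum.inl s))

theorem polyComp_length : PolyComp fun a : α => (inp a).length :=
  PolyComp.length 0 (by decide)

theorem strokesEnd_le (l : List Cell) (q : ℕ) : strokesEnd l q ≤ q + l.length := by
  have := iterate_le_add (h := fun r => if At l r Symbol.one then r + 1 else r) (G := 1)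
    (fun q => by split_ifs <;> omega) l.length q
  rwa [Nat.mul_one] at this

theorem polyComp_strokesEnd {f : α → ℕ} (hf : PolyComp f) : PolyComp fun a => strokesEnd (inp a) (f a) :=
  polyComp_length.iterate_of_le_add hf
    (h := fun a r => if At (inp a) r Symbol.one then r + 1 else r)
    (PolyDec.ite (p := fun x : α × ℕ => At (inp x.1) x.2 Symbol.one)
      (polyDec_at PolyComp.var _) PolyComp.var.succ PolyComp.var)
    (PolyBdd.const _ 1) fun a q => by split_ifs <;> omega

theorem polyComp_next {f : α → ℕ} (hf : PolyComp f) : PolyComp fun a => next (inp a) (f a) :=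
  PolyDec.ite (polyDec_at hf _) (hf.add (PolyComp.const 2)) (polyComp_strokesEnd hf).succ

/-- An entry advances the position by at most `l.length + 2`, even on malformed input, so
`PolyComp.iterate_of_le_add` applies. -/
theorem polyComp_iterate_next {n f : α → ℕ} (hn : PolyComp n) (hf : PolyComp f) :
    PolyComp fun a => (next (inp a))^[n a] (f a) :=
  hn.iterate_of_le_add hf (h := fun a => next (inp a)) (G := fun a => (inp a).length + 2)
    (polyComp_next (α := α × ℕ) PolyComp.var)
    (polyComp_length.polyBdd.add (PolyBdd.const _ 2)) fun a q => by
      have := strokesEnd_le (inp a) q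
      unfold next
      split_ifs <;> omega

theorem polyComp_numVar : PolyComp fun a : α => numVar (inp a) := polyComp_strokesEnd (PolyComp.const 0)

theorem polyComp_domSize : PolyComp fun a : α => domSize (inp a) :=
  (polyComp_strokesEnd polyComp_numVar.succ).sub polyComp_numVar.succ

theorem polyComp_rowStart {f : α → ℕ} (hf : PolyComp f) :
    PolyComp fun a => rowStart (inp a) (f a) :=
  hf.iterate_of_le_add (polyComp_strokesEnd polyComp_numVar.succ).succ
    (h := fun a => nextRow (inp a) (numVar (inp a)))
    (G := fun a => numVar (inp a) * ((inp a).length + 2) + 1)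
    (polyComp_iterate_next (α := α × ℕ) polyComp_numVar.weaken PolyComp.var).succ
    ((polyComp_numVar.polyBdd.mul (polyComp_length.polyBdd.add (PolyBdd.const _ 2))).add
      (PolyBdd.const _ 1)) fun a q => by
      have := iterate_le_add (h := next (inp a)) (G := (inp a).length + 2) (fun q => by
        have := strokesEnd_le (inp a) q
        unfold next
        split_ifs <;> omega) (numVar (inp a)) q
      unfold nextRow
      omega

theorem polyComp_entryPos {f g : α → ℕ} (hf : PolyComp f) (hg : PolyComp g) :
    PolyComp fun a => entryPos (inp a) (f a) (g a) :=
  polyComp_iterate_next hg (polyComp_rowStart hf)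

theorem polyDec_undef {f g : α → ℕ} (hf : PolyComp f) (hg : PolyComp g) :
    PolyDec fun a => Undef (inp a) (f a) (g a) :=
  polyDec_at (polyComp_entryPos hf hg) _

theorem polyComp_value {f g : α → ℕ} (hf : PolyComp f) (hg : PolyComp g) :
    PolyComp fun a => value (inp a) (f a) (g a) :=
  (polyComp_strokesEnd (polyComp_entryPos hf hg)).sub (polyComp_entryPos hf hg)

theorem polyDec_isAction {f : α → ℕ} (hf : PolyComp f) :
    PolyDec fun a => IsAction (inp a) (f a) :=
  PolyDec.testAt (polyComp_rowStart ((PolyComp.const 2).add ((PolyComp.const 2).mul hf))) 0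
    (by decide) fun o => ∃ s : Symbol, o = some (some (Sum.inl s))

theorem polyDec_entryOk {f g : α → ℕ} (hf : PolyComp f) (hg : PolyComp g) :
    PolyDec fun a => EntryOk (inp a) (f a) (g a) :=
  ((polyDec_at hg _).and (polyDec_at hg.succ _)).or ((polyDec_at hg _).not.and
    ((polyDec_at (polyComp_strokesEnd hg) _).and (PolyDec.lt ((polyComp_strokesEnd hg).sub hg) hf)))

theorem polyDec_rowOk {n f g : α → ℕ} (hn : PolyComp n) (hf : PolyComp f) (hg : PolyComp g) :
    PolyDec fun a => RowOk (inp a) (n a) (f a) (g a) :=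
  (PolyDec.all (p := fun a v => EntryOk (inp a) (f a) ((next (inp a))^[v] (g a))) hn
    (polyDec_entryOk (α := α × ℕ) hf.weaken
      (polyComp_iterate_next (α := α × ℕ) PolyComp.var hg.weaken))).and
    (polyDec_at (polyComp_iterate_next hn hg) _)

theorem polyDec_wellFormed {f : α → ℕ} (hf : PolyComp f) :
    PolyDec fun a => WellFormed (inp a) (f a) := by
  have h2 : PolyComp fun a => 2 + 2 * f a := (PolyComp.const 2).add ((PolyComp.const 2).mul hf)
  refine ((polyDec_at polyComp_numVar _).and
    ((polyDec_at (polyComp_strokesEnd polyComp_numVar.succ) _).and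
    ((PolyDec.all (p := fun a r => RowOk (inp a) (numVar (inp a)) (domSize (inp a))
      (rowStart (inp a) r)) h2 (polyDec_rowOk (α := α × ℕ) polyComp_numVar polyComp_domSize
        (polyComp_rowStart PolyComp.var))).and
    ((PolyDec.all (p := fun a v => ¬Undef (inp a) 0 v) polyComp_numVar
      (polyDec_undef (α := α × ℕ) (PolyComp.const 0) PolyComp.var).not).and
    (PolyDec.testAt (polyComp_rowStart h2) 0 (by decide) fun o => o = some none))))).congr
    fun a => ⟨fun h => ⟨h.1, h.2, h.3, h.4, h.5⟩, fun h => ⟨h.1, h.2.1, h.2.2.1, h.2.2.2.1,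
      h.2.2.2.2⟩⟩

end Reading

/-- The initial value of the variable `v` contradicts the goal. -/
def WrongAt (l : List Cell) (v : ℕ) : Prop := ¬Undef l 1 v ∧ value l 0 v ≠ value l 1 v

instance (l : List Cell) (v : ℕ) : Decidable (WrongAt l v) :=
  inferInstanceAs (Decidable (_ ∧ _))

/-- The number of variables before `v` whose initial values contradict the goal. -/
def rank (l : List Cell) (v : ℕ) : ℕ := ∑ u ∈ Finset.range v, if WrongAt l u then 1 else 0

/-- The action with number `x` (where `0` stands for no action) writes the variable `v`. -/
def WritesAt (l : List Cell) (x v : ℕ) : Prop := x ≠ 0 ∧ ¬Undef l (3 + 2 * (x - 1)) v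

/-- The effect of the action with index `b` on the variable `v` contradicts the goal. -/
def BadAt (l : List Cell) (b v : ℕ) : Prop :=
  ¬Undef l (3 + 2 * b) v ∧ ¬Undef l 1 v ∧ value l (3 + 2 * b) v ≠ value l 1 v

/-- All bad effects of the action with index `b` are written by that with number `x`. -/
def RepairedAt (l : List Cell) (b x : ℕ) : Prop := ∀ v < numVar l, BadAt l b v → WritesAt l x v

/-- The set coded by `S` is contained in the union of those coded by `S₁`, `S₂` and of the
variables written by the action with number `x`. -/
def SplitAt (l : List Cell) (x S S₁ S₂ : ℕ) : Prop :=
  ∀ v < numVar l, WrongAt l v → S.testBit (rank l v) = true → WritesAt l x v ∨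
    S₁.testBit (rank l v) = true ∨ S₂.testBit (rank l v) = true

/-- The place of an entry in the table of covers. -/
def place (N K c x S : ℕ) : ℕ := (c * N + x) * K + S

/-- The entry `j` of a table `t` of length `i`. -/
def EntryAt (t : List Cell) (i j : ℕ) : Prop := t[i - 1 - j]? = some (some (Sum.inr true))

/-- An action can be used for an entry of the table. -/
def StepAt (l t : List Cell) (K i c x S : ℕ) : Prop :=
  ∃ b < l.length, (IsAction l b ∧ RepairedAt l b x) ∧ ∃ c₁ < c, ∃ c₂ < c, c₁ + c₂ < c ∧
    ∃ S₁ < K, ∃ S₂ < K, SplitAt l x S S₁ S₂ ∧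
      EntryAt t i (place (l.length + 1) K c₁ (b + 1) S₁) ∧
      EntryAt t i (place (l.length + 1) K c₂ x S₂)

/-- The value of the entry `i` of the table. -/
def NewEntry (l t : List Cell) (k K i : ℕ) : Prop :=
  ∃ c < k + 1, ∃ x < l.length + 1, ∃ S < K, i = place (l.length + 1) K c x S ∧
    (SplitAt l x S 0 0 ∨ StepAt l t K i c x S)

/-- The final answer of the algorithm. -/
def Answer (l t : List Cell) (k K : ℕ) : Prop :=
  0 < k ∧ (∃ m < l.length, WellFormed l m) ∧
    (∀ b < l.length, IsAction l b → (∀ v < numVar l, Undef l (2 + 2 * b) v) ∧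
      (∑ v ∈ Finset.range (numVar l), if Undef l (3 + 2 * b) v then 0 else 1) ≤ 2) ∧
    rank l (numVar l) ≤ 2 * k ∧
    EntryAt t (place (l.length + 1) K (k + 1) 0 0) (place (l.length + 1) K k 0 (K - 1))

/-! ### Polynomial-time decidability of the recursion and of the answer. -/

section

variable {α : Type} [Ctx α Cell] {f g h i j k : α → ℕ}

/-- The table of the algorithm. -/
abbrev tbl (a : α) : List Cell := Ctx.data a 1

theorem polyDec_wrongAt (hf : PolyComp f) : PolyDec fun a => WrongAt (inp a) (f a) :=
  (polyDec_undef (PolyComp.const 1) hf).not.and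
    (PolyDec.eq (polyComp_value (PolyComp.const 0) hf) (polyComp_value (PolyComp.const 1) hf)).not

theorem polyComp_rank (hf : PolyComp f) : PolyComp fun a => rank (inp a) (f a) :=
  PolyDec.count (p := fun a u => WrongAt (inp a) u) hf
    (polyDec_wrongAt (α := α × ℕ) PolyComp.var)

theorem polyComp_effRow (hf : PolyComp f) : PolyComp fun a => 3 + 2 * f a :=
  (PolyComp.const 3).add ((PolyComp.const 2).mul hf)

theorem polyDec_writesAt (hf : PolyComp f) (hg : PolyComp g) :
    PolyDec fun a => WritesAt (inp a) (f a) (g a) :=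
  (PolyDec.eq_zero hf).not.and (polyDec_undef (polyComp_effRow hf.pred) hg).not

theorem polyDec_badAt (hf : PolyComp f) (hg : PolyComp g) :
    PolyDec fun a => BadAt (inp a) (f a) (g a) :=
  (polyDec_undef (polyComp_effRow hf) hg).not.and ((polyDec_undef (PolyComp.const 1) hg).not.and
    (PolyDec.eq (polyComp_value (polyComp_effRow hf) hg)
      (polyComp_value (PolyComp.const 1) hg)).not)

theorem polyDec_repairedAt (hf : PolyComp f) (hg : PolyComp g) :
    PolyDec fun a => RepairedAt (inp a) (f a) (g a) :=
  PolyDec.all (p := fun a v => BadAt (inp a) (f a) v → WritesAt (inp a) (g a) v)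
    polyComp_numVar ((polyDec_badAt (α := α × ℕ) hf.weaken PolyComp.var).imp
      (polyDec_writesAt (α := α × ℕ) hg.weaken PolyComp.var))

theorem polyDec_splitAt (hf : PolyComp f) (hg : PolyComp g) (hh : PolyComp h) (hi : PolyComp i) :
    PolyDec fun a => SplitAt (inp a) (f a) (g a) (h a) (i a) :=
  have hr := polyComp_rank (α := α × ℕ) PolyComp.var
  PolyDec.all (p := fun a v => WrongAt (inp a) v → (g a).testBit (rank (inp a) v) = true →
    WritesAt (inp a) (f a) v ∨ (h a).testBit (rank (inp a) v) = true ∨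
      (i a).testBit (rank (inp a) v) = true) polyComp_numVar
    ((polyDec_wrongAt (α := α × ℕ) PolyComp.var).imp ((PolyDec.testBit hg.weaken hr).imp
      ((polyDec_writesAt (α := α × ℕ) hf.weaken PolyComp.var).or
        ((PolyDec.testBit hh.weaken hr).or (PolyDec.testBit hi.weaken hr)))))

theorem polyComp_place (hf : PolyComp f) (hg : PolyComp g) (hh : PolyComp h) (hi : PolyComp i)
    (hj : PolyComp j) : PolyComp fun a => place (f a) (g a) (h a) (i a) (j a) :=
  (((hh.mul hf).add hi).mul hg).add hj

theorem polyDec_entryAt (hf : PolyComp f) (hg : PolyComp g) :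
    PolyDec fun a => EntryAt (tbl a) (f a) (g a) :=
  PolyDec.testAt (hf.pred.sub hg) 1 (by decide) fun o => o = some (some (Sum.inr true))

theorem polyDec_stepAt (hf : PolyComp f) (hg : PolyComp g) (hh : PolyComp h) (hi : PolyComp i)
    (hj : PolyComp j) :
    PolyDec fun a => StepAt (inp a) (tbl a) (f a) (g a) (h a) (i a) (j a) := by
  have hN := fun (β : Type) [Ctx β Cell] => (polyComp_length (α := β)).succ
  refine PolyDec.ex polyComp_length (PolyDec.and (α := α × ℕ)
    ((polyDec_isAction PolyComp.var).and (polyDec_repairedAt PolyComp.var hi.weaken))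
    (PolyDec.ex hh.weaken (PolyDec.ex hh.weaken.weaken (PolyDec.and
      (PolyDec.lt (PolyComp.var.weaken.add PolyComp.var) hh.weaken.weaken.weaken)
      (PolyDec.ex hf.weaken.weaken.weaken (PolyDec.ex hf.weaken.weaken.weaken.weaken
        ?_))))))
  -- The bound variables are, from the oldest, `b`, `c₁`, `c₂`, `S₁`, `S₂`; each `weaken` passes one
  -- variable introduced later.
  exact PolyDec.and (α := ((((α × ℕ) × ℕ) × ℕ) × ℕ) × ℕ)
    (polyDec_splitAt hi.weaken.weaken.weaken.weaken.weaken
      hj.weaken.weaken.weaken.weaken.weaken PolyComp.var.weaken PolyComp.var)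
    ((polyDec_entryAt hg.weaken.weaken.weaken.weaken.weaken (polyComp_place (hN _)
      hf.weaken.weaken.weaken.weaken.weaken PolyComp.var.weaken.weaken.weaken
      PolyComp.var.weaken.weaken.weaken.weaken.succ PolyComp.var.weaken)).and
    (polyDec_entryAt hg.weaken.weaken.weaken.weaken.weaken (polyComp_place (hN _)
      hf.weaken.weaken.weaken.weaken.weaken PolyComp.var.weaken.weaken
      hi.weaken.weaken.weaken.weaken.weaken PolyComp.var)))

theorem polyDec_newEntry (hf : PolyComp f) (hg : PolyComp g) (hh : PolyComp h) :
    PolyDec fun a => NewEntry (inp a) (tbl a) (f a) (g a) (h a) := by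
  have hN := fun (β : Type) [Ctx β Cell] => (polyComp_length (α := β)).succ
  refine PolyDec.ex hf.succ (PolyDec.ex (hN _) (PolyDec.ex hg.weaken.weaken ?_))
  exact PolyDec.and (α := ((α × ℕ) × ℕ) × ℕ)
    (PolyDec.eq hh.weaken.weaken.weaken (polyComp_place (hN _) hg.weaken.weaken.weaken
      PolyComp.var.weaken.weaken PolyComp.var.weaken PolyComp.var))
    ((polyDec_splitAt PolyComp.var.weaken PolyComp.var (PolyComp.const 0) (PolyComp.const 0)).or
      (polyDec_stepAt hg.weaken.weaken.weaken hh.weaken.weaken.weaken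
        PolyComp.var.weaken.weaken PolyComp.var.weaken PolyComp.var))

theorem polyDec_answer (hf : PolyComp f) (hg : PolyComp g) :
    PolyDec fun a => Answer (inp a) (tbl a) (f a) (g a) := by
  have hN : PolyComp fun a : α => (inp a).length + 1 := polyComp_length.succ
  refine (PolyDec.lt (PolyComp.const 0) hf).and ((PolyDec.ex polyComp_length
    (polyDec_wellFormed (α := α × ℕ) PolyComp.var)).and (PolyDec.and (PolyDec.all polyComp_length
    (PolyDec.imp (α := α × ℕ) (polyDec_isAction PolyComp.var) (PolyDec.and
      (PolyDec.all polyComp_numVar (polyDec_undef (α := (α × ℕ) × ℕ) ((PolyComp.const 2).add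
        ((PolyComp.const 2).mul PolyComp.var.weaken)) PolyComp.var))
      (PolyDec.le (PolyComp.sum polyComp_numVar (PolyDec.ite
        (polyDec_undef (α := (α × ℕ) × ℕ) (polyComp_effRow PolyComp.var.weaken) PolyComp.var)
        (PolyComp.const 0) (PolyComp.const 1))) (PolyComp.const 2))))) (PolyDec.and
    (PolyDec.le (polyComp_rank polyComp_numVar) ((PolyComp.const 2).mul hf))
    (polyDec_entryAt (polyComp_place hN hg hf.succ (PolyComp.const 0) (PolyComp.const 0))
      (polyComp_place hN hg hf (PolyComp.const 0) hg.pred)))))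

end

end SASPlus

/-! ## The table of covers -/

namespace SASPlus

open Classical in
/-- The table after `i` steps, the last entry first. -/
noncomputable def table (l : List Cell) (k K : ℕ) : ℕ → List Cell
  | 0 => []
  | i + 1 => some (Sum.inr (decide (NewEntry l (table l k K i) k K i))) :: table l k K i

/-- New entries go on top, so an entry keeps its index counted from the bottom. -/
theorem entryAt_table {l : List Cell} {k K i j : ℕ} (h : j < i) :
    EntryAt (table l k K i) i j ↔ NewEntry l (table l k K j) k K j := by
  induction i with
  | zero => omega
  | succ i ih =>
    unfold EntryAt at ih ⊢
    rcases Nat.eq_or_lt_of_le (Nat.le_of_lt_succ h) with rfl | h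
    · simp [table]
    · rw [← ih h, show i + 1 - 1 - j = (i - 1 - j) + 1 by omega, table, List.getElem?_cons_succ]

/-- The budget is the leading digit: all entries with a smaller budget are in the table before they
are needed. -/
theorem place_lt {N K c c' x x' S S' : ℕ} (hc : c' < c) (hx : x' < N) (hS : S' < K) :
    place N K c' x' S' < place N K c x S := by
  unfold place
  have h1 : c' * N + x' + 1 ≤ c * N + x := by
    have := Nat.mul_le_mul_right N (Nat.succ_le_of_lt hc)
    rw [Nat.succ_mul] at this
    omega
  have h2 := Nat.mul_le_mul_right K h1
  rw [Nat.succ_mul] at h2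
  omega

theorem place_inj {N K c c' x x' S S' : ℕ} (hx : x < N) (hx' : x' < N) (hS : S < K) (hS' : S' < K)
    (h : place N K c x S = place N K c' x' S') : c = c' ∧ x = x' ∧ S = S' := by
  have key : ∀ {B a a' b b' : ℕ}, b < B → b' < B → a * B + b = a' * B + b' → a = a' ∧ b = b' := by
    intro B a a' b b' hb hb' h
    have h1 : (a * B + b) / B = a := by
      rw [Nat.mul_comm, Nat.mul_add_div (by omega), Nat.div_eq_of_lt hb, Nat.add_zero]
    have h2 : (a' * B + b') / B = a' := by
      rw [Nat.mul_comm, Nat.mul_add_div (by omega), Nat.div_eq_of_lt hb', Nat.add_zero]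
    have h3 : a = a' := by rw [← h1, h, h2]
    subst h3
    exact ⟨rfl, by omega⟩
  obtain ⟨h1, h2⟩ := key hS hS' h
  obtain ⟨h3, h4⟩ := key hx hx' h1
  exact ⟨h3, h4, h2⟩

theorem exists_testBit (N : ℕ) (Q : ℕ → Prop) :
    ∃ m < 2 ^ N, ∀ j < N, (m.testBit j = true ↔ Q j) := by
  classical
  refine ⟨Nat.ofBits fun i : Fin N => decide (Q i), Nat.ofBits_lt_two_pow _, fun j hj => ?_⟩
  rw [Nat.testBit_ofBits_lt _ _ hj]
  simp

/-- The number of an action or of no action. -/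
def number {m : ℕ} : Option (Fin m) → ℕ
  | none => 0
  | some b => b + 1

/-- The rank numbers the wrong variables consecutively and so assigns to each its own bit. -/
theorem rank_lt {l : List Cell} {u v : ℕ} (hu : WrongAt l u) (huv : u < v) :
    rank l u < rank l v := by
  have h1 : rank l (u + 1) = rank l u + 1 := by
    unfold rank
    rw [Finset.sum_range_succ, if_pos hu]
  have h2 : rank l (u + 1) ≤ rank l v :=
    Finset.sum_le_sum_of_subset (Finset.range_subset_range.2 huv)
  omega

theorem rank_inj {l : List Cell} {u v : ℕ} (hu : WrongAt l u) (hv : WrongAt l v)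
    (h : rank l u = rank l v) : u = v := by
  rcases lt_trichotomy u v with h' | h' | h'
  · exact absurd h (rank_lt hu h').ne
  · exact h'
  · exact absurd h (rank_lt hv h').ne'

/-! ### Correctness of the table and of the answer. -/

section Table

variable {l : List Cell} {n d : ℕ} {P : Instance (Fin n) (Fin d)}

/-- The variables written by the actions of an instance. -/
abbrev Instance.wr (P : Instance (Fin n) (Fin d)) (i : Fin P.actions.length) : Set (Fin n) :=
  {v | ((P.actions.get i).eff v).isSome}

/-- The bad effects of the actions of an instance. -/
abbrev Instance.bad (P : Instance (Fin n) (Fin d)) (i : Fin P.actions.length) : Set (Fin n) :=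
  {v | (P.actions.get i).Bad P.goal v}

/-- The set of variables coded by a number. -/
def coded (l : List Cell) (P : Instance (Fin n) (Fin d)) (S : ℕ) : Set (Fin n) :=
  {v | P.Wrong v ∧ S.testBit (rank l v) = true}

theorem Encodes.wrongAt_iff (h : Encodes l P) (v : Fin n) : WrongAt l v ↔ P.Wrong v := by
  unfold WrongAt Instance.Wrong
  rw [(h.goal v).1, (h.init v).2]
  cases hg : P.goal v with
  | none => simp
  | some y => simp [(h.goal v).2 y hg, Fin.val_inj, eq_comm (a := y)]

theorem Encodes.writesAt_iff (h : Encodes l P) (x : Option (Fin P.actions.length)) (v : Fin n) :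
    WritesAt l (number x) v ↔ v ∈ writes P.wr x := by
  unfold WritesAt
  cases x with
  | none => simp [number, writes]
  | some b =>
    simp only [number, Nat.add_sub_cancel, (h.eff b v).1, writes]
    simp [Option.isSome_iff_ne_none]

theorem Encodes.badAt_iff (h : Encodes l P) (b : Fin P.actions.length) (v : Fin n) :
    BadAt l b v ↔ v ∈ P.bad b := by
  unfold BadAt
  rw [(h.goal v).1, (h.eff b v).1]
  show _ ↔ (P.actions.get b).Bad P.goal v
  unfold Action.Bad
  cases hg : P.goal v with
  | none => simp
  | some y =>
    cases he : (P.actions.get b).eff v with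
    | none => simp
    | some x => simp [(h.goal v).2 y hg, (h.eff b v).2 x he, Fin.val_inj]

theorem Encodes.repairedAt_iff (h : Encodes l P) (b : Fin P.actions.length)
    (x : Option (Fin P.actions.length)) :
    RepairedAt l b (number x) ↔ P.bad b ⊆ writes P.wr x := by
  unfold RepairedAt
  rw [h.numVar_eq]
  constructor
  · intro hr v hv
    exact (h.writesAt_iff x v).1 (hr v v.2 ((h.badAt_iff b v).2 hv))
  · intro hr v hv hb
    exact (h.writesAt_iff x ⟨v, hv⟩).2 (hr ((h.badAt_iff b ⟨v, hv⟩).1 hb))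

theorem Encodes.splitAt_iff (h : Encodes l P) (x : Option (Fin P.actions.length)) (S S₁ S₂ : ℕ) :
    SplitAt l (number x) S S₁ S₂ ↔
      coded l P S ⊆ writes P.wr x ∪ coded l P S₁ ∪ coded l P S₂ := by
  unfold SplitAt coded
  rw [h.numVar_eq]
  constructor
  · rintro hs v ⟨hw, hb⟩
    have := hs v v.2 ((h.wrongAt_iff v).2 hw) hb
    rw [h.writesAt_iff x v] at this
    simp only [Set.mem_union, Set.mem_ofPred_eq, hw, true_and]
    tauto
  · intro hs v hv hw hb
    have hw' := (h.wrongAt_iff ⟨v, hv⟩).1 hw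
    have := @hs ⟨v, hv⟩ ⟨hw', hb⟩
    simp only [Set.mem_union, Set.mem_ofPred_eq, hw', true_and] at this
    rw [← h.writesAt_iff x ⟨v, hv⟩] at this
    tauto

/-- At most `2 * k` wrong variables need at most `2 * k` bits, hence codes below `4 ^ k`. -/
theorem Encodes.exists_coded (h : Encodes l P) {k : ℕ} (hk : rank l n ≤ 2 * k)
    (S : Set (Fin n)) :
    ∃ m < 4 ^ k, coded l P m = S ∩ {v | P.Wrong v} := by
  obtain ⟨m, hm, hbit⟩ := exists_testBit (2 * k)
    fun j => ∃ v : Fin n, v ∈ S ∧ P.Wrong v ∧ rank l v = j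
  refine ⟨m, by rwa [pow_mul] at hm, ?_⟩
  ext v
  simp only [coded, Set.mem_ofPred_eq, Set.mem_inter_iff]
  rw [and_comm]
  refine and_congr_left fun hw => ?_
  have hw' := (h.wrongAt_iff v).2 hw
  rw [hbit _ ((rank_lt hw' v.2).trans_le hk)]
  constructor
  · rintro ⟨u, hu, huw, huv⟩
    have := rank_inj ((h.wrongAt_iff u).2 huw) hw' huv
    rwa [← Fin.ext this]
  · intro hv
    exact ⟨v, hv, hw, rfl⟩

/-- The two constructors of `Covers` are the two alternatives of `NewEntry`, and recursive calls
have smaller budgets. The table also has rows for numbers `x` that belong to no action; no entry of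
a genuine root consults them. -/
theorem Encodes.newEntry_iff (h : Encodes l P) (hA : P.actions.length < l.length) {k : ℕ}
    (hk : rank l n ≤ 2 * k) (c : ℕ) (hc : c ≤ k) (x : Option (Fin P.actions.length)) (S : ℕ)
    (hS : S < 4 ^ k) :
    NewEntry l (table l k (4 ^ k) (place (l.length + 1) (4 ^ k) c (number x) S)) k (4 ^ k)
      (place (l.length + 1) (4 ^ k) c (number x) S) ↔
    Covers P.wr P.bad c x (coded l P S) := by
  have hnum : ∀ x : Option (Fin P.actions.length), number x < l.length + 1 := by
    intro x
    cases x with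
    | none => exact Nat.succ_pos _
    | some b => have := b.2; simp only [number]; omega
  induction c using Nat.strong_induction_on generalizing x S with
  | _ c ih =>
    have key : ∀ c₁ < c, ∀ (y : Option (Fin P.actions.length)) (S₁ : ℕ), S₁ < 4 ^ k →
        (EntryAt (table l k (4 ^ k) (place (l.length + 1) (4 ^ k) c (number x) S))
          (place (l.length + 1) (4 ^ k) c (number x) S)
          (place (l.length + 1) (4 ^ k) c₁ (number y) S₁) ↔
        Covers P.wr P.bad c₁ y (coded l P S₁)) := by
      intro c₁ hc₁ y S₁ hS₁
      rw [entryAt_table (place_lt hc₁ (hnum y) hS₁)]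
      exact ih c₁ hc₁ (by omega) y S₁ hS₁
    have h0 : coded l P 0 = ∅ := by ext; simp [coded]
    have hbase : SplitAt l (number x) S 0 0 ↔ coded l P S ⊆ writes P.wr x := by
      rw [h.splitAt_iff, h0, Set.union_empty, Set.union_empty]
    have hmain : NewEntry l (table l k (4 ^ k) (place (l.length + 1) (4 ^ k) c (number x) S)) k
        (4 ^ k) (place (l.length + 1) (4 ^ k) c (number x) S) ↔
        (SplitAt l (number x) S 0 0 ∨
          StepAt l (table l k (4 ^ k) (place (l.length + 1) (4 ^ k) c (number x) S)) (4 ^ k)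
            (place (l.length + 1) (4 ^ k) c (number x) S) c (number x) S) := by
      constructor
      · rintro ⟨c', _, x', hx', S', hS', he, hor⟩
        obtain ⟨rfl, rfl, rfl⟩ := place_inj (hnum x) hx' hS hS' he
        exact hor
      · intro hor
        exact ⟨c, by omega, number x, hnum x, S, hS, rfl, hor⟩
    rw [hmain, hbase]
    constructor
    · rintro (hb | ⟨b, hb, ⟨hact, hrep⟩, c₁, hc₁, c₂, hc₂, hsum, S₁, hS₁, S₂, hS₂, hsp, he₁, he₂⟩)
      · exact .base hb
      · have hb' := (h.isAction_iff b).1 hact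
        exact .step ((h.repairedAt_iff ⟨b, hb'⟩ x).1 hrep) hsum ((h.splitAt_iff x S S₁ S₂).1 hsp)
          ((key c₁ hc₁ (some ⟨b, hb'⟩) S₁ hS₁).1 he₁) ((key c₂ hc₂ x S₂ hS₂).1 he₂)
    · intro hcov
      cases hcov with
      | base hb => exact Or.inl hb
      | @step _ _ _ b c₁ c₂ T₁ T₂ hb hsum hsp he₁ he₂ =>
        -- `T₁` and `T₂` may contain variables that are not wrong and have no code. Cutting them
        -- down to wrong variables loses nothing, since `S` codes only such variables.
        obtain ⟨S₁, hS₁, hT₁⟩ := h.exists_coded hk T₁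
        obtain ⟨S₂, hS₂, hT₂⟩ := h.exists_coded hk T₂
        refine Or.inr ⟨b, by have := b.2; omega, ⟨(h.isAction_iff b).2 b.2,
          (h.repairedAt_iff b x).2 hb⟩, c₁, by omega, c₂, by omega, hsum, S₁, hS₁, S₂, hS₂,
          (h.splitAt_iff x S S₁ S₂).2 ?_,
          (key c₁ (by omega) (some b) S₁ hS₁).2 (he₁.mono le_rfl ?_),
          (key c₂ (by omega) x S₂ hS₂).2 (he₂.mono le_rfl ?_)⟩
        · rintro v hv
          have hw : P.Wrong v := hv.1
          have := hsp hv
          rw [hT₁, hT₂]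
          simp only [Set.mem_union, Set.mem_inter_iff, Set.mem_ofPred_eq, hw, and_true] at this ⊢
          exact this
        · rw [hT₁]; exact Set.inter_subset_left
        · rw [hT₂]; exact Set.inter_subset_left

theorem length_le_length_flatten {E : List (List Symbol)} (h : ∀ e ∈ E, e ≠ []) :
    E.length ≤ E.flatten.length := by
  induction E with
  | nil => simp
  | cons e E ih =>
    have h1 := ih fun e he => h e (List.mem_cons_of_mem _ he)
    have h2 := List.length_pos_iff.2 (h e List.mem_cons_self)
    rw [List.flatten_cons, List.length_append, List.length_cons]
    omega

/-- Codes of actions are nonempty, so searches over indices below the input length miss no action.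
-/
theorem length_actions_le (P : Instance (Fin n) (Fin d)) :
    P.actions.length ≤ (encodeInstance P).length := by
  have := length_le_length_flatten (E := P.actions.map encodeAction) fun e he => by
    obtain ⟨a, _, rfl⟩ := List.mem_map.1 he
    simp [encodeAction, encodePartialState]
  rw [List.length_map] at this
  unfold encodeInstance
  rw [List.length_append]
  omega

open Classical in
theorem Encodes.rank_eq (h : Encodes l P) :
    rank l n = (Finset.univ.filter fun v => P.Wrong v).card := by
  rw [rank, Finset.sum_range, Finset.card_filter]
  exact Finset.sum_congr rfl fun v _ => if_congr (h.wrongAt_iff v) rfl rfl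

theorem Encodes.sum_eq_numEff (h : Encodes l P) (b : Fin P.actions.length) :
    (∑ v ∈ Finset.range n, if Undef l (3 + 2 * b) v then 0 else 1) =
      (P.actions.get b).numEff := by
  rw [Action.numEff, Finset.sum_range, Finset.card_filter]
  refine Finset.sum_congr rfl fun v _ => ?_
  rw [if_congr (h.eff b v).1 rfl rfl]
  cases (P.actions.get b).eff v <;> simp

theorem Encodes.bounded_iff (h : Encodes l P) (hA : P.actions.length < l.length) :
    P.Bounded 0 2 ↔ ∀ b < l.length, IsAction l b →
      (∀ v < numVar l, Undef l (2 + 2 * b) v) ∧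
      (∑ v ∈ Finset.range (numVar l), if Undef l (3 + 2 * b) v then 0 else 1) ≤ 2 := by
  rw [h.numVar_eq]
  constructor
  · intro hP b _ hb
    have hb' := (h.isAction_iff b).1 hb
    have hB := hP _ (List.get_mem P.actions ⟨b, hb'⟩)
    exact ⟨fun v hv => (h.pre ⟨b, hb'⟩ ⟨v, hv⟩).2 (Action.pre_eq_none hB.1 _),
      (h.sum_eq_numEff ⟨b, hb'⟩).trans_le hB.2⟩
  · intro hP a ha
    obtain ⟨b, rfl⟩ := List.get_of_mem ha
    have hB := hP b (b.2.trans hA) ((h.isAction_iff b).2 b.2)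
    refine ⟨?_, (h.sum_eq_numEff b).symm.trans_le hB.2⟩
    refine (Finset.card_eq_zero.2 (Finset.filter_eq_empty_iff.2 fun v _ => ?_)).le
    have hv := (h.pre b v).1 (hB.1 v v.2)
    rw [hv]
    simp

/-- The number `4 ^ k - 1` has its lowest `2 * k` bits set. -/
theorem Encodes.coded_full (h : Encodes l P) {k : ℕ} (hk : rank l n ≤ 2 * k) :
    coded l P (4 ^ k - 1) = {v | P.Wrong v} := by
  ext v
  simp only [coded, Set.mem_ofPred_eq, and_iff_left_iff_imp]
  intro hw
  rw [show 4 = 2 ^ 2 by rfl, ← pow_mul, Nat.testBit_two_pow_sub_one]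
  exact decide_eq_true ((rank_lt ((h.wrongAt_iff v).2 hw) v.2).trans_le hk)

theorem answer_iff {w : List Symbol} {t : List Cell} (ht : ∀ s : Symbol, some (Sum.inl s) ∉ t)
    (k : ℕ) (hl : l = lift w ++ none :: t) :
    Answer l (table l k (4 ^ k) (place (l.length + 1) (4 ^ k) (k + 1) 0 0)) k (4 ^ k) ↔
      (w, k) ∈ boundedPlanning 0 2 := by
  have hpos : 0 < 4 ^ k := Nat.pow_pos (by norm_num)
  -- Stated for every instance encoded by `w`, as it serves both for the instance found by the
  -- syntax check and for the one given by membership.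
  have key : ∀ {n d : ℕ} {P : Instance (Fin n) (Fin d)}, encodeInstance P = w →
      ((∃ m < l.length, WellFormed l m) ∧ numVar l = n ∧ (P.Bounded 0 2 ↔
        ∀ b < l.length, IsAction l b → (∀ v < numVar l, Undef l (2 + 2 * b) v) ∧
          (∑ v ∈ Finset.range (numVar l), if Undef l (3 + 2 * b) v then 0 else 1) ≤ 2) ∧
        (P.Bounded 0 2 → ((∃ ω, P.IsPlan ω ∧ ω.length ≤ k) ↔ rank l n ≤ 2 * k ∧
          EntryAt (table l k (4 ^ k) (place (l.length + 1) (4 ^ k) (k + 1) 0 0))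
            (place (l.length + 1) (4 ^ k) (k + 1) 0 0)
            (place (l.length + 1) (4 ^ k) k 0 (4 ^ k - 1))))) := by
    intro n d P hP
    subst hP
    obtain ⟨h, hwf⟩ := encodes hl ht
    have hA : P.actions.length < l.length := by
      have h1 := length_actions_le P
      have h2 := congrArg List.length hl
      rw [List.length_append, length_lift, List.length_cons] at h2
      omega
    refine ⟨⟨_, hA, hwf⟩, h.numVar_eq, h.bounded_iff hA, fun hB => ?_⟩
    have hent : rank l n ≤ 2 * k →
        (EntryAt (table l k (4 ^ k) (place (l.length + 1) (4 ^ k) (k + 1) 0 0))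
            (place (l.length + 1) (4 ^ k) (k + 1) 0 0)
            (place (l.length + 1) (4 ^ k) k 0 (4 ^ k - 1)) ↔
          ∃ ω, P.IsPlan ω ∧ ω.length ≤ k) := by
      intro hk
      rw [entryAt_table (place_lt (Nat.lt_succ_self k) (Nat.succ_pos _) (by omega)),
        Instance.exists_plan_iff hB, ← h.coded_full hk]
      exact h.newEntry_iff hA hk k le_rfl none _ (by omega)
    constructor
    · intro hp
      have hk : rank l n ≤ 2 * k := h.rank_eq.trans_le (Instance.card_wrong_le hB hp)
      exact ⟨hk, (hent hk).2 hp⟩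
    · rintro ⟨hk, he⟩
      exact (hent hk).1 he
  constructor
  · rintro ⟨hk, ⟨m, _, hwf⟩, hB, hr, he⟩
    obtain ⟨n, d, P, t', ht'⟩ := hwf.exists_instance
    have hP := lift_none_inj (hl.symm.trans ht')
    obtain ⟨_, hn, hB', hplan⟩ := key hP.symm
    exact ⟨hk, n, d, P, hP.symm, hB'.2 hB, (hplan (hB'.2 hB)).2 ⟨hn ▸ hr, he⟩⟩
  · rintro ⟨hk, n, d, P, hP, hB, hplan⟩
    obtain ⟨hwf, hn, hB', hplan'⟩ := key hP
    obtain ⟨hr, he⟩ := (hplan' hB).1 hplan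
    exact ⟨hk, hwf, hB'.1 hB, by rwa [hn], he⟩

end Table

end SASPlus

/-! ## The parameter of an input -/

namespace SASPlus

open StackProg

/-- The number that arises from `r` by putting a symbol, if it is a binary digit, before its least
digit. -/
def paramStep (s : Cell) (r : ℕ) : ℕ :=
  match s with
  | some (Sum.inr b) => 2 * r + b.toNat
  | _ => r

/-- The number in binary that is found in an input. -/
def param (l : List Cell) : ℕ := l.foldr paramStep 0

/-- Makes every intermediate value of the conversion at most the final one, as `CompIn.loop`
requires. -/
theorem le_paramStep (s : Cell) (r : ℕ) : r ≤ paramStep s r := by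
  unfold paramStep
  split <;> omega

theorem param_digits (k : ℕ) :
    param ((Computability.encodeNat k).map fun b => some (Sum.inr b)) = k := by
  have pos : ∀ p : PosNum,
      param ((Computability.encodePosNum p).map fun b => some (Sum.inr b)) = p := by
    intro p
    induction p with
    | one => rfl
    | bit0 p ih =>
      show 2 * param _ + 0 = _
      rw [ih, PosNum.cast_bit0]
      omega
    | bit1 p ih =>
      show 2 * param _ + 1 = _
      rw [ih, PosNum.cast_bit1]
      omega
  have num : ∀ m : Num,
      param ((Computability.encodeNum m).map fun b => some (Sum.inr b)) = m := by
    intro m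
    cases m with
    | zero => rfl
    | pos p => exact pos p
  exact (num k).trans (Num.to_of_nat k)

theorem param_pairInput (w : List Symbol) (k : ℕ) : param (pairInput w k) = k := by
  unfold pairInput param
  rw [List.foldr_append, List.foldr_cons]
  have h := param_digits k
  unfold param at h
  rw [h]
  induction w with
  | nil => rfl
  | cons s w ih => exact ih

/-- The loop reads from the end of the input, so it meets the most significant digit first. -/
theorem param_drop (l : List Cell) (i : ℕ) (hi : i ≤ l.length) :
    (Nat.rec 0 (fun i r => if l[l.length - 1 - i]? = some (some (Sum.inr true)) then 2 * r + 1
      else if l[l.length - 1 - i]? = some (some (Sum.inr false)) then 2 * r else r) i : ℕ) =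
      param (l.drop (l.length - i)) := by
  induction i with
  | zero => simp [param]
  | succ i ih =>
    have h : l.length - (i + 1) < l.length := by omega
    rw [List.drop_eq_getElem_cons h, show l.length - (i + 1) + 1 = l.length - i by omega]
    have e : l[l.length - 1 - i]? = some l[l.length - (i + 1)] := by
      rw [show l.length - 1 - i = l.length - (i + 1) by omega, List.getElem?_eq_getElem]
    have step : param (l[l.length - (i + 1)] :: l.drop (l.length - i)) =
        paramStep l[l.length - (i + 1)] (param (l.drop (l.length - i))) := rfl
    rw [step, ← ih (by omega)]
    dsimp only
    rw [e]
    generalize l[l.length - (i + 1)] = s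
    match s with
    | none => simp [paramStep]
    | some (Sum.inl s) => simp [paramStep]
    | some (Sum.inr true) => simp [paramStep]
    | some (Sum.inr false) => simp [paramStep]

theorem param_drop_le (l : List Cell) (i : ℕ) : param (l.drop i) ≤ param l := by
  induction i generalizing l with
  | zero => exact le_rfl
  | succ i ih =>
    cases l with
    | nil => exact le_rfl
    | cons s l => exact (ih l).trans (le_paramStep s (param l))

/-- The parameter may be exponential in the input length, so its unary form is computed only in time
polynomial in the length and its value. -/
theorem compIn_param {α : Type} [Ctx α Cell] :
    CompIn (fun a : α => param (inp a)) fun a => param (inp a) := by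
  have hp : PolyComp fun x : (α × ℕ) × ℕ => (inp x).length - 1 - x.1.2 :=
    polyComp_length.pred.sub PolyComp.var.weaken
  have h := CompIn.loop (polyComp_length (α := α)) (PolyComp.const 0)
    (body := fun x => if (inp x.1.1)[(inp x.1.1).length - 1 - x.1.2]? =
        some (some (Sum.inr true)) then 2 * x.2 + 1
      else if (inp x.1.1)[(inp x.1.1).length - 1 - x.1.2]? = some (some (Sum.inr false))
        then 2 * x.2 else x.2)
    (PolyDec.ite (PolyDec.testAt hp 0 (by decide) fun o => o = some (some (Sum.inr true)))
      ((PolyComp.const 2).mul PolyComp.var).succ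
      (PolyDec.ite (PolyDec.testAt hp 0 (by decide) fun o => o = some (some (Sum.inr false)))
        ((PolyComp.const 2).mul PolyComp.var) PolyComp.var))
    (B := fun a => param (inp a))
    (fun a i hi => (param_drop (inp a) i hi).trans_le (param_drop_le _ _))
  have e : ∀ a : α, _ = param (inp a) := fun a =>
    (param_drop (inp a) (inp a).length le_rfl).trans (by rw [Nat.sub_self, List.drop_zero])
  rwa [funext e] at h

theorem compIn_pow {α A : Type} [Ctx α A] [Inhabited A] :
    CompIn (fun a : α × ℕ => 4 ^ a.2) fun a => 4 ^ a.2 := by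
  have key : ∀ i : ℕ, (Nat.rec 1 (fun _ r => 4 * r) i : ℕ) = 4 ^ i := by
    intro i
    induction i with
    | zero => rfl
    | succ i ih => rw [pow_succ, ← ih, Nat.mul_comm]
  have h := CompIn.loop (PolyComp.var (α := α)) (PolyComp.const 1)
    (body := fun x => 4 * x.2) ((PolyComp.const 4).mul PolyComp.var) (B := fun a => 4 ^ a.2)
    (fun a i hi => (key i).trans_le (Nat.pow_le_pow_right (by omega) hi))
  rwa [funext fun a : α × ℕ => key a.2] at h

end SASPlus

/-! ## From programs to Turing machines -/

namespace StackProg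

/-- Halting configurations of `Turing.FinTM2` have all stacks but the output empty and the internal
state reset, so this is demanded of the final memory. The extra control point `none` halts the
machine and costs the one additional step. -/
theorem exists_machine {A : Type} [Fintype A] [Inhabited A] (p : RProg A) :
    ∃ M : Turing.TM2ComputableAux A Bool, ∀ (l : List A) (b : Bool) (n m : ℕ),
      p.Exec (none, stk [] (Tapes.data ⟨l, []⟩) fun _ => 0)
        (none, stk [b] (fun _ => []) fun _ => 0) n → n + 1 ≤ m →
      Nonempty (Turing.TM2OutputsInTime M.tm (l.map M.inputAlphabet.symm)
        (some ((Computability.encodeBool b).map M.outputAlphabet.symm)) m) := by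
  classical
  set S : Finset Stk := p.usedStacks ∪ {Stk.data 0, Stk.out} with hS
  have hp : p.usedStacks ⊆ S := Finset.subset_union_left
  have h0 : Stk.data 0 ∈ S := by simp [hS]
  have h1 : Stk.out ∈ S := by simp [hS]
  set q := p.restrict S hp with hq
  let Λ := Option q.Lab
  let code : Λ → Turing.TM2.Stmt (fun k : {k // k ∈ S} => Alph A k.1) Λ (Option A) := fun l =>
    Option.rec Turing.TM2.Stmt.halt (fun l => q.code some none l) l
  let _ : Fintype Λ := Fintype.ofFinite _
  let tm : Turing.FinTM2 :=
    { K := {k // k ∈ S}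
      k₀ := ⟨Stk.data 0, h0⟩
      k₁ := ⟨Stk.out, h1⟩
      Γ := fun k => Alph A k.1
      Λ := Λ
      main := some q.entry
      σ := Option A
      initialState := none
      Γk₀Fin := inferInstanceAs (Fintype A)
      m := code }
  refine ⟨⟨tm, Equiv.refl A, Equiv.refl Bool⟩, fun l b n m h hm => ?_⟩
  have h2 := (h.restrict S hp).steps code some none fun _ => rfl
  have e1 : Turing.initList tm (l.map (Equiv.refl A).symm) =
      ⟨some (some q.entry), none,
        fun k => stk [] (Tapes.data ⟨l, []⟩) (fun _ => 0) k.1⟩ := by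
    unfold Turing.initList
    congr 1
    funext k
    obtain ⟨k, hk⟩ := k
    split_ifs with h
    · cases h
      exact List.map_id _
    · match k, hk, h with
      | Stk.out, _, _ => rfl
      | Stk.data 0, _, h => exact absurd rfl h
      | Stk.data 1, _, _ => rfl
      | Stk.data 2, _, _ => rfl
      | Stk.reg i, _, _ => rfl
  have e2 : Turing.haltList tm ((Computability.encodeBool b).map (Equiv.refl Bool).symm) =
      ⟨none, none, fun k => stk [b] (fun _ => []) (fun _ => 0) k.1⟩ := by
    unfold Turing.haltList
    congr 1
    funext k
    obtain ⟨k, hk⟩ := k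
    split_ifs with h
    · cases h
      rfl
    · match k, hk, h with
      | Stk.out, _, h => exact absurd rfl h
      | Stk.data i, _, _ => rfl
      | Stk.reg i, _, _ => rfl
  refine ⟨⟨⟨n + 1, ?_⟩, hm⟩⟩
  rw [Function.iterate_succ_apply']
  show (flip bind tm.step) ((flip bind tm.step)^[n] (some (Turing.initList tm
    (l.map (Equiv.refl A).symm)))) = some (Turing.haltList tm
      ((Computability.encodeBool b).map (Equiv.refl Bool).symm))
  rw [e1, e2]
  exact (congrArg (flip bind tm.step) h2).trans rfl

end StackProg

/-! ## The algorithm -/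

namespace StackProg

section

variable {A : Type} [Inhabited A]

/-- Remove all symbols from a data stack. -/
def wipe (b : Fin 3) : RProg A := (popData b).seq (Prog.whileDo Option.isSome (popData b))

theorem runs_wipe (b : Fin 3) (d : Fin 3 → List A) (ρ : ℕ → ℕ) :
    Runs (wipe b) (d, ρ) (Function.update d b [], ρ) ((d b).length * 2 + 2) := by
  have key : ∀ (l : List A) (v : Option A), ∃ v' n, n ≤ l.length * 2 + 2 ∧
      (wipe b).Exec (v, stk [] (Function.update d b l) ρ)
        (v', stk [] (Function.update d b []) ρ) n := by
    intro l
    induction l with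
    | nil =>
      intro v
      have e1 := exec_popData [] (Function.update d b []) ρ v b
      simp only [Function.update_self, List.head?_nil, List.tail_nil, Function.update_idem] at e1
      exact ⟨none, 2, le_rfl, e1.seq (Prog.Exec.while_false (c := Option.isSome) rfl)⟩
    | cons x l ih =>
      intro v
      have e1 := exec_popData [] (Function.update d b (x :: l)) ρ v b
      simp only [Function.update_self, List.head?_cons, List.tail_cons,
        Function.update_idem] at e1
      obtain ⟨v', n, hn, he⟩ := ih (some x)
      cases he with
      | @seq _ _ _ w _ a c hp hw =>
        have ha : a = 1 := by cases hp; rfl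
        refine ⟨v', _, ?_, e1.seq (Prog.Exec.while_true (c := Option.isSome) rfl hp hw)⟩
        rw [List.length_cons]
        omega
  intro v
  have := key (d b) v
  rwa [Function.update_eq_self] at this

/-- Push a fixed symbol to a data stack. -/
def pushSymbol (b : Fin 3) (x : A) : RProg A := Prog.push (Stk.data b) fun _ => x

theorem runs_pushSymbol (b : Fin 3) (x : A) (d : Fin 3 → List A) (ρ : ℕ → ℕ) :
    Runs (pushSymbol b x) (d, ρ) (Function.update d b (x :: d b), ρ) 1 := fun v =>
  ⟨v, 1, le_rfl, by
    rw [← update_stk_data]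
    exact Prog.Exec.push (Γ := Alph A) (Stk.data b) (fun _ => x) v _⟩

/-- Remove a symbol from a counter, write to the output stack whether there was one, and reset the
internal state. -/
def report (i : ℕ) : RProg A :=
  (probe i).seq ((Prog.push Stk.out fun v => v.isSome).seq (Prog.load fun _ => none))

theorem exec_report (i : ℕ) (d : Fin 3 → List A) (ρ : ℕ → ℕ) (v : Option A) (b : Bool)
    (hi : ρ i = b.toNat) :
    (report i).Exec (v, stk [] d ρ) (none, stk [b] d (Function.update ρ i 0)) 3 := by
  have key : ∀ (w : Option A) (τ : ℕ → ℕ), w.isSome = b → (Prog.seq (Prog.push Stk.out fun v =>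
      v.isSome) (Prog.load fun _ => none) : RProg A).Exec (w, stk [] d τ)
        (none, stk [b] d τ) 2 := by
    intro w τ hw
    have e1 := Prog.Exec.push (Γ := Alph A) Stk.out (fun v : Option A => v.isSome) w (stk [] d τ)
    have e2 := update_stk_out [] (w.isSome :: []) d τ
    rw [hw] at e2
    have e3 := Prog.Exec.load (Γ := Alph A) (fun _ : Option A => none) w (stk [b] d τ)
    refine Prog.Exec.seq (m := 1) (n := 1) ?_ e3
    rw [← e2, ← hw]
    exact e1
  cases b with
  | false =>
    have := exec_probe_zero [] d ρ v i hi
    rw [Function.update_eq_self_iff.2 hi.symm]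
    exact this.seq (key _ _ rfl)
  | true => exact (exec_probe_succ [] d ρ v i 0 hi).seq (key _ _ rfl)

end

end StackProg

namespace SASPlus

open StackProg

theorem length_table (l : List Cell) (k K i : ℕ) : (table l k K i).length = i := by
  induction i with
  | zero => rfl
  | succ i ih => rw [table, List.length_cons, ih]

theorem update_data (l t t' : List Cell) :
    Function.update (Tapes.data ⟨l, t⟩) 1 t' = Tapes.data ⟨l, t'⟩ := by
  funext i
  match i with
  | 0 => rfl
  | 1 => rfl
  | 2 => rfl

/-- The number of entries of the table of covers for an input. -/
def tableSize (l : List Cell) : ℕ :=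
  place (l.length + 1) (4 ^ param l) (param l + 1) 0 0

/-- A bound for the size of the table of covers for an input. -/
def scale (l : List Cell) : ℕ := l.length + 4 ^ param l

theorem param_le_scale (l : List Cell) : param l ≤ scale l :=
  ((Nat.lt_pow_self (by norm_num)).le).trans (Nat.le_add_left _ _)

theorem polyBdd_tableSize : PolyBdd scale tableSize := by
  have h1 : PolyBdd scale fun l => l.length + 1 :=
    (PolyBdd.of_le fun l => Nat.le_add_right _ _).add (PolyBdd.const _ 1)
  have h2 : PolyBdd scale fun l => param l + 1 :=
    (PolyBdd.of_le param_le_scale).add (PolyBdd.const _ 1)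
  exact (h2.mul h1).mul (PolyBdd.of_le fun l => Nat.le_add_left _ _)

/-- The parameter and the size of the table of covers are computed in time polynomial in `scale`. -/
theorem exists_prologue : ∃ (p : RProg Cell) (T : List Cell → ℕ), PolyBdd scale T ∧
    ∀ l, Runs p (Tapes.data ⟨l, []⟩, fun _ => 0) (Tapes.data ⟨l, []⟩,
      Function.update (Function.update (Function.update (fun _ => 0) 0 (param l)) 1
        (4 ^ param l)) 2 (tableSize l)) (T l) := by
  obtain ⟨P, T, hT, hP⟩ := compIn_param (α := Tapes Cell)
  obtain ⟨Q, U, hU, hQ⟩ := compIn_pow (α := Tapes Cell)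
  obtain ⟨R, V, hV, hR⟩ := polyComp_place (α := (Tapes Cell × ℕ) × ℕ) polyComp_length.succ
    PolyComp.var PolyComp.var.weaken.succ (PolyComp.const 0) (PolyComp.const 0)
  have hs : ∀ {X : List Cell → ℕ}, (∀ l, X l ≤ scale l) → PolyBdd scale X := PolyBdd.of_le
  have hlen : PolyBdd scale List.length := hs fun l => Nat.le_add_right _ _
  have hpar := hs param_le_scale
  have hpow : PolyBdd scale fun l => 4 ^ param l := hs fun l => Nat.le_add_left _ _
  refine ⟨(P id 0).seq ((Q (consSeq 0 id) 1).seq (R (consSeq 1 (consSeq 0 id)) 2)),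
    fun l => T ⟨l, []⟩ + (U (⟨l, []⟩, param l) + V ((⟨l, []⟩, param l), 4 ^ param l)),
    (hT.of_comp (fun l => ⟨l, []⟩) (hlen.add hpar)).add
      ((hU.of_comp (fun l => (⟨l, []⟩, param l)) ((hlen.add hpar).add hpow)).add
        (hV.of_comp (fun l => (((⟨l, []⟩ : Tapes Cell), param l), 4 ^ param l))
          ((hlen.add hpar).add hpow))),
    fun l => ?_⟩
  have h0 : Holds (⟨l, []⟩ : Tapes Cell) id 0 fun _ => 0 :=
    ⟨fun i hi => absurd hi (Nat.not_lt_zero i), fun _ _ => rfl⟩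
  have h1 := h0.push (param l)
  have h2 := h1.push (4 ^ param l)
  exact (hP _ _ _ _ h0).seq ((hQ _ _ _ _ h1).seq (hR _ _ _ _ h2))

/-- The values of the counters while the table of covers is computed. -/
def counters (l : List Cell) (i r : ℕ) : ℕ → ℕ :=
  Function.update (Function.update (Function.update (Function.update (fun _ => 0) 0 (param l)) 1
    (4 ^ param l)) 3 i) 2 r

theorem exists_tableProg : ∃ (p : RProg Cell) (T : List Cell → ℕ), PolyBdd scale T ∧
    ∀ l, Runs p (Tapes.data ⟨l, []⟩, counters l 0 (tableSize l))
      (Tapes.data ⟨l, table l (param l) (4 ^ param l) (tableSize l)⟩,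
        counters l (tableSize l) 0) (T l) := by
  classical
  obtain ⟨P, T, ⟨c, hT⟩, hP⟩ := polyDec_newEntry (α := ((Tapes Cell × ℕ) × ℕ) × ℕ)
    PolyComp.var.weaken.weaken PolyComp.var.weaken PolyComp.var
  -- Bounds the time for any entry: the current table length and the index are both at most
  -- `tableSize l`.
  set W : List Cell → ℕ := fun l =>
    (l.length + tableSize l + param l + 4 ^ param l + tableSize l + 2) ^ c with hW
  have hc := PolyBdd.const scale
  have hWb : PolyBdd scale W := by
    refine PolyBdd.pow (.add (.add (.add (.add (.add ?_ polyBdd_tableSize) ?_) ?_)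
      polyBdd_tableSize) (hc 2)) c
    · exact PolyBdd.of_le fun l => Nat.le_add_right _ _
    · exact PolyBdd.of_le param_le_scale
    · exact PolyBdd.of_le fun l => Nat.le_add_left _ _
  refine ⟨times 2 ((P (consSeq 3 (consSeq 1 (consSeq 0 id))) 4).seq
    ((ifZero 4 (pushSymbol 1 (some (Sum.inr false))) (pushSymbol 1 (some (Sum.inr true)))).seq
      ((clear 4).seq (incr 3)))),
    -- The `10` is `4` for the branch with its push, at most `5` for clearing a bit and `1` for the
    -- index; the rest is the overhead of `times`.
    fun l => tableSize l * (W l + 10 + 2) + 2,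
    (polyBdd_tableSize.mul ((hWb.add (hc _)).add (hc _))).add (hc _), fun l => ?_⟩
  refine runs_times (fun i => Tapes.data ⟨l, table l (param l) (4 ^ param l) i⟩)
    (fun i => counters l i 0) (fun j hj => ?_) |>.congr
    (fun r => by unfold counters; rw [Function.update_idem])
    (fun r => by unfold counters; rw [Function.update_idem]) le_rfl
  have hcount : ∀ i, Function.update (counters l i 0) 2 (tableSize l - 1 - j) =
      counters l i (tableSize l - 1 - j) := fun i => Function.update_idem _ _ _
  rw [hcount, hcount]
  set r := tableSize l - 1 - j with hr
  set t := table l (param l) (4 ^ param l) j with ht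
  have hh : Holds (((((⟨l, t⟩ : Tapes Cell), param l), 4 ^ param l), j) :
      ((Tapes Cell × ℕ) × ℕ) × ℕ) (consSeq 3 (consSeq 1 (consSeq 0 id))) 4 (counters l j r) := by
    refine ⟨fun i hi => ?_, fun i hi => ?_⟩
    · match i, hi with
      | 0, _ => exact ⟨by simp [consSeq], rfl⟩
      | 1, _ => exact ⟨by simp [consSeq], rfl⟩
      | 2, _ => exact ⟨by simp [consSeq], rfl⟩
      | i + 3, hi => exact absurd hi (by simp [Ctx.arity])
    · unfold counters
      grind [Function.update_apply]
  have z : counters l j r 4 = 0 := hh.2 4 le_rfl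
  have e1 := hP _ _ _ _ hh
  set e : ℕ := if NewEntry l t (param l) (4 ^ param l) j then 1 else 0 with he
  have e2 : Runs (ifZero 4 (pushSymbol 1 (some (Sum.inr false)))
      (pushSymbol 1 (some (Sum.inr true)))) (Tapes.data ⟨l, t⟩,
        Function.update (counters l j r) 4 e)
      (Tapes.data ⟨l, table l (param l) (4 ^ param l) (j + 1)⟩,
        Function.update (counters l j r) 4 e) (1 + 3) := by
    have push : ∀ b : Bool, b = decide (NewEntry l t (param l) (4 ^ param l) j) →
        Runs (pushSymbol 1 (some (Sum.inr b))) (Tapes.data ⟨l, t⟩,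
          Function.update (counters l j r) 4 e)
        (Tapes.data ⟨l, table l (param l) (4 ^ param l) (j + 1)⟩,
          Function.update (counters l j r) 4 e) 1 := by
      intro b hb
      have := runs_pushSymbol 1 (some (Sum.inr b)) (Tapes.data ⟨l, t⟩)
        (Function.update (counters l j r) 4 e)
      rw [update_data] at this
      rw [table, ← ht]
      convert this using 7
      · rw [hb]
      · rfl
    refine runs_ifZero (fun h => push _ ?_) (fun h => push _ ?_)
    · rw [Function.update_self] at h
      by_cases hn : NewEntry l t (param l) (4 ^ param l) j
      · rw [he, if_pos hn] at h
        omega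
      · exact (decide_eq_false hn).symm
    · rw [Function.update_self] at h
      by_cases hn : NewEntry l t (param l) (4 ^ param l) j
      · exact (decide_eq_true hn).symm
      · rw [he, if_neg hn] at h
        omega
  have hTW : T ((((⟨l, t⟩ : Tapes Cell), param l), 4 ^ param l), j) ≤ W l := by
    refine (hT _).trans (Nat.pow_le_pow_left ?_ c)
    show l.length + t.length + param l + 4 ^ param l + j + 2 ≤ _
    rw [ht, length_table]
    omega
  have he1 : e ≤ 1 := by rw [he]; split_ifs <;> omega
  refine (e1.seq (e2.seq ((runs_clear 4 _ _).seq (runs_incr 3 _ _)))).congr (fun _ => rfl)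
    (fun x => ?_) ?_
  · unfold counters at z ⊢
    grind [Function.update_apply]
  · refine Nat.add_le_add hTW ?_
    rw [Function.update_self]
    omega

open Classical in
theorem exists_program : ∃ (p : RProg Cell) (T : List Cell → ℕ), PolyBdd scale T ∧
    ∀ l, ∃ n ≤ T l, p.Exec (none, stk [] (Tapes.data ⟨l, []⟩) fun _ => 0)
      (none, stk [decide (Answer l (table l (param l) (4 ^ param l) (tableSize l)) (param l)
        (4 ^ param l))] (fun _ => []) fun _ => 0) n := by
  obtain ⟨P, T, hT, hP⟩ := exists_prologue
  obtain ⟨Q, U, hU, hQ⟩ := exists_tableProg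
  obtain ⟨R, V, hV, hR⟩ := polyDec_answer (α := (Tapes Cell × ℕ) × ℕ)
    PolyComp.var.weaken PolyComp.var
  have hc := PolyBdd.const scale
  have hlen : PolyBdd scale List.length := PolyBdd.of_le fun l => Nat.le_add_right _ _
  have hpar := PolyBdd.of_le param_le_scale
  have hpow : PolyBdd scale fun l => 4 ^ param l := PolyBdd.of_le fun l => Nat.le_add_left _ _
  have hV' : PolyBdd scale fun l =>
      V (((⟨l, table l (param l) (4 ^ param l) (tableSize l)⟩ : Tapes Cell), param l),
        4 ^ param l) := by
    refine hV.of_comp (fun l => ((⟨l, table l (param l) (4 ^ param l) (tableSize l)⟩, param l),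
      4 ^ param l)) (((hlen.add polyBdd_tableSize).add hpar).add hpow |>.mono fun l => ?_)
    show l.length + (table l (param l) (4 ^ param l) (tableSize l)).length + _ + _ ≤ _
    rw [length_table]
  -- The clearing prepares the halting configuration; counter `2` has already been counted down to
  -- zero by the table loop.
  refine ⟨P.seq (Q.seq ((R (consSeq 1 (consSeq 0 id)) 4).seq (((clear 0).seq ((clear 1).seq
    ((clear 3).seq ((wipe 0).seq (wipe 1))))).seq (report 4)))),
    fun l => T l + (U l + (V (((⟨l, table l (param l) (4 ^ param l) (tableSize l)⟩ :
      Tapes Cell), param l), 4 ^ param l) + (((param l * 3 + 2) + ((4 ^ param l * 3 + 2) +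
        ((tableSize l * 3 + 2) + ((l.length * 2 + 2) + (tableSize l * 2 + 2))))) + 3))),
    hT.add (hU.add (hV'.add (PolyBdd.add (((hpar.mul (hc _)).add (hc _)).add
      (((hpow.mul (hc _)).add (hc _)).add (((polyBdd_tableSize.mul (hc _)).add (hc _)).add
        (((hlen.mul (hc _)).add (hc _)).add ((polyBdd_tableSize.mul (hc _)).add (hc _))))))
          (hc 3)))), fun l => ?_⟩
  set t := table l (param l) (4 ^ param l) (tableSize l) with ht
  set b := decide (Answer l t (param l) (4 ^ param l)) with hb
  have hh : Holds ((((⟨l, t⟩ : Tapes Cell), param l), 4 ^ param l) : (Tapes Cell × ℕ) × ℕ)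
      (consSeq 1 (consSeq 0 id)) 4 (counters l (tableSize l) 0) := by
    refine ⟨fun i hi => ?_, fun i hi => ?_⟩
    · match i, hi with
      | 0, _ => exact ⟨by simp [consSeq], rfl⟩
      | 1, _ => exact ⟨by simp [consSeq], rfl⟩
      | i + 2, hi => exact absurd hi (by simp [Ctx.arity])
    · unfold counters
      grind [Function.update_apply]
  have h1 := (hP l).congr (fun _ => rfl) (τ' := counters l 0 (tableSize l)) (fun x => by
    unfold counters
    grind [Function.update_apply]) le_rfl
  have h2 := hQ l
  have h3 := hR _ _ _ _ hh
  have h4 : Runs ((clear 0).seq ((clear 1).seq ((clear 3).seq ((wipe 0).seq (wipe 1)))))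
      (Tapes.data ⟨l, t⟩, Function.update (counters l (tableSize l) 0) 4 b.toNat)
      (fun _ => [], Function.update (fun _ => 0) 4 b.toNat) ((param l * 3 + 2) +
        ((4 ^ param l * 3 + 2) + ((tableSize l * 3 + 2) + ((l.length * 2 + 2) +
          (tableSize l * 2 + 2))))) := by
    have e := (runs_clear 0 (Tapes.data ⟨l, t⟩)
      (Function.update (counters l (tableSize l) 0) 4 b.toNat)).seq ((runs_clear 1 _ _).seq
        ((runs_clear 3 _ _).seq ((runs_wipe 0 _ _).seq (runs_wipe 1 _ _))))
    have e' : Function.update (Function.update (Tapes.data ⟨l, t⟩) 0 []) 1 [] =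
        fun _ => ([] : List Cell) := by
      funext i
      match i with
      | 0 => rfl
      | 1 => rfl
      | 2 => rfl
    rw [e'] at e
    refine e.congr (fun _ => rfl) (fun x => ?_) ?_
    · unfold counters
      grind [Function.update_apply]
    · have : t.length = tableSize l := length_table _ _ _ _
      rw [← this]
      exact le_rfl
  have h5 : Function.update (counters l (tableSize l) 0) 4 b.toNat =
      Function.update (counters l (tableSize l) 0) 4
        (if Answer l t (param l) (4 ^ param l) then 1 else 0) := by
    congr 1
    by_cases h : Answer l t (param l) (4 ^ param l) <;> simp [hb, h]
  rw [h5] at h4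
  obtain ⟨v1, n1, hn1, he1⟩ := h1 none
  obtain ⟨v2, n2, hn2, he2⟩ := h2 v1
  obtain ⟨v3, n3, hn3, he3⟩ := h3 v2
  obtain ⟨v4, n4, hn4, he4⟩ := h4 v3
  have he5 := exec_report 4 (fun _ => ([] : List Cell))
    (Function.update (fun _ => 0) 4 b.toNat) v4 b (Function.update_self _ _ _)
  rw [Function.update_idem, Function.update_eq_self] at he5
  exact ⟨_, Nat.add_le_add hn1 (Nat.add_le_add hn2 (Nat.add_le_add hn3 (Nat.add_le_add hn4 le_rfl))),
    he1.seq (he2.seq (he3.seq (he4.seq he5)))⟩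

theorem computable_bound (c : ℕ) : Computable fun k => (4 ^ k + 4) ^ c := by
  have pow : Primrec₂ fun m n : ℕ => m ^ n := Primrec₂.unpaired'.1 Nat.Primrec.pow
  exact (pow.comp (Primrec.nat_add.comp (pow.comp (Primrec.const 4) Primrec.id) (Primrec.const 4))
    (Primrec.const c)).to_comp

end SASPlus

theorem mainTheorem2 :
    FixedParameterTractable (SASPlus.boundedPlanning 0 2) := by
  classical
  obtain ⟨p, T, hT, hp⟩ := SASPlus.exists_program
  -- The additional `1` is the halting step.
  obtain ⟨c, hc⟩ := hT.add (StackProg.PolyBdd.const _ 1)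
  obtain ⟨M, hM⟩ := StackProg.exists_machine p
  refine ⟨M, fun k => (4 ^ k + 4) ^ c, c, SASPlus.computable_bound c, fun w k => ?_⟩
  have hk := SASPlus.param_pairInput w k
  set l := pairInput w k with hl
  obtain ⟨n, hn, he⟩ := hp l
  refine ⟨_, ?_, hM l _ n _ he ?_⟩
  · rw [decide_eq_true_iff, SASPlus.tableSize, hk]
    refine SASPlus.answer_iff (t := (Computability.encodeNat k).map fun b => some (Sum.inr b))
      (fun s hs => ?_) k rfl
    obtain ⟨b, _, hb⟩ := List.mem_map.1 hs
    cases hb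
  · have h1 : 1 ≤ l.length := by
      simp only [hl, pairInput, List.length_append, List.length_cons]
      omega
    refine (Nat.add_le_add_right hn 1).trans ((hc l).trans ?_)
    -- The sum `l.length + 4 ^ k + 2` is at most `(4 ^ k + 4) * l.length` as the input is nonempty,
    -- which separates the parameter from the length.
    rw [← Nat.mul_pow]
    refine Nat.pow_le_pow_left ?_ c
    show l.length + 4 ^ SASPlus.param l + 2 ≤ _
    rw [hk]
    nlinarith [Nat.mul_le_mul_left (4 ^ k) h1]
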